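/- An \emph{office-like polygon} $P$ is a connected region of the plane that is the union of finitely many pairwise disjoint closed axis-parallel rectangles (\emph{rooms}) and finitely many pairwise disjoint closed axis-parallel rectangles (\emph{corridors}), all of positive width and height and with real coordinates, such that every corridor links exactly two rooms: two opposite sides of the corridor are strictly contained (without touching an endpoint) in edges of the two rooms, which lie outside the corridor on opposite sides of it, and the corridor is disjoint from all other rooms. The \emph{vertices} of $P$ are the corners of its rooms and corridors; $n$ denotes their number. $P$ is \emph{without holes} if its complement in the plane is connected. Two points $p,q$ \emph{see} each other ($r$-visibility) if the axis-parallel rectangle spanned by $p$ and $q$ is contained in $P$. $P$ is \emph{independent} if for any two different corridors $C_1,C_2$ no vertex of $C_1$ sees all of $C_2$. A \emph{vertex guard set} is a set of vertices of $P$ such that every point of $P$ is seen by at least one of them; its \emph{dispersion distance} is the minimum, over all pairs of distinct guards, of the geodesic $L_1$-distance inside $P$ (the infimum of the $L_1$-lengths of polygonal paths in $P$ between the two guards), and it is $+\infty$ if there is only one guard. \textbf{Theorem.} There is an algorithm that, given an independent office-like polygon without holes with $n$ vertices (as the list of its rooms and the list of its corridors, in arbitrary order, each rectangle by its coordinates),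 computes a vertex guard set whose dispersion distance is maximum among all vertex guard sets, in time $O(n^5\log^2 n)$, in particular in polynomial time. Here time is the number of elementary steps of a random access machine whose memory holds natural numbers (used for control and addressing) and real numbers, with unit-cost assignment, indexed access, addition, subtraction and comparison, and with integer constants only. -/

import Mathlib

open Set

noncomputable section

namespace Gallery

/-! ### Office-like polygons -/

/-- A non-degenerate axis-parallel rectangle `[x₀, x₁] × [y₀, y₁]`. -/
structure Rect where
  x₀ : ℝ
  x₁ : ℝ
  y₀ : ℝ
  y₁ : ℝ
  hx : x₀ < x₁
  hy : y₀ < y₁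

/-- The closed rectangle as a subset of the plane. -/
def Rect.toSet (r : Rect) : Set (ℝ × ℝ) := Icc r.x₀ r.x₁ ×ˢ Icc r.y₀ r.y₁

/-- The four corners of a rectangle. -/
def Rect.corners (r : Rect) : Finset (ℝ × ℝ) :=
  {(r.x₀, r.y₀), (r.x₀, r.y₁), (r.x₁, r.y₀), (r.x₁, r.y₁)}

/-- `c` is a horizontal corridor from the room `a` on its left to the room `b` on its right:
its left (right) side is strictly contained in the right edge of `a` (left edge of `b`). -/
def Rect.LinksHorizontally (c a b : Rect) : Prop :=
  c.x₀ = a.x₁ ∧ c.x₁ = b.x₀ ∧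
    a.y₀ < c.y₀ ∧ c.y₁ < a.y₁ ∧ b.y₀ < c.y₀ ∧ c.y₁ < b.y₁

/-- `c` is a vertical corridor from the room `a` below it to the room `b` above it. -/
def Rect.LinksVertically (c a b : Rect) : Prop :=
  c.y₀ = a.y₁ ∧ c.y₁ = b.y₀ ∧
    a.x₀ < c.x₀ ∧ c.x₁ < a.x₁ ∧ b.x₀ < c.x₀ ∧ c.x₁ < b.x₁

/-- An office-like polygon: finitely many disjoint rectangular rooms and disjoint rectangular
corridors, each corridor joining exactly two rooms, with connected union. -/
structure OfficePolygon where
  numRooms : ℕ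
  numCorridors : ℕ
  room : Fin numRooms → Rect
  corridor : Fin numCorridors → Rect
  rooms_disjoint : ∀ i i', i ≠ i' → Disjoint (room i).toSet (room i').toSet
  corridors_disjoint : ∀ j j', j ≠ j' → Disjoint (corridor j).toSet (corridor j').toSet
  links : ∀ j, ∃ a b,
    ((corridor j).LinksHorizontally (room a) (room b) ∨
      (corridor j).LinksVertically (room a) (room b)) ∧
    ∀ i, i ≠ a → i ≠ b → Disjoint (corridor j).toSet (room i).toSet
  connected : IsConnected ((⋃ i, (room i).toSet) ∪ ⋃ j, (corridor j).toSet)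

namespace OfficePolygon

variable (P : OfficePolygon)

/-- The closed region of the plane covered by the polygon. -/
def region : Set (ℝ × ℝ) := (⋃ i, (P.room i).toSet) ∪ ⋃ j, (P.corridor j).toSet

/-- The vertices of the polygon: the (convex) corners of the rooms and the (reflex) corners of
the corridors. -/
def vertices : Finset (ℝ × ℝ) :=
  (Finset.univ.biUnion fun i => (P.room i).corners) ∪
    (Finset.univ.biUnion fun j => (P.corridor j).corners)

/-- The number `n` of vertices. -/
def numVertices : ℕ := P.vertices.card

/-- The polygon has no holes: its complement in the plane is connected. -/
def HoleFree : Prop := IsPreconnected (P.region)ᶜ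

/-- `r`-visibility: the axis-parallel rectangle spanned by `p` and `q` lies in the polygon. -/
def Sees (p q : ℝ × ℝ) : Prop := uIcc p.1 q.1 ×ˢ uIcc p.2 q.2 ⊆ P.region

/-- No guard on a vertex of a corridor also guards (sees all of) a different corridor. -/
def Independent : Prop :=
  ∀ j j', j ≠ j' → ∀ g ∈ (P.corridor j).corners,
    ¬ ∀ q ∈ (P.corridor j').toSet, P.Sees g q

/-- A vertex guard set: a set of vertices that together see every point of the polygon. -/
def IsGuardSet (S : Set (ℝ × ℝ)) : Prop :=
  S ⊆ ↑P.vertices ∧ ∀ p ∈ P.region, ∃ g ∈ S, P.Sees g p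

/-- `z 0, …, z k` are the successive corners of a polygonal path inside the polygon
from `p` to `q`. -/
def IsPath (p q : ℝ × ℝ) (k : ℕ) (z : ℕ → ℝ × ℝ) : Prop :=
  z 0 = p ∧ z k = q ∧ ∀ i < k, segment ℝ (z i) (z (i + 1)) ⊆ P.region

end OfficePolygon

/-- The `L₁`-distance in the plane. -/
def l1Dist (p q : ℝ × ℝ) : ℝ := |p.1 - q.1| + |p.2 - q.2|

/-- The `L₁`-length of the polygonal path with successive corners `z 0, …, z k`. -/
def pathLength (k : ℕ) (z : ℕ → ℝ × ℝ) : ℝ := ∑ i ∈ Finset.range k, l1Dist (z i) (z (i + 1))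

namespace OfficePolygon

variable (P : OfficePolygon)

/-- The geodesic `L₁`-distance `δ(p, q)` inside the polygon. -/
def geodesicDist (p q : ℝ × ℝ) : ENNReal :=
  ⨅ (k : ℕ) (z : ℕ → ℝ × ℝ) (_ : P.IsPath p q k z), ENNReal.ofReal (pathLength k z)

/-- The dispersion distance of a set of guards: the minimum geodesic distance of two distinct
guards (`∞` if there is only one guard). -/
def dispersion (S : Set (ℝ × ℝ)) : ENNReal :=
  ⨅ (p ∈ S) (q ∈ S) (_ : p ≠ q), P.geodesicDist p q

/-- `S` is a vertex guard set of maximum dispersion distance. -/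
def IsOptimalGuardSet (S : Set (ℝ × ℝ)) : Prop :=
  P.IsGuardSet S ∧ ∀ S', P.IsGuardSet S' → P.dispersion S' ≤ P.dispersion S

end OfficePolygon

/-! ### A random access machine with real registers

Programs manipulate natural numbers (used for control and as addresses) and real numbers. Both
come in scalar registers and in finitely many (per program) arrays of unbounded length with
indexed access. The only arithmetic is addition and subtraction, the only constants are integers,
and the only way to get information out of a real number is a comparison. Every elementary
operation costs one step. -/

/-- A memory configuration. -/
structure State where
  natReg : ℕ → ℕ
  realReg : ℕ → ℝ
  natArr : ℕ → ℕ → ℕ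
  realArr : ℕ → ℕ → ℝ

/-- Expressions of natural-number type; `sub` is truncated subtraction, and `get a e` reads
entry `e` of the array with name `a`. -/
inductive NatExpr where
  | lit (k : ℕ)
  | reg (v : ℕ)
  | get (a : ℕ) (e : NatExpr)
  | add (e f : NatExpr)
  | sub (e f : NatExpr)

def NatExpr.eval (s : State) : NatExpr → ℕ
  | lit k => k
  | reg v => s.natReg v
  | get a e => s.natArr a (e.eval s)
  | add e f => e.eval s + f.eval s
  | sub e f => e.eval s - f.eval s

/-- The number of elementary operations in an evaluation. -/
def NatExpr.cost : NatExpr → ℕ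
  | lit _ => 1
  | reg _ => 1
  | get _ e => e.cost + 1
  | add e f => e.cost + f.cost + 1
  | sub e f => e.cost + f.cost + 1

/-- Expressions of real type. -/
inductive RealExpr where
  | lit (k : ℤ)
  | reg (v : ℕ)
  | get (a : ℕ) (e : NatExpr)
  | add (e f : RealExpr)
  | sub (e f : RealExpr)

def RealExpr.eval (s : State) : RealExpr → ℝ
  | lit k => k
  | reg v => s.realReg v
  | get a e => s.realArr a (e.eval s)
  | add e f => e.eval s + f.eval s
  | sub e f => e.eval s - f.eval s

def RealExpr.cost : RealExpr → ℕ
  | lit _ => 1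
  | reg _ => 1
  | get _ e => e.cost + 1
  | add e f => e.cost + f.cost + 1
  | sub e f => e.cost + f.cost + 1

/-- Tests. -/
inductive Test where
  | natLt (e f : NatExpr)
  | realLt (e f : RealExpr)
  | not (b : Test)
  | and (b c : Test)

def Test.eval (s : State) : Test → Prop
  | natLt e f => e.eval s < f.eval s
  | realLt e f => e.eval s < f.eval s
  | not b => ¬ b.eval s
  | and b c => b.eval s ∧ c.eval s

def Test.cost : Test → ℕ
  | natLt e f => e.cost + f.cost + 1
  | realLt e f => e.cost + f.cost + 1
  | not b => b.cost + 1
  | and b c => b.cost + c.cost + 1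

/-- Programs: assignments to registers and array entries, sequencing, branching and
while-loops. -/
inductive Program where
  | skip
  | setNat (v : ℕ) (e : NatExpr)
  | setReal (v : ℕ) (e : RealExpr)
  | storeNat (a : ℕ) (i : NatExpr) (e : NatExpr)
  | storeReal (a : ℕ) (i : NatExpr) (e : RealExpr)
  | seq (c d : Program)
  | cond (b : Test) (c d : Program)
  | loop (b : Test) (c : Program)

/-- `Exec c s s' t`: started in the memory configuration `s`, the program `c` halts in the
configuration `s'` after exactly `t` steps. -/
inductive Exec : Program → State → State → ℕ → Prop where
  | skip (s : State) : Exec .skip s s 1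
  | setNat (v : ℕ) (e : NatExpr) (s : State) :
      Exec (.setNat v e) s
        { s with natReg := Function.update s.natReg v (e.eval s) } (e.cost + 1)
  | setReal (v : ℕ) (e : RealExpr) (s : State) :
      Exec (.setReal v e) s
        { s with realReg := Function.update s.realReg v (e.eval s) } (e.cost + 1)
  | storeNat (a : ℕ) (i e : NatExpr) (s : State) :
      Exec (.storeNat a i e) s
        { s with natArr :=
            Function.update s.natArr a (Function.update (s.natArr a) (i.eval s) (e.eval s)) }
        (i.cost + e.cost + 1)
  | storeReal (a : ℕ) (i : NatExpr) (e : RealExpr) (s : State) :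
      Exec (.storeReal a i e) s
        { s with realArr :=
            Function.update s.realArr a (Function.update (s.realArr a) (i.eval s) (e.eval s)) }
        (i.cost + e.cost + 1)
  | seq {c d : Program} {s s' s'' : State} {t t' : ℕ} (h : Exec c s s' t)
      (h' : Exec d s' s'' t') : Exec (.seq c d) s s'' (t + t')
  | condTrue {b : Test} {c d : Program} {s s' : State} {t : ℕ} (hb : b.eval s)
      (h : Exec c s s' t) : Exec (.cond b c d) s s' (b.cost + 1 + t)
  | condFalse {b : Test} {c d : Program} {s s' : State} {t : ℕ} (hb : ¬ b.eval s)
      (h : Exec d s s' t) : Exec (.cond b c d) s s' (b.cost + 1 + t)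
  | loopDone {b : Test} {c : Program} {s : State} (hb : ¬ b.eval s) :
      Exec (.loop b c) s s (b.cost + 1)
  | loopStep {b : Test} {c : Program} {s s' s'' : State} {t t' : ℕ} (hb : b.eval s)
      (h : Exec c s s' t) (h' : Exec (.loop b c) s' s'' t') :
      Exec (.loop b c) s s'' (b.cost + 1 + t + t')

/-! ### Input and output -/

/-- A function on `Fin m` as an array, with zeros behind its last entry. -/
def toArray {m : ℕ} (f : Fin m → ℝ) (i : ℕ) : ℝ := if h : i < m then f ⟨i, h⟩ else 0

/-- The initial memory: registers `0` and `1` hold the numbers of rooms and of corridors, the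
arrays `0, 1, 2, 3` hold the coordinates `x₀, x₁, y₀, y₁` of the rooms, and the arrays
`4, 5, 6, 7` those of the corridors, in arbitrary order. Everything else is zero. -/
def OfficePolygon.input (P : OfficePolygon) : State where
  natReg := fun v => match v with
    | 0 => P.numRooms
    | 1 => P.numCorridors
    | _ => 0
  realReg := fun _ => 0
  natArr := fun _ _ => 0
  realArr := fun a => match a with
    | 0 => toArray fun i => (P.room i).x₀
    | 1 => toArray fun i => (P.room i).x₁
    | 2 => toArray fun i => (P.room i).y₀
    | 3 => toArray fun i => (P.room i).y₁
    | 4 => toArray fun j => (P.corridor j).x₀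
    | 5 => toArray fun j => (P.corridor j).x₁
    | 6 => toArray fun j => (P.corridor j).y₀
    | 7 => toArray fun j => (P.corridor j).y₁
    | _ => fun _ => 0

/-- The set of points returned by a program: register `0` holds their number, and the arrays `0`
and `1` hold their first and second coordinates. -/
def State.output (s : State) : Set (ℝ × ℝ) :=
  {p | ∃ i < s.natReg 0, p = (s.realArr 0 i, s.realArr 1 i)}

end Gallery

end

/-! The geometry is reduced to a combinatorial problem on a tree, which is then solved exactly by
local consistency.

Reduction. In an independent polygon a set of vertices is a guard set if and only if it meets every
room and every corridor (`Independent.isGuardSet_iff`): a corner of a room is seen only from that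
room, and among the vertices the centre of a corridor is seen only from the corridor. A room corner
lies in one rectangle and a corridor corner in two (`corner_mem_iff`), so the rectangles act as bags
of vertices, and two bags share at most two vertices, the corners of a mouth. Without holes the
intersection graph of the rectangles is a tree: a cycle through a corridor would separate the two
sides of that corridor in the complement, which is detected by a crossing number
(`HoleFree.not_hasCrossings`). Geodesics can be routed through vertices of the mouths
(`Independent.exists_portal`), so geodesic distances of vertices are shortest-path distances in the
graph that joins vertices of a common bag.

The problem is then to find the largest `δ` for which some set of vertices with pairwise distances
at least `δ` meets every bag. For fixed `δ`, keep the pairs of compatible vertices and repeatedly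
delete a pair for which some bag has no vertex compatible with itself and with both members. If
anything is left after as many rounds as there are bags, a solution exists (`exists_survives_iff`).
The bags are chosen from the root downwards; the difficulty is that consistency controls only pairs
of earlier choices. The lemma `majority` overcomes it: given three partial solutions, each failing
to respect at most one prescribed vertex, use in every subtree one of the three that is not the only
closest one to either of the two portals. Any conflict would pass through a portal and would already
be present inside a single one of the three solutions. By induction, pairwise solvability gives
solvability for any number of prescribed vertices (`helly`).

The program needs no search over `δ`. Its matrix stores, for each pair, the largest threshold at
which the pair survives; conjunctions become minima and existential quantifiers maxima. Afterwards
vertices are discarded greedily as long as the optimum does not drop. The vertices left form an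
inclusion-minimal feasible set, which must coincide with a solution contained in it. With `m` bags
and `4 m` vertices, one pruning takes order `m⁴` steps and is repeated for every vertex, which gives
order `m⁵`. -/

noncomputable section

namespace Gallery

/-! ### Separated hitting sets of tree-like families of bags -/

section Hitting

variable {V B : Type*}

/-- The pairs that survive `t` rounds of pruning at the threshold `δ`. -/
def Survives (d : V → V → ℝ) (δ : ℝ) (A : V → Prop) (bag : B → V → Prop) : ℕ → V → V → Prop
  -- The diagonal records whether a vertex is allowed and the other entries whether two vertices are
  -- far enough apart, so a witness may coincide with `u` or `w`.
  | 0, u, w => (u = w ∧ A u) ∨ (u ≠ w ∧ δ ≤ d u w)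
  | t + 1, u, w => Survives d δ A bag t u w ∧ ∀ k, ∃ o, bag k o ∧
      Survives d δ A bag t o o ∧ Survives d δ A bag t o u ∧ Survives d δ A bag t o w

/-- `S` consists of allowed vertices, has pairwise distances at least `δ` and meets every bag. -/
def IsSeparatedHitting (d : V → V → ℝ) (δ : ℝ) (A : V → Prop) (bag : B → V → Prop)
    (S : Set V) : Prop :=
  (∀ p ∈ S, A p) ∧ (∀ p ∈ S, ∀ q ∈ S, p ≠ q → δ ≤ d p q) ∧ ∀ k, ∃ p ∈ S, bag k p

/-- The bags form a rooted tree: bags that meet are parent and child, and they share at most two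
vertices. -/
structure BagTree (bag : B → V → Prop) where
  root : B
  parent : B → B
  depth : B → ℕ
  depth_lt : ∀ k, k ≠ root → depth (parent k) < depth k
  adj : ∀ k k' v, k ≠ k' → bag k v → bag k' v →
    (k ≠ root ∧ parent k = k') ∨ (k' ≠ root ∧ parent k' = k)
  portals : ∀ k k', k ≠ k' → ∃ c c', ∀ v, bag k v → bag k' v → v = c ∨ v = c'
  cover : ∀ v, ∃ k, bag k v

/-- `L` is the length of a walk from `p` to `q`, all of whose edges lie inside bags. -/
inductive WalkLength (bag : B → V → Prop) (w : V → V → ℝ) : V → V → ℝ → Prop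
  | edge {k : B} {p q : V} (hp : bag k p) (hq : bag k q) : WalkLength bag w p q (w p q)
  | trans {p q r : V} {L L' : ℝ} (h : WalkLength bag w p q L) (h' : WalkLength bag w q r L') :
      WalkLength bag w p r (L + L')

namespace BagTree

variable {bag : B → V → Prop} (T : BagTree bag)

/-- `k` is a descendant of `k'`. -/
def Desc (k k' : B) : Prop := Relation.ReflTransGen (fun x y => x ≠ T.root ∧ T.parent x = y) k k'

variable {T}

theorem Desc.eq_or_parent {k k' : B} (h : T.Desc k k') :
    k = k' ∨ (k ≠ T.root ∧ T.Desc (T.parent k) k') := by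
  rcases Relation.ReflTransGen.cases_head h with h | ⟨c, ⟨h1, h2⟩, h3⟩
  · exact Or.inl h
  · subst h2; exact Or.inr ⟨h1, h3⟩

/-- Each bag has a single parent, so its ancestors form a chain; subtrees are therefore nested or
disjoint. -/
theorem Desc.total {k t t' : B} (h : T.Desc k t) (h' : T.Desc k t') :
    T.Desc t t' ∨ T.Desc t' t := by
  induction h using Relation.ReflTransGen.head_induction_on with
  | refl => exact Or.inl h'
  | head hab hbc ih =>
    rcases h'.eq_or_parent with e | ⟨_, e⟩
    · subst e; exact Or.inr (Relation.ReflTransGen.head hab hbc)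
    · rw [hab.2] at e; exact ih e

/-- The edge from `k` to its parent is the only tree edge that leaves the subtree of `k`, so a
vertex with bags on both sides must belong to both ends of this edge. -/
theorem crossing {k k₁ k₂ : B} {v : V} (h₁ : bag k₁ v) (h₂ : bag k₂ v) (hk₁ : T.Desc k₁ k)
    (hk₂ : ¬ T.Desc k₂ k) : bag k v ∧ bag (T.parent k) v := by
  have hne : k₁ ≠ k₂ := by rintro rfl; exact hk₂ hk₁
  rcases T.adj k₁ k₂ v hne h₁ h₂ with ⟨hr, hp⟩ | ⟨hr, hp⟩
  · rcases hk₁.eq_or_parent with e | ⟨_, e⟩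
    · subst e; rw [hp]; exact ⟨h₁, h₂⟩
    · rw [hp] at e; exact absurd e hk₂
  · exact absurd (Relation.ReflTransGen.head ⟨hr, hp⟩ hk₁) hk₂

/-- The vertices shared with the parent bag separate the subtree of `k` from the rest. -/
theorem separates {d w : V → V → ℝ} (hself : ∀ u, d u u = 0)
    (htri : ∀ u v x, d u x ≤ d u v + d v x) (hw : ∀ k u v, bag k u → bag k v → d u v ≤ w u v)
    {p q : V} {L : ℝ} (hL : WalkLength bag w p q L) {k k₁ k₂ : B}
    (h₁ : bag k₁ p) (h₂ : bag k₂ q) (hk₁ : T.Desc k₁ k) (hk₂ : ¬ T.Desc k₂ k) :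
    ∃ c, bag k c ∧ bag (T.parent k) c ∧ d p c + d c q ≤ L := by
  have hle : ∀ {p q L}, WalkLength bag w p q L → d p q ≤ L := by
    intro p q L h
    induction h with
    | edge hp hq => exact hw _ _ _ hp hq
    | trans _ _ ih ih' => exact (htri _ _ _).trans (add_le_add ih ih')
  induction hL generalizing k₁ k₂ with
  | @edge k₀ p q hp hq =>
    -- The bag `k₀` of the edge lies on one side of the cut; the endpoint whose other bag lies on
    -- the opposite side is the portal.
    by_cases h : T.Desc k₀ k
    · obtain ⟨hc, hc'⟩ := crossing hq h₂ h hk₂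
      exact ⟨q, hc, hc', by rw [hself, add_zero]; exact hw _ _ _ hp hq⟩
    · obtain ⟨hc, hc'⟩ := crossing h₁ hp hk₁ h
      exact ⟨p, hc, hc', by rw [hself, zero_add]; exact hw _ _ _ hp hq⟩
  | @trans p r q L L' hl hl' ih ih' =>
    obtain ⟨k₀, hr⟩ := T.cover r
    by_cases h : T.Desc k₀ k
    · obtain ⟨c, hc, hc', hcL⟩ := ih' hr h₂ h hk₂
      exact ⟨c, hc, hc', by linarith [htri p r c, hle hl]⟩
    · obtain ⟨c, hc, hc', hcL⟩ := ih h₁ hr hk₁ h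
      exact ⟨c, hc, hc', by linarith [htri c r q, hle hl']⟩

end BagTree

/-- A total preorder on three elements has, for any two of its kind, an element that is not the
only smallest one for either of them. -/
theorem exists_not_unique_min (r : Bool → Fin 3 → Fin 3 → Prop) (tot : ∀ b i j, r b i j ∨ r b j i)
    (tr : ∀ b i j k, r b i j → r b j k → r b i k) :
    ∃ i₀, ∀ b, ∃ i₁, i₁ ≠ i₀ ∧ r b i₁ i₀ := by
  have hmin : ∀ b, ∃ m, ∀ i, r b m i := by
    intro b
    have hr : ∀ i, r b i i := fun i => by simpa using tot b i i
    obtain ⟨x, hx0, hx1⟩ : ∃ x, r b x 0 ∧ r b x 1 := by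
      rcases tot b 0 1 with h | h
      · exact ⟨0, hr 0, h⟩
      · exact ⟨1, h, hr 1⟩
    rcases tot b x 2 with h | h
    · exact ⟨x, fun i => by fin_cases i <;> assumption⟩
    · refine ⟨2, fun i => ?_⟩
      fin_cases i
      · exact tr _ _ _ _ h hx0
      · exact tr _ _ _ _ h hx1
      · exact hr 2
  choose m hm using hmin
  -- One minimum for each of the two preorders uses up at most two of the three elements; a third
  -- element works.
  have key : ∀ a b : Fin 3, ∃ c, a ≠ c ∧ b ≠ c := by decide
  obtain ⟨c, h1, h2⟩ := key (m false) (m true)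
  exact ⟨c, fun b => ⟨m b, by cases b <;> assumption, hm b c⟩⟩

/-! ### Elimination of bags: local consistency and the majority argument. -/

section Elimination

variable {bag : B → V → Prop} (T : BagTree bag) (d : V → V → ℝ) (δ : ℝ) (A : V → Prop)

/-- A separated set of allowed vertices from the bags in `E` that meets all of these bags. -/
structure PartialHitting (bag : B → V → Prop) (E : Set B) (s : Set V) : Prop where
  allowed : ∀ p ∈ s, A p
  inside : ∀ p ∈ s, ∃ k ∈ E, bag k p
  sep : ∀ p ∈ s, ∀ q ∈ s, p ≠ q → δ ≤ d p q
  hits : ∀ k ∈ E, ∃ p ∈ s, bag k p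

variable {T d δ A}

/-- Climbing from `k` towards the root must leave `E`, since the root is not in it; the last bag
before leaving is the top of the component of `k`. -/
theorem exists_top {E : Set B} (hroot : T.root ∉ E) (k : B) (hk : k ∈ E) :
    ∃ t ∈ E, T.parent t ∉ E ∧ T.Desc k t := by
  induction hn : T.depth k using Nat.strong_induction_on generalizing k with
  | _ n ih =>
    by_cases h : T.parent k ∈ E
    · have hkr : k ≠ T.root := by rintro rfl; exact hroot hk
      obtain ⟨t, h1, h2, h3⟩ := ih _ (hn ▸ T.depth_lt k hkr) _ h rfl
      exact ⟨t, h1, h2, Relation.ReflTransGen.head ⟨hkr, rfl⟩ h3⟩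
    · exact ⟨k, hk, h, Relation.ReflTransGen.refl⟩

/-- Three partial solutions, each of which misses at most one of the prescribed vertices, can be
combined into one that misses none. -/
theorem majority (hsymm : ∀ u v, d u v = d v u)
    (htri : ∀ u v x, d u x ≤ d u v + d v x)
    (hsep : ∀ p q k k₁ k₂, bag k₁ p → bag k₂ q → T.Desc k₁ k → ¬ T.Desc k₂ k →
      ∃ c, bag k c ∧ bag (T.parent k) c ∧ d p c + d c q ≤ d p q)
    {E : Set B} (hroot : T.root ∉ E) (hE : ∀ k, k ≠ T.root → T.parent k ∈ E → k ∈ E)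
    {Q : Set V} (hQ : ∀ u ∈ Q, ∀ w ∈ Q, u ≠ w → δ ≤ d u w) (hout : ∀ q ∈ Q, ∃ k, k ∉ E ∧ bag k q)
    (s : Fin 3 → Set V) (hs : ∀ i, PartialHitting d δ A bag E (s i)) (x : Fin 3 → V)
    (hx : Function.Injective x)
    (hcomp : ∀ i, ∀ q ∈ Q, q ≠ x i → ∀ p ∈ s i, p = q ∨ δ ≤ d q p) :
    ∃ s', PartialHitting d δ A bag E s' ∧ ∀ q ∈ Q, ∀ p ∈ s', p = q ∨ δ ≤ d q p := by
  have hdesc : ∀ {k t}, T.Desc k t → t ∈ E → k ∈ E := by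
    intro k t h ht
    induction h using Relation.ReflTransGen.head_induction_on with
    | refl => exact ht
    | head hab _ ih => exact hE _ hab.1 (hab.2 ▸ ih)
  -- The vertices of the component of `E` below a top bag `t`. A separate choice among the three
  -- solutions is made for each component.
  let comp : B → Set V := fun t => {p | ∃ k, T.Desc k t ∧ bag k p}
  have htop : ∀ t ∈ E, T.parent t ∉ E → ∃ i₀, ∀ c, bag t c → bag (T.parent t) c →
      ∃ i₁, i₁ ≠ i₀ ∧ ∀ p ∈ (s i₀ ∩ comp t) \ Q, ∃ p₁ ∈ (s i₁ ∩ comp t) \ Q, d p₁ c ≤ d p c := by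
    intro t ht hpt
    obtain ⟨c, c', hc⟩ := T.portals t (T.parent t) (by rintro h; exact hpt (h ▸ ht))
    -- Solution `i` precedes solution `j` at a portal if every vertex of `j` is matched by one of
    -- `i` that is no farther from the portal; this form needs no minima and allows empty sets.
    -- Vertices of `Q` are left out because their distances are controlled directly.
    obtain ⟨i₀, hi₀⟩ := exists_not_unique_min
      (fun b i j => ∀ p ∈ (s j ∩ comp t) \ Q, ∃ p₁ ∈ (s i ∩ comp t) \ Q,
        d p₁ (if b then c else c') ≤ d p (if b then c else c'))
      (by
        intro b i j
        by_contra! h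
        obtain ⟨⟨p, hp, hp'⟩, ⟨q, hq, hq'⟩⟩ := h
        exact absurd (hp' q hq) (not_lt.2 (hq' p hp).le))
      (by
        intro b i j k hij hjk p hp
        obtain ⟨q, hq, hq'⟩ := hjk p hp
        obtain ⟨r, hr, hr'⟩ := hij q hq
        exact ⟨r, hr, hr'.trans hq'⟩)
    refine ⟨i₀, fun v hv hv' => ?_⟩
    rcases hc v hv hv' with rfl | rfl
    · simpa using hi₀ true
    · simpa using hi₀ false
  choose! f hf using htop
  have hcomp' : ∀ t ∈ E, T.parent t ∉ E → ∀ q ∈ Q, ∀ p ∈ s (f t) ∩ comp t,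
      p = q ∨ δ ≤ d q p := by
    rintro t ht hpt q hq p ⟨hps, k, hkt, hkp⟩
    by_cases hpQ : p ∈ Q
    · by_cases hpq : p = q
      · exact Or.inl hpq
      · exact Or.inr (hQ q hq p hpQ (Ne.symm hpq))
    -- Only the vertex that the chosen solution disregards is critical. The route from it to `p`
    -- uses a portal to which some other solution is at least as close, and that solution respects
    -- `q`, because `x` is injective.
    by_cases hqx : q = x (f t)
    · right
      obtain ⟨k', hk', hkq⟩ := hout q hq
      obtain ⟨c, hc, hc', hcd⟩ := hsep p q t k k' hkp hkq hkt (fun h => hk' (hdesc h ht))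
      obtain ⟨i₁, hi₁, hle⟩ := hf t ht hpt c hc hc'
      obtain ⟨p₁, ⟨⟨hp₁s, _⟩, hp₁Q⟩, hp₁⟩ := hle p ⟨⟨hps, k, hkt, hkp⟩, hpQ⟩
      have := hcomp i₁ q hq (by rw [hqx]; exact fun h => hi₁ (hx h.symm)) p₁ hp₁s
      rcases this with rfl | h
      · exact absurd hq hp₁Q
      · have h1 := htri q c p₁
        rw [hsymm q c, hsymm c p₁] at h1
        rw [hsymm q p]
        linarith
    · exact hcomp (f t) q hq hqx p hps
  refine ⟨{p | ∃ t ∈ E, T.parent t ∉ E ∧ p ∈ s (f t) ∩ comp t}, ⟨?_, ?_, ?_, ?_⟩, ?_⟩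
  · rintro p ⟨t, -, -, hp, -⟩
    exact (hs _).allowed p hp
  · rintro p ⟨t, -, -, hp, -⟩
    exact (hs _).inside p hp
  · rintro p ⟨t, ht, hpt, hps, k, hkt, hkp⟩ q ⟨t', ht', hpt', hqs, k', hkt', hkq⟩ hpq
    by_cases hpQ : p ∈ Q
    · rcases hcomp' t' ht' hpt' p hpQ q ⟨hqs, k', hkt', hkq⟩ with h | h
      · exact absurd h.symm hpq
      · exact h
    by_cases hqQ : q ∈ Q
    · rcases hcomp' t ht hpt q hqQ p ⟨hps, k, hkt, hkp⟩ with h | h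
      · exact absurd h hpq
      · rwa [hsymm]
    by_cases htt : t = t'
    · subst htt; exact (hs _).sep p hps q hqs hpq
    -- Distinct top bags have disjoint subtrees: a top bag below another one would have its parent
    -- in `E`.
    have hnd : ∀ {t t' k : B}, t ≠ t' → T.parent t ∉ E → T.parent t' ∉ E → t ∈ E → t' ∈ E →
        T.Desc k t → ¬ T.Desc k t' := by
      intro t t' k hne h1 h2 h3 h4 h5 h6
      rcases h5.total h6 with h | h
      · rcases h.eq_or_parent with e | ⟨_, e⟩
        · exact hne e
        · exact h1 (hdesc e h4)
      · rcases h.eq_or_parent with e | ⟨_, e⟩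
        · exact hne e.symm
        · exact h2 (hdesc e h3)
    obtain ⟨c, hc, hc', hcd⟩ := hsep p q t k k' hkp hkq hkt
      (hnd (Ne.symm htt) hpt' hpt ht' ht hkt')
    obtain ⟨c₁, hc₁, hc₁', hcd₁⟩ := hsep q c t' k' (T.parent t) hkq hc' hkt'
      (fun h => hpt (hdesc h ht'))
    obtain ⟨i₁, hi₁, hle⟩ := hf t ht hpt c hc hc'
    obtain ⟨j₁, hj₁, hle'⟩ := hf t' ht' hpt' c₁ hc₁ hc₁'
    -- For each of the two components, two of the three solutions are close enough to the relevant
    -- portal. Two pairs out of three indices intersect, so both vertices can be replaced by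
    -- vertices of one common solution without increasing the distances to the portals.
    have hpick : ∃ i, (i = f t ∨ i = i₁) ∧ (i = f t' ∨ i = j₁) := by
      have : ∀ a b c d : Fin 3, b ≠ a → d ≠ c → ∃ i, (i = a ∨ i = b) ∧ (i = c ∨ i = d) := by decide
      exact this _ _ _ _ hi₁ hj₁
    obtain ⟨i, hi, hi'⟩ := hpick
    obtain ⟨p₁, ⟨⟨hp₁s, k₁, hk₁t, hk₁p⟩, -⟩, hp₁⟩ : ∃ p₁ ∈ (s i ∩ comp t) \ Q,
        d p₁ c ≤ d p c := by
      rcases hi with rfl | rfl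
      · exact ⟨p, ⟨⟨hps, k, hkt, hkp⟩, hpQ⟩, le_rfl⟩
      · exact hle p ⟨⟨hps, k, hkt, hkp⟩, hpQ⟩
    obtain ⟨q₁, ⟨⟨hq₁s, k₂, hk₂t, hk₂q⟩, -⟩, hq₁⟩ : ∃ q₁ ∈ (s i ∩ comp t') \ Q,
        d q₁ c₁ ≤ d q c₁ := by
      rcases hi' with rfl | rfl
      · exact ⟨q, ⟨⟨hqs, k', hkt', hkq⟩, hqQ⟩, le_rfl⟩
      · exact hle' q ⟨⟨hqs, k', hkt', hkq⟩, hqQ⟩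
    -- A vertex common to both components would lie in adjacent bags, and then one component would
    -- contain a bag of the other.
    have hne : p₁ ≠ q₁ := by
      rintro rfl
      have hkk : k₁ ≠ k₂ := by
        rintro rfl; exact hnd htt hpt hpt' ht ht' hk₁t hk₂t
      rcases T.adj k₁ k₂ p₁ hkk hk₁p hk₂q with ⟨h1, h2⟩ | ⟨h1, h2⟩
      · exact hnd (Ne.symm htt) hpt' hpt ht' ht
          (Relation.ReflTransGen.head ⟨h1, h2⟩ hk₂t) hk₁t
      · exact hnd htt hpt hpt' ht ht' (Relation.ReflTransGen.head ⟨h1, h2⟩ hk₁t) hk₂t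
    have h1 := (hs i).sep p₁ hp₁s q₁ hq₁s hne
    have h2 := htri p₁ c q₁
    have h3 := htri c c₁ q₁
    rw [hsymm c c₁, hsymm c₁ q₁] at h3
    rw [hsymm q c] at hcd₁
    linarith
  · intro k hk
    obtain ⟨t, ht, hpt, hkt⟩ := exists_top hroot k hk
    obtain ⟨p, hp, hkp⟩ := (hs (f t)).hits k hk
    exact ⟨p, ⟨t, ht, hpt, hp, k, hkt, hkp⟩, hkp⟩
  · rintro q hq p ⟨t, ht, hpt, hp⟩
    exact hcomp' t ht hpt q hq p hp

theorem Survives.base {t : ℕ} {u w : V} (h : Survives d δ A bag t u w) :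
    Survives d δ A bag 0 u w := by
  induction t with
  | zero => exact h
  | succ t ih => exact ih h.1

theorem injective_vecCons_three {a b c : V} (hab : a ≠ b) (hac : a ≠ c) (hbc : b ≠ c) :
    Function.Injective ![a, b, c] := by
  intro i j hij
  fin_cases i <;> fin_cases j <;> first | rfl | exact absurd hij ‹_› | exact absurd hij.symm ‹_›

/-- If any two of the prescribed vertices can be accommodated, then so can all of them. -/
theorem helly (hsymm : ∀ u v, d u v = d v u)
    (htri : ∀ u v x, d u x ≤ d u v + d v x)
    (hsep : ∀ p q k k₁ k₂, bag k₁ p → bag k₂ q → T.Desc k₁ k → ¬ T.Desc k₂ k →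
      ∃ c, bag k c ∧ bag (T.parent k) c ∧ d p c + d c q ≤ d p q)
    {E : Finset B} (hroot : T.root ∉ E) (hE : ∀ k, k ≠ T.root → T.parent k ∈ E → k ∈ E)
    {Q : Finset V} (hsepQ : ∀ u ∈ Q, ∀ w ∈ Q, u ≠ w → δ ≤ d u w)
    (hout : ∀ q ∈ Q, ∃ k, k ∉ E ∧ bag k q) (hne : Q.Nonempty)
    (hpair : ∀ u ∈ Q, ∀ w ∈ Q, ∃ s, PartialHitting d δ A bag (E : Set B) s ∧
        ∀ p ∈ s, (p = u ∨ δ ≤ d u p) ∧ (p = w ∨ δ ≤ d w p)) :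
    ∃ s, PartialHitting d δ A bag (E : Set B) s ∧ ∀ q ∈ Q, ∀ p ∈ s, p = q ∨ δ ≤ d q p := by
  classical
  have hall : ∀ n, ∀ Q' : Finset V, Q'.card = n → Q' ⊆ Q →
      ∃ s, PartialHitting d δ A bag (E : Set B) s ∧ ∀ q ∈ Q', ∀ p ∈ s, p = q ∨ δ ≤ d q p := by
    intro n
    induction n using Nat.strong_induction_on with
    | _ n ihn =>
      intro Q' hn hQ'
      rcases Nat.lt_or_ge 2 n with h3 | h2
      · obtain ⟨a, ha, b, hb, c, hc, hab, hac, hbc⟩ := Finset.two_lt_card.1 (hn ▸ h3)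
        have hx : ∀ i, (![a, b, c] : Fin 3 → V) i ∈ Q' := by
          intro i; fin_cases i <;> assumption
        have hone : ∀ i : Fin 3, ∃ s, PartialHitting d δ A bag (E : Set B) s ∧
            ∀ q ∈ Q'.erase (![a, b, c] i), ∀ p ∈ s, p = q ∨ δ ≤ d q p := fun i =>
          ihn (n - 1) (by omega) _ (by rw [Finset.card_erase_of_mem (hx i), hn])
            ((Finset.erase_subset _ _).trans hQ')
        choose s hs hsq using hone
        exact majority hsymm htri hsep (E := (E : Set B)) (mt Finset.mem_coe.1 hroot)
          (fun k h h' => hE k h h')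
          (Q := (Q' : Set V)) (fun u hu w hw => hsepQ u (hQ' hu) w (hQ' hw))
          (fun q hq => hout q (hQ' hq)) s hs ![a, b, c] (injective_vecCons_three hab hac hbc)
          (fun i q hq hqx p hp => hsq i q (Finset.mem_erase.2 ⟨hqx, hq⟩) p hp)
      · obtain ⟨u₀, hu₀⟩ := hne
        have hcov : ∃ u ∈ Q, ∃ w ∈ Q, ∀ q ∈ Q', q = u ∨ q = w := by
          interval_cases n
          · rw [Finset.card_eq_zero] at hn
            exact ⟨u₀, hu₀, u₀, hu₀, by simp [hn]⟩
          · obtain ⟨a, rfl⟩ := Finset.card_eq_one.1 hn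
            exact ⟨a, hQ' (by simp), a, hQ' (by simp), by simp⟩
          · obtain ⟨a, b, -, rfl⟩ := Finset.card_eq_two.1 hn
            exact ⟨a, hQ' (by simp), b, hQ' (by simp), by simp⟩
        obtain ⟨u, hu, w, hw, hcov⟩ := hcov
        obtain ⟨s, hs, hsp⟩ := hpair u hu w hw
        refine ⟨s, hs, fun q hq p hp => ?_⟩
        rcases hcov q hq with rfl | rfl
        · exact (hsp p hp).1
        · exact (hsp p hp).2
  exact hall _ Q rfl subset_rfl

/-- Every bag of `E` costs one round. For a pair `u`, `w` of prescribed vertices, survival supplies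
a witness `o` in a top bag of `E`; then `o`, `u`, `w` survive pairwise for one round less, and
induction handles the remaining bags with these three prescribed. So all pairs can be accommodated,
and `helly` passes from pairs to all of `Q`. The disjunction in the hypothesis avoids any appeal to
symmetry of survival. -/
theorem exists_partialHitting (hsymm : ∀ u v, d u v = d v u)
    (htri : ∀ u v x, d u x ≤ d u v + d v x)
    (hsep : ∀ p q k k₁ k₂, bag k₁ p → bag k₂ q → T.Desc k₁ k → ¬ T.Desc k₂ k →
      ∃ c, bag k c ∧ bag (T.parent k) c ∧ d p c + d c q ≤ d p q)
    (E : Finset B) (hroot : T.root ∉ E) (hE : ∀ k, k ≠ T.root → T.parent k ∈ E → k ∈ E)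
    (Q : Finset V) (hne : Q.Nonempty) (hout : ∀ q ∈ Q, ∃ k, k ∉ E ∧ bag k q)
    (hQ : ∀ u ∈ Q, ∀ w ∈ Q, Survives d δ A bag E.card u w ∨ Survives d δ A bag E.card w u) :
    ∃ s, PartialHitting d δ A bag (E : Set B) s ∧ ∀ q ∈ Q, ∀ p ∈ s, p = q ∨ δ ≤ d q p := by
  classical
  induction hn : E.card generalizing E Q with
  | zero =>
    rw [Finset.card_eq_zero] at hn
    subst hn
    exact ⟨∅, ⟨by simp, by simp, by simp, by simp⟩, by simp⟩
  | succ n ih =>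
    have hEne : E.Nonempty := by rw [← Finset.card_pos]; omega
    obtain ⟨k₀, hk₀⟩ := hEne
    -- Since the parent of `k` is outside `E`, removing `k` leaves a family that is still closed
    -- under taking children.
    obtain ⟨k, hk, hpk, -⟩ := exists_top (E := (E : Set B)) (by simpa using hroot) k₀ (by simpa)
    simp only [Finset.mem_coe] at hk hpk
    have hcard : (E.erase k).card = n := by rw [Finset.card_erase_of_mem hk, hn]; rfl
    have hpair : ∀ u ∈ Q, ∀ w ∈ Q, ∃ s, PartialHitting d δ A bag (E : Set B) s ∧
        ∀ p ∈ s, (p = u ∨ δ ≤ d u p) ∧ (p = w ∨ δ ≤ d w p) := by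
      intro u hu w hw
      obtain ⟨o, hko, hoo, hou, how⟩ : ∃ o, bag k o ∧ Survives d δ A bag n o o ∧
          Survives d δ A bag n o u ∧ Survives d δ A bag n o w := by
        rcases hQ u hu w hw with h | h
        · rw [hn] at h; exact h.2 k
        · rw [hn] at h
          obtain ⟨o, h1, h2, h3, h4⟩ := h.2 k
          exact ⟨o, h1, h2, h4, h3⟩
      have hmono : ∀ a ∈ Q, ∀ b ∈ Q, Survives d δ A bag n a b ∨ Survives d δ A bag n b a := by
        intro a ha b hb
        rcases hQ a ha b hb with h | h
        · rw [hn] at h; exact Or.inl h.1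
        · rw [hn] at h; exact Or.inr h.1
      obtain ⟨s, hs, hsQ⟩ := ih (E.erase k) (fun h => hroot (Finset.mem_of_mem_erase h))
        (fun k' hk' hp => Finset.mem_erase.2
          ⟨by rintro rfl; exact hpk (Finset.mem_of_mem_erase hp),
            hE k' hk' (Finset.mem_of_mem_erase hp)⟩)
        {o, u, w} (by simp)
        (by
          intro q hq
          simp only [Finset.mem_insert, Finset.mem_singleton] at hq
          rcases hq with rfl | rfl | rfl
          · exact ⟨k, by simp, hko⟩
          · obtain ⟨k', h1, h2⟩ := hout q hu
            exact ⟨k', fun h => h1 (Finset.mem_of_mem_erase h), h2⟩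
          · obtain ⟨k', h1, h2⟩ := hout q hw
            exact ⟨k', fun h => h1 (Finset.mem_of_mem_erase h), h2⟩)
        (by
          rw [hcard]
          intro a ha b hb
          simp only [Finset.mem_insert, Finset.mem_singleton] at ha hb
          rcases ha with rfl | rfl | rfl <;> rcases hb with rfl | rfl | rfl <;>
            first
            | exact hmono _ ‹_› _ ‹_›
            | exact Or.inl ‹_›
            | exact Or.inr ‹_›)
        hcard
      have hbase : ∀ {x}, Survives d δ A bag n o x → o = x ∨ δ ≤ d x o := by
        intro x hx
        rcases hx.base with ⟨h, _⟩ | ⟨_, h⟩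
        · exact Or.inl h
        · exact Or.inr (by rwa [hsymm])
      refine ⟨insert o s, ⟨?_, ?_, ?_, ?_⟩, ?_⟩
      · rintro p (rfl | hp)
        · rcases hoo.base with ⟨_, h⟩ | ⟨h, _⟩
          · exact h
          · exact absurd rfl h
        · exact hs.allowed p hp
      · rintro p (rfl | hp)
        · exact ⟨k, by simpa using hk, hko⟩
        · obtain ⟨k', h1, h2⟩ := hs.inside p hp
          exact ⟨k', (Finset.mem_erase.1 (Finset.mem_coe.1 h1)).2, h2⟩
      · rintro p (rfl | hp) q (rfl | hq) hpq
        · exact absurd rfl hpq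
        · rcases hsQ p (by simp) q hq with h | h
          · exact absurd h.symm hpq
          · exact h
        · rcases hsQ q (by simp) p hp with h | h
          · exact absurd h hpq
          · rwa [hsymm]
        · exact hs.sep p hp q hq hpq
      · intro k' hk'
        by_cases h : k' = k
        · subst h; exact ⟨o, by simp, hko⟩
        · obtain ⟨p, h1, h2⟩ := hs.hits k' (by simpa [h] using hk')
          exact ⟨p, by simp [h1], h2⟩
      · rintro p (rfl | hp)
        · exact ⟨hbase hou, hbase how⟩
        · exact ⟨hsQ u (by simp) p hp, hsQ w (by simp) p hp⟩
    have hsepQ : ∀ u ∈ Q, ∀ w ∈ Q, u ≠ w → δ ≤ d u w := by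
      intro u hu w hw huw
      rcases hQ u hu w hw with h | h
      · rcases h.base with ⟨h, _⟩ | ⟨_, h⟩
        · exact absurd h huw
        · exact h
      · rcases h.base with ⟨h, _⟩ | ⟨_, h⟩
        · exact absurd h.symm huw
        · rwa [hsymm]
    exact helly hsymm htri hsep hroot hE hsepQ hout hne hpair

/-- The elements of a solution are compatible with each other, so in every round they serve as
witnesses for each other and for any pair compatible with all of them. -/
theorem IsSeparatedHitting.survives {S : Set V} (hS : IsSeparatedHitting d δ A bag S)
    (hsymm : ∀ u v, d u v = d v u) (t : ℕ) {u w : V} (h0 : Survives d δ A bag 0 u w)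
    (hu : ∀ p ∈ S, p = u ∨ δ ≤ d u p) (hw : ∀ p ∈ S, p = w ∨ δ ≤ d w p) :
    Survives d δ A bag t u w := by
  classical
  induction t generalizing u w with
  | zero => exact h0
  | succ t ih =>
    refine ⟨ih h0 hu hw, fun k => ?_⟩
    obtain ⟨o, ho, hko⟩ := hS.2.2 k
    have hoS : ∀ p ∈ S, p = o ∨ δ ≤ d o p := fun p hp => by
      by_cases h : p = o
      · exact Or.inl h
      · exact Or.inr (hS.2.1 o ho p hp (Ne.symm h))
    have hox : ∀ x, (∀ p ∈ S, p = x ∨ δ ≤ d x p) → Survives d δ A bag 0 o x := by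
      intro x hx
      rcases hx o ho with rfl | h
      · exact Or.inl ⟨rfl, hS.1 _ ho⟩
      · by_cases hox : o = x
        · subst hox; exact Or.inl ⟨rfl, hS.1 _ ho⟩
        · exact Or.inr ⟨hox, by rwa [hsymm]⟩
    exact ⟨o, hko, ih (hox o hoS) hoS hoS, ih (hox u hu) hoS hu, ih (hox w hw) hoS hw⟩

end Elimination

/-- Pruning decides whether a separated hitting set exists. -/
theorem exists_survives_iff [Fintype B] {bag : B → V → Prop} (T : BagTree bag)
    {d w : V → V → ℝ} (δ : ℝ) (A : V → Prop) (hsymm : ∀ u v, d u v = d v u)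
    (hself : ∀ u, d u u = 0) (htri : ∀ u v x, d u x ≤ d u v + d v x)
    (hw : ∀ k u v, bag k u → bag k v → d u v ≤ w u v)
    (hwalk : ∀ u v, WalkLength bag w u v (d u v)) :
    (∃ u, Survives d δ A bag (Fintype.card B) u u) ↔ ∃ S, IsSeparatedHitting d δ A bag S := by
  classical
  have hsep : ∀ p q k k₁ k₂, bag k₁ p → bag k₂ q → T.Desc k₁ k → ¬ T.Desc k₂ k →
      ∃ c, bag k c ∧ bag (T.parent k) c ∧ d p c + d c q ≤ d p q :=
    fun p q k k₁ k₂ h₁ h₂ hk₁ hk₂ =>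
      BagTree.separates hself htri hw (hwalk p q) h₁ h₂ hk₁ hk₂
  constructor
  · rintro ⟨u, hu⟩
    have hcard : (Finset.univ.erase T.root).card + 1 = Fintype.card B := by
      rw [Finset.card_erase_of_mem (Finset.mem_univ _), Finset.card_univ]
      have : 0 < Fintype.card B := Fintype.card_pos_iff.2 ⟨T.root⟩
      omega
    rw [← hcard] at hu
    -- One round pays for the root bag and yields `y`; the remaining rounds, one for each other bag,
    -- extend `y` to a solution.
    obtain ⟨y, hy, hyy, -⟩ := hu.2 T.root
    obtain ⟨s, hs, hsy⟩ := exists_partialHitting (T := T) (A := A) (δ := δ) hsymm htri hsep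
      (Finset.univ.erase T.root) (by simp)
      (fun k hk _ => by simpa using hk) {y} (by simp)
      (by simpa using hy) (by simpa using hyy)
    have hsy : ∀ p ∈ s, p = y ∨ δ ≤ d y p := hsy y (by simp)
    have hAy : A y := by
      rcases hyy.base with ⟨_, h⟩ | ⟨h, _⟩
      · exact h
      · exact absurd rfl h
    refine ⟨insert y s, ?_, ?_, ?_⟩
    · rintro p (rfl | hp)
      · exact hAy
      · exact hs.allowed p hp
    · rintro p (rfl | hp) q (rfl | hq) hpq
      · exact absurd rfl hpq
      · exact (hsy q hq).resolve_left (Ne.symm hpq)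
      · rw [hsymm]; exact (hsy p hp).resolve_left hpq
      · exact hs.sep p hp q hq hpq
    · intro k
      by_cases h : k = T.root
      · subst h; exact ⟨y, by simp, hy⟩
      · obtain ⟨p, h1, h2⟩ := hs.hits k (by simpa using h)
        exact ⟨p, by simp [h1], h2⟩
  · rintro ⟨S, hS⟩
    obtain ⟨y, hy, -⟩ := hS.2.2 T.root
    have hyS : ∀ p ∈ S, p = y ∨ δ ≤ d y p := fun p hp => by
      by_cases h : p = y
      · exact Or.inl h
      · exact Or.inr (hS.2.1 y hy p hp (Ne.symm h))
    exact ⟨y, hS.survives hsymm _ (Or.inl ⟨rfl, hS.1 y hy⟩) hyS hyS⟩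

end Hitting

/-! ### Structured programs -/

namespace State

def setNat (s : State) (v x : ℕ) : State := { s with natReg := Function.update s.natReg v x }

def setReal (s : State) (v : ℕ) (x : ℝ) : State :=
  { s with realReg := Function.update s.realReg v x }

def setNatArr (s : State) (a i x : ℕ) : State :=
  { s with natArr := Function.update s.natArr a (Function.update (s.natArr a) i x) }

def setRealArr (s : State) (a i : ℕ) (x : ℝ) : State :=
  { s with realArr := Function.update s.realArr a (Function.update (s.realArr a) i x) }

variable (s : State) (v x w a i j b : ℕ) (y : ℝ)

@[simp] theorem setNat_natReg : (s.setNat v x).natReg w = if w = v then x else s.natReg w := by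
  simp [setNat, Function.update_apply]
@[simp] theorem setNat_realReg : (s.setNat v x).realReg = s.realReg := rfl
@[simp] theorem setNat_natArr : (s.setNat v x).natArr = s.natArr := rfl
@[simp] theorem setNat_realArr : (s.setNat v x).realArr = s.realArr := rfl

@[simp] theorem setReal_natReg : (s.setReal v y).natReg = s.natReg := rfl
@[simp] theorem setReal_realReg :
    (s.setReal v y).realReg w = if w = v then y else s.realReg w := by
  simp [setReal, Function.update_apply]
@[simp] theorem setReal_natArr : (s.setReal v y).natArr = s.natArr := rfl
@[simp] theorem setReal_realArr : (s.setReal v y).realArr = s.realArr := rfl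

@[simp] theorem setNatArr_natReg : (s.setNatArr a i x).natReg = s.natReg := rfl
@[simp] theorem setNatArr_realReg : (s.setNatArr a i x).realReg = s.realReg := rfl
@[simp] theorem setNatArr_realArr : (s.setNatArr a i x).realArr = s.realArr := rfl
@[simp] theorem setNatArr_natArr : (s.setNatArr a i x).natArr b j =
    if b = a then (if j = i then x else s.natArr a j) else s.natArr b j := by
  by_cases h : b = a
  · subst h; simp [setNatArr, Function.update_apply]
  · simp [setNatArr, h]

@[simp] theorem setRealArr_natReg : (s.setRealArr a i y).natReg = s.natReg := rfl
@[simp] theorem setRealArr_realReg : (s.setRealArr a i y).realReg = s.realReg := rfl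
@[simp] theorem setRealArr_natArr : (s.setRealArr a i y).natArr = s.natArr := rfl
@[simp] theorem setRealArr_realArr : (s.setRealArr a i y).realArr b j =
    if b = a then (if j = i then y else s.realArr a j) else s.realArr b j := by
  by_cases h : b = a
  · subst h; simp [setRealArr, Function.update_apply]
  · simp [setRealArr, h]

@[simp] theorem ite_natReg (p : Prop) [Decidable p] (s t : State) :
    (if p then s else t).natReg w = if p then s.natReg w else t.natReg w := by split_ifs <;> rfl
@[simp] theorem ite_realReg (p : Prop) [Decidable p] (s t : State) :
    (if p then s else t).realReg w = if p then s.realReg w else t.realReg w := by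
  split_ifs <;> rfl
@[simp] theorem ite_natArr (p : Prop) [Decidable p] (s t : State) :
    (if p then s else t).natArr a j = if p then s.natArr a j else t.natArr a j := by
  split_ifs <;> rfl
@[simp] theorem ite_realArr (p : Prop) [Decidable p] (s t : State) :
    (if p then s else t).realArr a j = if p then s.realArr a j else t.realArr a j := by
  split_ifs <;> rfl

end State

/-- Programs whose only loops are counting loops: `loop i b c` runs `c` with the register `i`
counting from zero up to the value of the register `b`. -/
inductive Code where
  | skip
  | nat (v : ℕ) (e : NatExpr)
  | real (v : ℕ) (e : RealExpr)
  | natA (a : ℕ) (i e : NatExpr)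
  | realA (a : ℕ) (i : NatExpr) (e : RealExpr)
  | seq (c d : Code)
  | ite (b : Test) (c d : Code)
  | loop (i b : ℕ) (c : Code)

namespace Code

def compile : Code → Program
  | skip => .skip
  | nat v e => .setNat v e
  | real v e => .setReal v e
  | natA a i e => .storeNat a i e
  | realA a i e => .storeReal a i e
  | seq c d => .seq c.compile d.compile
  | ite b c d => .cond b c.compile d.compile
  | loop i b c => .seq (.setNat i (.lit 0))
      (.loop (.natLt (.reg i) (.reg b)) (.seq c.compile (.setNat i (.add (.reg i) (.lit 1)))))

open Classical in
/-- The effect of a structured program on the memory. -/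
def den : Code → State → State
  | skip, s => s
  | nat v e, s => s.setNat v (e.eval s)
  | real v e, s => s.setReal v (e.eval s)
  | natA a i e, s => s.setNatArr a (i.eval s) (e.eval s)
  | realA a i e, s => s.setRealArr a (i.eval s) (e.eval s)
  | seq c d, s => d.den (c.den s)
  | ite b c d, s => if b.eval s then c.den s else d.den s
  | loop i b c, s =>
      (fun s' => (c.den s').setNat i ((c.den s').natReg i + 1))^[s.natReg b] (s.setNat i 0)

/-- The registers and arrays that a structured program may modify. -/
def modN : Code → List ℕ
  | nat v _ => [v]
  | seq c d => c.modN ++ d.modN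
  | ite _ c d => c.modN ++ d.modN
  | loop i _ c => i :: c.modN
  | _ => []

def modR : Code → List ℕ
  | real v _ => [v]
  | seq c d => c.modR ++ d.modR
  | ite _ c d => c.modR ++ d.modR
  | loop _ _ c => c.modR
  | _ => []

def modNA : Code → List ℕ
  | natA v _ _ => [v]
  | seq c d => c.modNA ++ d.modNA
  | ite _ c d => c.modNA ++ d.modNA
  | loop _ _ c => c.modNA
  | _ => []

def modRA : Code → List ℕ
  | realA v _ _ => [v]
  | seq c d => c.modRA ++ d.modRA
  | ite _ c d => c.modRA ++ d.modRA
  | loop _ _ c => c.modRA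
  | _ => []

/-- The registers that bound the loops of a structured program. -/
def bounds : Code → List ℕ
  | seq c d => c.bounds ++ d.bounds
  | ite _ c d => c.bounds ++ d.bounds
  | loop _ b c => b :: c.bounds
  | _ => []

/-- Loop bodies do not tamper with the counters of the loops around them. -/
def WF : Code → Bool
  | seq c d => c.WF && d.WF
  | ite _ c d => c.WF && d.WF
  | loop i _ c => !c.modN.contains i && c.WF
  | _ => true

/-- A bound for the running time, given the values of the registers that bound the loops. -/
def cost (β : ℕ → ℕ) : Code → ℕ
  | skip => 1
  | nat _ e => e.cost + 1
  | real _ e => e.cost + 1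
  | natA _ i e => i.cost + e.cost + 1
  | realA _ i e => i.cost + e.cost + 1
  | seq c d => c.cost β + d.cost β
  | ite b c d => b.cost + 1 + c.cost β + d.cost β
  -- Each iteration spends four steps on the test and four on the increment; the initialisation
  -- takes two and the final failing test four.
  | loop _ b c => β b * (c.cost β + 8) + 6

/-- The memory has changed only where the program may modify it. -/
structure Frame (c : Code) (s s' : State) : Prop where
  natReg : ∀ v, v ∉ c.modN → s'.natReg v = s.natReg v
  realReg : ∀ v, v ∉ c.modR → s'.realReg v = s.realReg v
  natArr : ∀ v, v ∉ c.modNA → s'.natArr v = s.natArr v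
  realArr : ∀ v, v ∉ c.modRA → s'.realArr v = s.realArr v

theorem Frame.rfl' (c : Code) (s : State) : Frame c s s :=
  ⟨fun _ _ => rfl, fun _ _ => rfl, fun _ _ => rfl, fun _ _ => rfl⟩

theorem Frame.trans {c : Code} {s s' s'' : State} (h : Frame c s s') (h' : Frame c s' s'') :
    Frame c s s'' :=
  ⟨fun v hv => (h'.natReg v hv).trans (h.natReg v hv),
    fun v hv => (h'.realReg v hv).trans (h.realReg v hv),
    fun v hv => (h'.natArr v hv).trans (h.natArr v hv),
    fun v hv => (h'.realArr v hv).trans (h.realArr v hv)⟩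

theorem Frame.mono {c d : Code} {s s' : State} (h : Frame c s s') (h1 : c.modN ⊆ d.modN)
    (h2 : c.modR ⊆ d.modR) (h3 : c.modNA ⊆ d.modNA) (h4 : c.modRA ⊆ d.modRA) : Frame d s s' :=
  ⟨fun v hv => h.natReg v fun h => hv (h1 h), fun v hv => h.realReg v fun h => hv (h2 h),
    fun v hv => h.natArr v fun h => hv (h3 h), fun v hv => h.realArr v fun h => hv (h4 h)⟩

theorem Frame.step {i b : ℕ} {c : Code} {s s' : State} (h : Frame c s s') (x : ℕ) :
    Frame (loop i b c) s (s'.setNat i x) := by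
  refine ⟨fun v hv => ?_, h.realReg, h.natArr, h.realArr⟩
  simp only [modN, List.mem_cons, not_or] at hv
  simp [hv.1, h.natReg v hv.2]

theorem den_frame (c : Code) (s : State) : Frame c s (c.den s) := by
  induction c generalizing s with
  | skip => exact Frame.rfl' _ _
  | nat v e => exact ⟨fun w hw => by simp_all [den, modN], fun _ _ => rfl, fun _ _ => rfl,
      fun _ _ => rfl⟩
  | real v e => exact ⟨fun _ _ => rfl, fun w hw => by simp_all [den, modR], fun _ _ => rfl,
      fun _ _ => rfl⟩
  | natA a i e => exact ⟨fun _ _ => rfl, fun _ _ => rfl,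
      fun w hw => by ext; simp_all [den, modNA], fun _ _ => rfl⟩
  | realA a i e => exact ⟨fun _ _ => rfl, fun _ _ => rfl, fun _ _ => rfl,
      fun w hw => by ext; simp_all [den, modRA]⟩
  | seq c d ihc ihd =>
    exact ((ihc s).mono (by simp [modN]) (by simp [modR]) (by simp [modNA])
      (by simp [modRA])).trans ((ihd _).mono (by simp [modN]) (by simp [modR]) (by simp [modNA])
      (by simp [modRA]))
  | ite b c d ihc ihd =>
    unfold den
    split_ifs
    · exact (ihc s).mono (by simp [modN]) (by simp [modR]) (by simp [modNA]) (by simp [modRA])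
    · exact (ihd s).mono (by simp [modN]) (by simp [modR]) (by simp [modNA]) (by simp [modRA])
  | loop i b c ih =>
    unfold den
    generalize s.natReg b = N
    induction N with
    | zero => exact (Frame.rfl' c s).step 0
    | succ N ihN =>
      rw [Function.iterate_succ_apply']
      exact ihN.trans ((ih _).step _)

/-- Reasoning about a counting loop with an invariant. -/
theorem loop_induction {i b : ℕ} {c : Code} (hi : i ∉ c.modN) (s : State)
    (I : ℕ → State → Prop) (h0 : I 0 (s.setNat i 0))
    (hstep : ∀ k s', k < s.natReg b → s'.natReg i = k → Frame (loop i b c) s s' → I k s' →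
      I (k + 1) ((c.den s').setNat i (k + 1))) :
    I (s.natReg b) ((loop i b c).den s) := by
  have key : ∀ N, N ≤ s.natReg b →
      I N ((fun s' => (c.den s').setNat i ((c.den s').natReg i + 1))^[N] (s.setNat i 0)) ∧
      ((fun s' => (c.den s').setNat i ((c.den s').natReg i + 1))^[N] (s.setNat i 0)).natReg i = N ∧
      Frame (loop i b c) s
        ((fun s' => (c.den s').setNat i ((c.den s').natReg i + 1))^[N] (s.setNat i 0)) := by
    intro N
    induction N with
    | zero => exact fun _ => ⟨h0, by simp, (Frame.rfl' c s).step 0⟩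
    | succ N ih =>
      intro hN
      obtain ⟨h1, h2, h3⟩ := ih (by omega)
      rw [Function.iterate_succ_apply']
      set s' := (fun s' => (c.den s').setNat i ((c.den s').natReg i + 1))^[N] (s.setNat i 0)
      have hk : (c.den s').natReg i = N := by rw [(den_frame c s').natReg i hi, h2]
      refine ⟨?_, by simp [hk], h3.trans ((den_frame c s').step _)⟩
      simp only [hk]
      exact hstep N s' (by omega) h2 h3 h1
  exact (key _ le_rfl).1

/-- The program does not modify its own loop bounds, so these have the values `β` at every entry to
a loop, nested loops included, and the running time can be bounded statically. -/
theorem compile_exec (β : ℕ → ℕ) (c : Code) (hwf : c.WF = true) (hb : ∀ b ∈ c.bounds, b ∉ c.modN)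
    (s : State) (hs : ∀ b ∈ c.bounds, s.natReg b = β b) :
    ∃ t ≤ c.cost β, Exec c.compile s (c.den s) t := by
  induction c generalizing s with
  | skip => exact ⟨1, le_rfl, Exec.skip s⟩
  | nat v e => exact ⟨_, le_rfl, Exec.setNat v e s⟩
  | real v e => exact ⟨_, le_rfl, Exec.setReal v e s⟩
  | natA a i e => exact ⟨_, le_rfl, Exec.storeNat a i e s⟩
  | realA a i e => exact ⟨_, le_rfl, Exec.storeReal a i e s⟩
  | seq c d ihc ihd =>
    simp only [WF, Bool.and_eq_true] at hwf
    simp only [bounds, modN, List.mem_append, not_or] at hb hs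
    obtain ⟨t, ht, h⟩ := ihc hwf.1 (fun b h => (hb b (Or.inl h)).1) s (fun b h => hs b (Or.inl h))
    obtain ⟨t', ht', h'⟩ := ihd hwf.2 (fun b h => (hb b (Or.inr h)).2) (c.den s)
      (fun b h => by rw [(den_frame c s).natReg b (hb b (Or.inr h)).1, hs b (Or.inr h)])
    exact ⟨t + t', add_le_add ht ht', Exec.seq h h'⟩
  | ite b c d ihc ihd =>
    simp only [WF, Bool.and_eq_true] at hwf
    simp only [bounds, modN, List.mem_append, not_or] at hb hs
    unfold den
    split_ifs with hbs
    · obtain ⟨t, ht, h⟩ := ihc hwf.1 (fun b h => (hb b (Or.inl h)).1) s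
        (fun b h => hs b (Or.inl h))
      exact ⟨_, by unfold cost; omega, Exec.condTrue hbs h⟩
    · obtain ⟨t, ht, h⟩ := ihd hwf.2 (fun b h => (hb b (Or.inr h)).2) s
        (fun b h => hs b (Or.inr h))
      exact ⟨_, by unfold cost; omega, Exec.condFalse hbs h⟩
  | loop i b c ih =>
    simp only [WF, Bool.and_eq_true, Bool.not_eq_true', List.contains_eq_mem,
      decide_eq_false_iff_not] at hwf
    simp only [bounds, modN, List.mem_cons, not_or] at hb hs
    have hbi := hb b (Or.inl rfl)
    have hsb := hs b (Or.inl rfl)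
    have key : ∀ N s', s'.natReg b = β b → s'.natReg i + N = β b →
        (∀ x ∈ c.bounds, s'.natReg x = β x) →
        ∃ t ≤ N * (c.cost β + 8) + 4,
          Exec (.loop (.natLt (.reg i) (.reg b))
            (.seq c.compile (.setNat i (.add (.reg i) (.lit 1))))) s'
            ((fun s' => (c.den s').setNat i ((c.den s').natReg i + 1))^[N] s') t := by
      intro N
      induction N with
      | zero =>
        intro s' h1 h2 _
        exact ⟨4, by omega, Exec.loopDone (b := .natLt (.reg i) (.reg b)) (by
          simp only [Test.eval, NatExpr.eval]; omega)⟩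
      | succ N ihN =>
        intro s' h1 h2 h3
        obtain ⟨t, ht, h⟩ := ih hwf.2 (fun x hx => (hb x (Or.inr hx)).2) s' h3
        have hf := den_frame c s'
        have hfi := hf.natReg i hwf.1
        obtain ⟨t', ht', h'⟩ := ihN ((c.den s').setNat i ((c.den s').natReg i + 1))
          (by simp [hbi.1, hf.natReg b hbi.2, h1])
          (by simp [hfi]; omega)
          (fun x hx => by
            have := hb x (Or.inr hx)
            simp [this.1, hf.natReg x this.2, h3 x hx])
        refine ⟨4 + (t + 4) + t', by ring_nf at ht' ⊢; omega, ?_⟩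
        rw [Function.iterate_succ_apply]
        exact Exec.loopStep (b := .natLt (.reg i) (.reg b))
          (by simp only [Test.eval, NatExpr.eval]; omega)
          (Exec.seq h (Exec.setNat i (.add (.reg i) (.lit 1)) _)) h'
    obtain ⟨t, ht, h⟩ := key (β b) (s.setNat i 0) (by simp [hbi.1, hsb]) (by simp)
      (fun x hx => by
        have := hb x (Or.inr hx)
        simp [this.1, hs x (Or.inr hx)])
    refine ⟨2 + t, by unfold cost; omega, ?_⟩
    unfold den
    rw [hsb]
    exact Exec.seq (Exec.setNat i (.lit 0) s) h

/-- Entry `k` of the array `a` becomes the value that `c` computes in the register `r`. -/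
def fill (i b a r : ℕ) (c : Code) : Code := loop i b (seq c (realA a (.reg i) (.reg r)))

theorem fill_spec {i b a r : ℕ} {c : Code} (hi : i ∉ c.modN) (ha : a ∉ c.modRA) (s : State)
    (F : ℕ → ℝ → Prop) (hF : ∀ k s', k < s.natReg b → s'.natReg i = k →
      Frame (fill i b a r c) s s' → F k ((c.den s').realReg r)) :
    ∀ k < s.natReg b, F k (((fill i b a r c).den s).realArr a k) := by
  refine loop_induction (by simpa [modN] using hi) s
    (fun N s' => ∀ k < N, F k (s'.realArr a k)) (by simp) ?_
  intro N s' hN hsi hfr ih k hk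
  have hfc := den_frame c s'
  simp only [den, NatExpr.eval, RealExpr.eval, State.setNat_realArr, State.setRealArr_realArr,
    if_true]
  rw [hfc.natReg i hi, hsi]
  split_ifs with h
  · rw [h]; exact hF N s' hN hsi hfr
  · rw [hfc.realArr a ha]; exact ih k (by omega)

end Code

infixr:60 " ;; " => Code.seq

/-! ### The pruning program -/

open Code

/-- The entry in row `u` and column `w` of the matrix stored in the array `a`; the array `2` of
natural numbers holds the positions at which the rows start. -/
def entry (a : ℕ) (u w : NatExpr) : RealExpr := .get a (.add (.get 2 u) w)

def natEq (e f : NatExpr) : Test := .and (.not (.natLt e f)) (.not (.natLt f e))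

/-- Row and column of the current cell. -/
def loadCell : Code := nat 10 (.get 3 (.reg 5)) ;; nat 11 (.get 4 (.reg 5))

/-- `r := min r e`. -/
def lower (r : ℕ) (e : RealExpr) : Code := ite (.realLt e (.reg r)) (real r e) skip

/-- `a[i] := max a[i] r`. -/
def raise (a : ℕ) (i : NatExpr) (r : ℕ) : Code :=
  ite (.realLt (.get a i) (.reg r)) (realA a i (.reg r)) skip

/-- Two vertices are adjacent when one of the two bags of the first (own rectangle, home room) is
one of the two bags of the second. Pairs without a common bag get the large number kept in real
register `0`. -/
def weightCell : Code :=
  loadCell ;;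
  real 1 (.sub (.get 8 (.reg 10)) (.get 8 (.reg 11))) ;;
  ite (.realLt (.reg 1) (.lit 0)) (real 1 (.sub (.lit 0) (.reg 1))) skip ;;
  real 2 (.sub (.get 9 (.reg 10)) (.get 9 (.reg 11))) ;;
  ite (.realLt (.reg 2) (.lit 0)) (real 2 (.sub (.lit 0) (.reg 2))) skip ;;
  ite (.and (.and (.not (natEq (.get 0 (.reg 10)) (.get 0 (.reg 11))))
      (.not (natEq (.get 0 (.reg 10)) (.get 1 (.reg 11)))))
      (.and (.not (natEq (.get 1 (.reg 10)) (.get 0 (.reg 11))))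
      (.not (natEq (.get 1 (.reg 10)) (.get 1 (.reg 11))))))
    (real 3 (.reg 0)) (real 3 (.add (.reg 1) (.reg 2)))

def shortcutCell : Code :=
  loadCell ;; real 3 (.get 10 (.reg 5)) ;;
  lower 3 (.add (entry 10 (.reg 10) (.reg 6)) (entry 10 (.reg 6) (.reg 11)))

def distances : Code :=
  fill 5 4 10 3 weightCell ;;
  loop 6 3 (fill 5 4 11 3 shortcutCell ;; fill 5 4 10 3 (real 3 (.get 11 (.reg 5))))

/-- The diagonal holds an effectively infinite value for allowed vertices and `-1`, below every
relevant threshold, for vertices flagged in array `5`. -/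
def startCell : Code :=
  loadCell ;;
  ite (natEq (.reg 10) (.reg 11))
    (ite (.natLt (.get 5 (.reg 10)) (.lit 1)) (real 3 (.reg 0)) (real 3 (.lit (-1))))
    (real 3 (.get 10 (.reg 5)))

/-- All thresholds are treated at once: an entry of the matrix in array `12` is the largest
threshold at which the pair survives. The quality of a witness is a minimum of three entries, and
array `13` collects the best witness for every bag. -/
def witnesses : Code :=
  loop 6 2 (realA 13 (.reg 6) (.lit (-1))) ;;
  loop 6 3 (
    real 1 (entry 12 (.reg 6) (.reg 6)) ;;
    lower 1 (entry 12 (.reg 6) (.reg 10)) ;;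
    lower 1 (entry 12 (.reg 6) (.reg 11)) ;;
    raise 13 (.get 0 (.reg 6)) 1 ;;
    raise 13 (.get 1 (.reg 6)) 1)

def pruneCell : Code :=
  loadCell ;; witnesses ;; real 3 (.get 12 (.reg 5)) ;; loop 6 2 (lower 3 (.get 13 (.reg 6)))

/-- The number of rounds is the number of bags, as `exists_survives_iff` demands. A round reads the
old matrix only, hence the buffer in array `14`. The largest diagonal entry, in real register `5`,
is the optimum. -/
def prune : Code :=
  fill 5 4 12 3 startCell ;;
  loop 7 2 (fill 5 4 14 3 pruneCell ;; fill 5 4 12 3 (real 3 (.get 14 (.reg 5)))) ;;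
  real 5 (.lit (-1)) ;;
  loop 5 3 (ite (.realLt (.reg 5) (entry 12 (.reg 5) (.reg 5)))
    (real 5 (entry 12 (.reg 5) (.reg 5))) skip)

/-- Greedy deletion: each vertex is excluded on trial and readmitted if the optimum falls below the
original one, kept in real register `6`. -/
def shrink : Code :=
  prune ;; real 6 (.reg 5) ;;
  loop 8 3 (natA 5 (.reg 8) (.lit 1) ;; prune ;;
    ite (.realLt (.reg 5) (.reg 6)) (natA 5 (.reg 8) (.lit 0)) skip)

def write : Code :=
  nat 9 (.lit 0) ;;
  loop 5 3 (ite (.natLt (.get 5 (.reg 5)) (.lit 1))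
    (realA 0 (.reg 9) (.get 8 (.reg 5)) ;; realA 1 (.reg 9) (.get 9 (.reg 5)) ;;
      nat 9 (.add (.reg 9) (.lit 1))) skip) ;;
  nat 0 (.reg 9)

/-! ### What the program computes -/

/-- The memory holds the tables that describe the `n` vertices and the `m` bags. -/
structure Ready (m n : ℕ) (X Y : ℕ → ℝ) (hom : ℕ → ℕ) (M : ℝ) (s : State) : Prop where
  bags : s.natReg 2 = m
  verts : s.natReg 3 = n
  cells : s.natReg 4 = n * n
  own : ∀ v < n, s.natArr 0 v = v / 4
  home : ∀ v < n, s.natArr 1 v = hom v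
  row : ∀ v < n, s.natArr 2 v = v * n
  fst : ∀ e < n * n, s.natArr 3 e = e / n
  snd : ∀ e < n * n, s.natArr 4 e = e % n
  top : s.realReg 0 = M
  posX : ∀ v < n, s.realArr 8 v = X v
  posY : ∀ v < n, s.realArr 9 v = Y v

theorem den_seq (c d : Code) (s : State) : (c ;; d).den s = d.den (c.den s) := rfl

theorem den_nat (v : ℕ) (e : NatExpr) (s : State) : (nat v e).den s = s.setNat v (e.eval s) := rfl

theorem den_real (v : ℕ) (e : RealExpr) (s : State) :
    (real v e).den s = s.setReal v (e.eval s) := rfl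

section Spec

variable {m n : ℕ} {X Y : ℕ → ℝ} {hom : ℕ → ℕ} {M : ℝ} {s : State}

theorem Ready.frame {c : Code} {s' : State} (h : Ready m n X Y hom M s) (hf : Frame c s s')
    (h1 : ∀ v ∈ [2, 3, 4], v ∉ c.modN := by decide) (h2 : 0 ∉ c.modR := by decide)
    (h3 : ∀ v ∈ [0, 1, 2, 3, 4], v ∉ c.modNA := by decide)
    (h4 : ∀ v ∈ [8, 9], v ∉ c.modRA := by decide) : Ready m n X Y hom M s' := by
  simp only [List.mem_cons, List.not_mem_nil, or_false, forall_eq_or_imp, forall_eq] at h1 h3 h4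
  obtain ⟨a1, a2, a3⟩ := h1
  obtain ⟨b0, b1, b2, b3, b4⟩ := h3
  constructor
  · rw [hf.natReg _ a1, h.bags]
  · rw [hf.natReg _ a2, h.verts]
  · rw [hf.natReg _ a3, h.cells]
  · rw [hf.natArr _ b0]; exact h.own
  · rw [hf.natArr _ b1]; exact h.home
  · rw [hf.natArr _ b2]; exact h.row
  · rw [hf.natArr _ b3]; exact h.fst
  · rw [hf.natArr _ b4]; exact h.snd
  · rw [hf.realReg _ h2, h.top]
  · rw [hf.realArr _ h4.1]; exact h.posX
  · rw [hf.realArr _ h4.2]; exact h.posY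

theorem Ready.setNat (h : Ready m n X Y hom M s) {v x : ℕ} (hv : v ∉ [2, 3, 4]) :
    Ready m n X Y hom M (s.setNat v x) := by
  simp only [List.mem_cons, List.not_mem_nil, or_false, not_or] at hv
  obtain ⟨h2, h3, h4⟩ := hv
  refine ⟨?_, ?_, ?_, h.own, h.home, h.row, h.fst, h.snd, h.top, h.posX, h.posY⟩
  · simp [Ne.symm h2, h.bags]
  · simp [Ne.symm h3, h.verts]
  · simp [Ne.symm h4, h.cells]

theorem cell_lt {u w : ℕ} (hu : u < n) (hw : w < n) : u * n + w < n * n := by nlinarith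

theorem cell_div {u w : ℕ} (hw : w < n) : (u * n + w) / n = u := by
  rw [mul_comm, Nat.mul_add_div (by omega), Nat.div_eq_of_lt hw, add_zero]

theorem cell_mod {u w : ℕ} (hw : w < n) : (u * n + w) % n = w := by
  rw [mul_comm, Nat.mul_add_mod, Nat.mod_eq_of_lt hw]

theorem div_lt_of_lt_sq {e : ℕ} (he : e < n * n) : e / n < n := Nat.div_lt_of_lt_mul he

theorem mod_lt_of_lt_sq {e : ℕ} (he : e < n * n) : e % n < n :=
  Nat.mod_lt _ (Nat.pos_of_ne_zero (by rintro rfl; simp at he))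

@[simp] theorem natEq_eval (e f : NatExpr) : (natEq e f).eval s ↔ e.eval s = f.eval s := by
  simp only [natEq, Test.eval]; omega

@[simp] theorem entry_eval (a : ℕ) (u w : NatExpr) :
    (entry a u w).eval s = s.realArr a (s.natArr 2 (u.eval s) + w.eval s) := rfl

theorem lower_den (r : ℕ) (e : RealExpr) :
    (lower r e).den s = s.setReal r (min (s.realReg r) (e.eval s)) := by
  unfold lower den
  by_cases h : e.eval s < s.realReg r
  · rw [if_pos (show (Test.realLt e (.reg r)).eval s from h), min_eq_right h.le]; rfl
  · rw [if_neg (show ¬ (Test.realLt e (.reg r)).eval s from h), min_eq_left (not_lt.1 h)]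
    simp [State.setReal, den]

theorem raise_den (a : ℕ) (i : NatExpr) (r : ℕ) :
    (raise a i r).den s =
      s.setRealArr a (i.eval s) (max (s.realArr a (i.eval s)) (s.realReg r)) := by
  unfold raise den
  by_cases h : s.realArr a (i.eval s) < s.realReg r
  · rw [if_pos (show (Test.realLt (.get a i) (.reg r)).eval s from h), max_eq_right h.le]; rfl
  · rw [if_neg (show ¬ (Test.realLt (.get a i) (.reg r)).eval s from h),
      max_eq_left (not_lt.1 h)]
    simp [State.setRealArr, den]

theorem loadCell_den (h : Ready m n X Y hom M s) (he : s.natReg 5 < n * n) :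
    loadCell.den s = (s.setNat 10 (s.natReg 5 / n)).setNat 11 (s.natReg 5 % n) := by
  simp [loadCell, den, NatExpr.eval, h.fst _ he, h.snd _ he]

/-- The length of an edge of the vertex graph; `M` for pairs that are not adjacent. -/
def edgeWeight (X Y : ℕ → ℝ) (hom : ℕ → ℕ) (M : ℝ) (u w : ℕ) : ℝ :=
  if (u / 4 = w / 4 ∨ u / 4 = hom w) ∨ hom u = w / 4 ∨ hom u = hom w then
    |X u - X w| + |Y u - Y w| else M

/-- Shortest paths with all intermediate vertices below `K`. -/
def floydWarshall (w : ℕ → ℕ → ℝ) : ℕ → ℕ → ℕ → ℝ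
  | 0, u, v => w u v
  | K + 1, u, v => min (floydWarshall w K u v) (floydWarshall w K u K + floydWarshall w K K v)

theorem weightCell_spec (h : Ready m n X Y hom M s) (he : s.natReg 5 < n * n) :
    (weightCell.den s).realReg 3 =
      edgeWeight X Y hom M (s.natReg 5 / n) (s.natReg 5 % n) := by
  have hu := div_lt_of_lt_sq he
  have hw := mod_lt_of_lt_sq he
  have habs : ∀ x : ℝ, (if x < 0 then -x else x) = |x| := fun x => by
    split_ifs with hx
    · rw [abs_of_neg hx]
    · rw [abs_of_nonneg (not_lt.1 hx)]
  simp [weightCell, den, loadCell_den h he, Test.eval, NatExpr.eval, RealExpr.eval, h.posX _ hu,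
    h.posX _ hw, h.posY _ hu, h.posY _ hw, h.own _ hu, h.own _ hw, h.home _ hu, h.home _ hw, h.top,
    edgeWeight, habs, -sub_neg, -neg_sub]
  split_ifs <;> first | rfl | (exfalso; tauto)

theorem shortcutCell_spec (h : Ready m n X Y hom M s) (he : s.natReg 5 < n * n) {F : ℕ → ℕ → ℝ}
    (hF : ∀ u < n, ∀ w < n, s.realArr 10 (u * n + w) = F u w) {K : ℕ} (hK : s.natReg 6 = K)
    (hKn : K < n) :
    (shortcutCell.den s).realReg 3 = min (F (s.natReg 5 / n) (s.natReg 5 % n))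
      (F (s.natReg 5 / n) K + F K (s.natReg 5 % n)) := by
  have hu := div_lt_of_lt_sq he
  have hw := mod_lt_of_lt_sq he
  have h0 := hF _ hu _ hw
  rw [Nat.div_add_mod'] at h0
  simp [shortcutCell, den, loadCell_den h he, lower_den, NatExpr.eval, RealExpr.eval, hK,
    h.row _ hu, h.row _ hKn, hF _ hu _ hKn, hF _ hKn _ hw, h0]

theorem cells_iff {P : ℕ → ℕ → ℝ → Prop} {a : ℕ → ℝ} :
    (∀ e < n * n, P (e / n) (e % n) (a e)) ↔ ∀ u < n, ∀ w < n, P u w (a (u * n + w)) := by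
  constructor
  · intro h u hu w hw
    have := h _ (cell_lt hu hw)
    rwa [cell_div hw, cell_mod hw] at this
  · intro h e he
    have := h _ (div_lt_of_lt_sq he) _ (mod_lt_of_lt_sq he)
    rwa [Nat.div_add_mod'] at this

theorem fill_cells {a : ℕ} {c : Code} (h : Ready m n X Y hom M s) (P : ℕ → ℕ → ℝ → Prop)
    (hP : ∀ s', Frame (fill 5 4 a 3 c) s s' → s'.natReg 5 < n * n →
      P (s'.natReg 5 / n) (s'.natReg 5 % n) ((c.den s').realReg 3))
    (hi : 5 ∉ c.modN := by decide) (ha : a ∉ c.modRA := by decide) :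
    ∀ u < n, ∀ w < n, P u w (((fill 5 4 a 3 c).den s).realArr a (u * n + w)) := by
  rw [← cells_iff (P := P)]
  have := fill_spec hi ha s (b := 4) (r := 3) (fun e x => P (e / n) (e % n) x)
    (by
      intro k s' hk hk' hf
      rw [h.cells] at hk
      simpa only [hk'] using hP s' hf (hk' ▸ hk))
  rwa [h.cells] at this

theorem copy_cells {a b : ℕ} (h : Ready m n X Y hom M s) (hab : a ≠ b) :
    ∀ u < n, ∀ w < n, ((fill 5 4 a 3 (real 3 (.get b (.reg 5)))).den s).realArr a (u * n + w) =
      s.realArr b (u * n + w) := by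
  refine fill_cells h (fun u w x => x = s.realArr b (u * n + w)) (fun s' hf he => ?_)
    (by simp [modN]) (by simp [modRA])
  simp only [den, RealExpr.eval, NatExpr.eval, State.setReal_realReg, if_true, Nat.div_add_mod']
  rw [hf.realArr b (by simpa [fill, modRA] using hab.symm)]

theorem distances_spec (h : Ready m n X Y hom M s) :
    ∀ u < n, ∀ w < n, (distances.den s).realArr 10 (u * n + w) =
      floydWarshall (edgeWeight X Y hom M) n u w := by
  have h1 : ∀ u < n, ∀ w < n, ((fill 5 4 10 3 weightCell).den s).realArr 10 (u * n + w) =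
      edgeWeight X Y hom M u w :=
    fill_cells h (fun u w x => x = edgeWeight X Y hom M u w) fun s' hf he =>
      weightCell_spec (h.frame hf) he
  unfold distances den
  set s₁ := (fill 5 4 10 3 weightCell).den s
  have hs₁ : Ready m n X Y hom M s₁ := h.frame (den_frame _ s)
  have := loop_induction (i := 6) (b := 3)
    (c := fill 5 4 11 3 shortcutCell ;; fill 5 4 10 3 (real 3 (.get 11 (.reg 5))))
    (by decide) s₁ (fun K s' => ∀ u < n, ∀ w < n, s'.realArr 10 (u * n + w) =
      floydWarshall (edgeWeight X Y hom M) K u w) h1 ?_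
  · rwa [hs₁.verts] at this
  intro K s' hK hK' hf ih u hu w hw
  have hs' : Ready m n X Y hom M s' := hs₁.frame hf
  have h2 : ∀ u < n, ∀ w < n, ((fill 5 4 11 3 shortcutCell).den s').realArr 11 (u * n + w) =
      floydWarshall (edgeWeight X Y hom M) (K + 1) u w :=
    fill_cells hs' (fun u w x => x = floydWarshall (edgeWeight X Y hom M) (K + 1) u w)
      fun s'' hf he => shortcutCell_spec (hs'.frame hf) he
        (by rw [hf.realArr 10 (by decide)]; exact ih)
        (by rw [hf.natReg 6 (by decide), hK']) (by rwa [hs₁.verts] at hK)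
  rw [State.setNat_realArr]
  unfold den
  rw [copy_cells (hs'.frame (den_frame _ _)) (by decide) u hu w hw, h2 u hu w hw]

/-- The bags to which a vertex belongs: its own rectangle and its home room. -/
def inBag (m n : ℕ) (hom : ℕ → ℕ) (k : Fin m) (v : Fin n) : Prop := v.1 / 4 = k ∨ hom v = k

theorem startCell_spec (h : Ready m n X Y hom M s) (he : s.natReg 5 < n * n) :
    (startCell.den s).realReg 3 = if s.natReg 5 / n = s.natReg 5 % n then
      (if s.natArr 5 (s.natReg 5 / n) = 0 then M else -1) else s.realArr 10 (s.natReg 5) := by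
  simp [startCell, den, loadCell_den h he, Test.eval, NatExpr.eval, RealExpr.eval, h.top]

/-- Comparison with a fixed `δ` turns the maximum over vertices into an existential quantifier and
the minimum of three entries into a conjunction. The bound `-1 < δ` makes the initial value `-1`
mean that there is no witness yet. -/
theorem witnesses_spec (h : Ready m n X Y hom M s) {u w : ℕ} (hu : s.natReg 10 = u)
    (hw : s.natReg 11 = w) {A : ℕ → ℕ → ℝ} (hA : ∀ o u, s.realArr 12 (o * n + u) = A o u) :
    ∀ k < m, ∀ δ : ℝ, -1 < δ → (δ ≤ (witnesses.den s).realArr 13 k ↔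
      ∃ o < n, (o / 4 = k ∨ hom o = k) ∧ δ ≤ A o o ∧ δ ≤ A o u ∧ δ ≤ A o w) := by
  unfold witnesses den
  have h1 := loop_induction (i := 6) (b := 2) (c := realA 13 (.reg 6) (.lit (-1))) (by decide) s
    (fun N s' => ∀ k < N, s'.realArr 13 k = -1) (by simp) (by
      intro N s' _ hN _ ih k hk
      simp only [den, NatExpr.eval, RealExpr.eval, State.setNat_realArr, State.setRealArr_realArr,
        if_true, hN]
      split_ifs with hkN
      · simp
      · exact ih k (by omega))
  have hf₁ := den_frame (loop 6 2 (realA 13 (.reg 6) (.lit (-1)))) s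
  set s₁ := (loop 6 2 (realA 13 (.reg 6) (.lit (-1)))).den s
  have hs₁ : Ready m n X Y hom M s₁ := h.frame hf₁
  rw [h.bags] at h1
  have h2 := loop_induction (i := 6) (b := 3) (c := real 1 (entry 12 (.reg 6) (.reg 6)) ;;
    lower 1 (entry 12 (.reg 6) (.reg 10)) ;; lower 1 (entry 12 (.reg 6) (.reg 11)) ;;
    raise 13 (.get 0 (.reg 6)) 1 ;; raise 13 (.get 1 (.reg 6)) 1) (by decide) s₁
    (fun N s' => ∀ k < m, ∀ δ : ℝ, -1 < δ → (δ ≤ s'.realArr 13 k ↔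
      ∃ o < N, (o / 4 = k ∨ hom o = k) ∧ δ ≤ A o o ∧ δ ≤ A o u ∧ δ ≤ A o w))
    (by
      intro k hk δ hδ
      simp only [State.setNat_realArr, h1 k hk, Nat.not_lt_zero, false_and, exists_false, iff_false,
        not_le]
      exact hδ)
    (by
      intro N s' hN hN' hf ih k hk δ hδ
      rw [hs₁.verts] at hN
      have hs' : Ready m n X Y hom M s' := hs₁.frame hf
      have h10 : s'.natReg 10 = u := by
        rw [hf.natReg 10 (by decide), hf₁.natReg 10 (by decide), hu]
      have h11 : s'.natReg 11 = w := by
        rw [hf.natReg 11 (by decide), hf₁.natReg 11 (by decide), hw]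
      have h12 : ∀ o u, s'.realArr 12 (o * n + u) = A o u := by
        intro o u
        rw [hf.realArr 12 (by decide), hf₁.realArr 12 (by decide), hA]
      rw [Nat.exists_lt_succ_right, ← ih k hk δ hδ]
      simp only [den, lower_den, raise_den, entry_eval, NatExpr.eval,
        State.setNat_realArr, State.setReal_realArr, State.setRealArr_realArr,
        State.setReal_natReg, State.setReal_natArr, State.setRealArr_natReg,
        State.setRealArr_natArr, State.setReal_realReg, State.setRealArr_realReg, if_true,
        hN', h10, h11, hs'.row _ hN, hs'.own _ hN, hs'.home _ hN, h12]
      clear hf ih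
      by_cases ha : k = N / 4 <;> by_cases hb : k = hom N
      · simp [← ha, ← hb, and_assoc]
      · simp [← ha, hb, and_assoc]
      · simp [ha, ← hb, and_assoc, Ne.symm ha]
      · simp [ha, hb, Ne.symm ha, Ne.symm hb])
  rwa [hs₁.verts] at h2

theorem pruneCell_spec (h : Ready m n X Y hom M s) (he : s.natReg 5 < n * n) {A : ℕ → ℕ → ℝ}
    (hA : ∀ o u, s.realArr 12 (o * n + u) = A o u) (δ : ℝ) (hδ : -1 < δ) :
    δ ≤ (pruneCell.den s).realReg 3 ↔ δ ≤ A (s.natReg 5 / n) (s.natReg 5 % n) ∧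
      ∀ k < m, ∃ o < n, (o / 4 = k ∨ hom o = k) ∧ δ ≤ A o o ∧ δ ≤ A o (s.natReg 5 / n) ∧
        δ ≤ A o (s.natReg 5 % n) := by
  set u := s.natReg 5 / n with hu
  set w := s.natReg 5 % n with hw
  unfold pruneCell
  simp only [den_seq, den_real]
  rw [loadCell_den h he, ← hu, ← hw]
  set s₁ := (s.setNat 10 u).setNat 11 w with hs₁
  have hr₁ : Ready m n X Y hom M s₁ := (h.setNat (by decide)).setNat (by decide)
  have hwit := witnesses_spec hr₁ (u := u) (w := w) (by simp [hs₁]) (by simp [hs₁]) (A := A)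
    (by simpa [hs₁] using hA)
  have hf₂ := den_frame witnesses s₁
  set s₂ := witnesses.den s₁
  have hr₂ : Ready m n X Y hom M s₂ := hr₁.frame hf₂
  have h0 : s₂.realArr 12 (s₂.natReg 5) = A u w := by
    rw [hf₂.realArr 12 (by decide), hf₂.natReg 5 (by decide)]
    simp only [hs₁, State.setNat_realArr, State.setNat_natReg]
    rw [← hA, hu, hw, Nat.div_add_mod']; simp
  have := loop_induction (i := 6) (b := 2) (c := lower 3 (.get 13 (.reg 6))) (by decide)
    (s₂.setReal 3 ((RealExpr.get 12 (.reg 5)).eval s₂))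
    (fun N s' => ∀ δ, δ ≤ s'.realReg 3 ↔ δ ≤ A u w ∧ ∀ k < N, δ ≤ s₂.realArr 13 k)
    (by simp [RealExpr.eval, NatExpr.eval, h0])
    (by
      intro N s' _ hN hf ih δ
      simp only [lower_den, State.setNat_realReg, State.setReal_realReg, if_true, le_min_iff,
        RealExpr.eval, NatExpr.eval, ih, hN, hf.realArr 13 (by decide), State.setReal_realArr,
        Nat.forall_lt_succ_right, and_assoc])
  rw [State.setReal_natReg, hr₂.bags] at this
  rw [this δ]
  exact and_congr Iff.rfl (forall₂_congr fun k hk => hwit k hk δ hδ)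

/-- `r` is the largest feasible threshold when only the vertices in `A` are allowed. -/
def IsBest (D : ℕ → ℕ → ℝ) (M : ℝ) (bag : Fin m → Fin n → Prop) (A : Fin n → Prop) (r : ℝ) :
    Prop :=
  ∀ δ : ℝ, -1 < δ → (δ ≤ r ↔ ∃ u, Survives (fun u w : Fin n => D u w) δ
    (fun u => A u ∧ δ ≤ M) bag m u u)

/-- For fixed `δ`, an entry after `t` rounds is at least `δ` exactly when the pair survives `t`
rounds at threshold `δ`. The extra condition `δ ≤ M` on allowed vertices reflects the finite
diagonal value `M`. -/
theorem prune_spec (h : Ready m n X Y hom M s) {D : ℕ → ℕ → ℝ}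
    (hD : ∀ u < n, ∀ w < n, s.realArr 10 (u * n + w) = D u w) :
    IsBest D M (inBag m n hom) (fun v => s.natArr 5 v = 0) ((prune.den s).realReg 5) := by
  intro δ hδ
  set S := Survives (fun u w : Fin n => D u w) δ (fun u => s.natArr 5 u = 0 ∧ δ ≤ M)
    (inBag m n hom) with hS
  unfold prune
  simp only [den_seq, den_real]
  have h1 : ∀ u (hu : u < n) w (hw : w < n),
      (δ ≤ ((fill 5 4 12 3 startCell).den s).realArr 12 (u * n + w) ↔ S 0 ⟨u, hu⟩ ⟨w, hw⟩) := by
    intro u hu w hw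
    refine fill_cells h (a := 12) (c := startCell)
      (fun u w x => ∀ (hu : u < n) (hw : w < n), δ ≤ x ↔ S 0 ⟨u, hu⟩ ⟨w, hw⟩) ?_ (by decide) (by decide)
      u hu w hw hu hw
    intro s' hf he hu hw
    have hDe := hD _ hu _ hw
    rw [Nat.div_add_mod'] at hDe
    rw [startCell_spec (h.frame hf) he, hf.natArr 5 (by decide), hf.realArr 10 (by decide), hDe, hS]
    simp only [Survives, Fin.mk.injEq, ne_eq]
    by_cases h1 : s'.natReg 5 / n = s'.natReg 5 % n
    · by_cases h2 : s.natArr 5 (s'.natReg 5 / n) = 0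
      · rw [if_pos h1, if_pos h2]; tauto
      · rw [if_pos h1, if_neg h2]
        have := not_le.2 hδ
        tauto
    · rw [if_neg h1]; tauto
  have hf₁ := den_frame (fill 5 4 12 3 startCell) s
  set s₁ := (fill 5 4 12 3 startCell).den s
  have hs₁ : Ready m n X Y hom M s₁ := h.frame hf₁
  have h2 := loop_induction (i := 7) (b := 2)
    (c := fill 5 4 14 3 pruneCell ;; fill 5 4 12 3 (real 3 (.get 14 (.reg 5)))) (by decide) s₁
    (fun t s' => ∀ u (hu : u < n) w (hw : w < n),
      (δ ≤ s'.realArr 12 (u * n + w) ↔ S t ⟨u, hu⟩ ⟨w, hw⟩)) h1 (by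
    intro t s' ht ht' hf ih u hu w hw
    have hs' : Ready m n X Y hom M s' := hs₁.frame hf
    rw [State.setNat_realArr, den_seq,
      copy_cells (hs'.frame (den_frame _ _)) (by decide) u hu w hw]
    refine fill_cells hs' (a := 14) (c := pruneCell)
      (fun u w x => ∀ (hu : u < n) (hw : w < n), δ ≤ x ↔ S (t + 1) ⟨u, hu⟩ ⟨w, hw⟩) ?_
      (by decide) (by decide) u hu w hw hu hw
    intro s'' hf' he hu hw
    rw [pruneCell_spec (hs'.frame hf') he (A := fun o u => s''.realArr 12 (o * n + u))
      (fun _ _ => rfl) δ hδ, hf'.realArr 12 (by decide), hS]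
    simp only [Survives]
    rw [← hS, ih _ hu _ hw]
    refine and_congr Iff.rfl ⟨fun H k => ?_, fun H k hk => ?_⟩
    · obtain ⟨o, ho, hb, h1, h2, h3⟩ := H k.1 k.2
      exact ⟨⟨o, ho⟩, hb, (ih o ho o ho).1 h1, (ih o ho _ hu).1 h2, (ih o ho _ hw).1 h3⟩
    · obtain ⟨⟨o, ho⟩, hb, h1, h2, h3⟩ := H ⟨k, hk⟩
      exact ⟨o, ho, hb, (ih o ho o ho).2 h1, (ih o ho _ hu).2 h2, (ih o ho _ hw).2 h3⟩)
  have hf₂ := den_frame (loop 7 2 (fill 5 4 14 3 pruneCell ;;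
    fill 5 4 12 3 (real 3 (.get 14 (.reg 5))))) s₁
  rw [hs₁.bags] at h2
  set s₂ := (loop 7 2 (fill 5 4 14 3 pruneCell ;;
    fill 5 4 12 3 (real 3 (.get 14 (.reg 5))))).den s₁
  have hs₂ : Ready m n X Y hom M s₂ := hs₁.frame hf₂
  have h3 := loop_induction (i := 5) (b := 3)
    (c := ite (.realLt (.reg 5) (entry 12 (.reg 5) (.reg 5)))
      (real 5 (entry 12 (.reg 5) (.reg 5))) skip) (by decide)
    (s₂.setReal 5 ((RealExpr.lit (-1)).eval s₂))
    (fun N s' => δ ≤ s'.realReg 5 ↔ ∃ u < N, δ ≤ s₂.realArr 12 (u * n + u))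
    (by simp [RealExpr.eval, hδ]) (by
    intro N s' hN hN' hf ih
    simp only [State.setReal_natReg, hs₂.verts] at hN
    have hrow : s'.natArr 2 N = N * n := by
      rw [hf.natArr 2 (by decide), State.setReal_natArr, hs₂.row _ hN]
    rw [Nat.exists_lt_succ_right, ← ih]
    have h12 : s'.realArr 12 = s₂.realArr 12 := by
      rw [hf.realArr 12 (by decide), State.setReal_realArr]
    simp only [den, Test.eval, RealExpr.eval, NatExpr.eval, entry_eval, hN', hrow, h12,
      State.setNat_realReg, State.ite_realReg, State.setReal_realReg, if_true]
    split_ifs with hlt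
    · exact ⟨Or.inr, fun h => h.elim (fun h => h.trans hlt.le) id⟩
    · exact ⟨Or.inl, fun h => h.elim id (fun h => h.trans (not_lt.1 hlt))⟩)
  rw [State.setReal_natReg, hs₂.verts] at h3
  rw [h3]
  constructor
  · rintro ⟨u, hu, h⟩
    exact ⟨⟨u, hu⟩, (h2 u hu u hu).1 h⟩
  · rintro ⟨⟨u, hu⟩, h⟩
    exact ⟨u, hu, (h2 u hu u hu).2 h⟩

/-- A vertex that is kept was indispensable when it was tested. It remains so, because the set of
allowed vertices only shrinks afterwards and feasibility is monotone. -/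
theorem shrink_spec (h : Ready m n X Y hom M s) {D : ℕ → ℕ → ℝ}
    (hD : ∀ u < n, ∀ w < n, s.realArr 10 (u * n + w) = D u w) (h0 : ∀ v < n, s.natArr 5 v = 0)
    (hmono : ∀ (A A' : Fin n → Prop) (δ : ℝ), (∀ v, A v → A' v) →
      (∃ u, Survives (fun u w : Fin n => D u w) δ (fun u => A u ∧ δ ≤ M) (inBag m n hom) m u u) →
      ∃ u, Survives (fun u w : Fin n => D u w) δ (fun u => A' u ∧ δ ≤ M) (inBag m n hom) m u u)
    {best : ℝ} (hbest : IsBest D M (inBag m n hom) (fun _ => True) best) (hb0 : -1 < best) :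
    (∃ u, Survives (fun u w : Fin n => D u w) best
      (fun u => (shrink.den s).natArr 5 u = 0 ∧ best ≤ M) (inBag m n hom) m u u) ∧
    ∀ v : Fin n, (shrink.den s).natArr 5 v = 0 →
      ¬ ∃ u, Survives (fun u w : Fin n => D u w) best
        (fun u => ((shrink.den s).natArr 5 u = 0 ∧ u ≠ v) ∧ best ≤ M) (inBag m n hom) m u u := by
  set P : (Fin n → Prop) → Prop := fun A => ∃ u, Survives (fun u w : Fin n => D u w) best
    (fun u => A u ∧ best ≤ M) (inBag m n hom) m u u with hP
  have hPm : ∀ A A', (∀ v, A v → A' v) → P A → P A' := fun A A' hA => hmono A A' best hA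
  unfold shrink
  simp only [den_seq, den_real]
  have hp := prune_spec h hD
  have hf₁ := den_frame prune s
  set s₁ := prune.den s
  have hr₁ : s₁.realReg 5 = best := by
    -- Both numbers have the same lower bounds above `-1`, and `best` itself is one of them, so they
    -- are equal.
    have heq : ∀ δ, -1 < δ → (δ ≤ s₁.realReg 5 ↔ δ ≤ best) := by
      intro δ hδ
      rw [hp δ hδ, hbest δ hδ]
      exact ⟨fun H => hmono _ _ _ (fun _ _ => trivial) H,
        fun H => hmono _ _ _ (fun v _ => h0 v v.2) H⟩
    have h1 := (heq best hb0).2 le_rfl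
    exact le_antisymm ((heq _ (hb0.trans_le h1)).1 le_rfl) h1
  have hr₁' : (RealExpr.reg 5).eval s₁ = best := hr₁
  rw [hr₁']
  set s₂ := s₁.setReal 6 best with hs₂
  have hR₂ : Ready m n X Y hom M s₂ := (h.frame hf₁).frame (den_frame (real 6 (.lit 0)) s₁) |> fun
    H => ⟨H.bags, H.verts, H.cells, H.own, H.home, H.row, H.fst, H.snd, by
      simpa [hs₂, den] using H.top, H.posX, H.posY⟩
  have hD₂ : ∀ u < n, ∀ w < n, s₂.realArr 10 (u * n + w) = D u w := by
    rw [hs₂, State.setReal_realArr, hf₁.realArr 10 (by decide)]; exact hD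
  have h5 : ∀ v < n, s₂.natArr 5 v = 0 := by
    rw [hs₂, State.setReal_natArr, hf₁.natArr 5 (by decide)]; exact h0
  have key := loop_induction (i := 8) (b := 3) (c := natA 5 (.reg 8) (.lit 1) ;; prune ;;
    ite (.realLt (.reg 5) (.reg 6)) (natA 5 (.reg 8) (.lit 0)) skip) (by decide) s₂
    (fun N s' => P (fun v => s'.natArr 5 v = 0) ∧ (∀ v < n, N ≤ v → s'.natArr 5 v = 0) ∧
      ∀ v : Fin n, v.1 < N → s'.natArr 5 v = 0 → ¬ P (fun u => s'.natArr 5 u = 0 ∧ u ≠ v))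
    ⟨hPm _ _ (fun v _ => h5 v v.2) ((hbest best hb0).1 le_rfl), fun v hv _ => h5 v hv,
      fun v hv => absurd hv (Nat.not_lt_zero _)⟩ (by
    intro N s' hN hN' hf ⟨ih1, ih2, ih3⟩
    rw [hR₂.verts] at hN
    have hR' : Ready m n X Y hom M s' := hR₂.frame hf
    have hR'' : Ready m n X Y hom M (s'.setNatArr 5 N 1) :=
      ⟨hR'.bags, hR'.verts, hR'.cells, hR'.own, hR'.home, hR'.row, hR'.fst, hR'.snd, hR'.top,
        hR'.posX, hR'.posY⟩
    have hprune := prune_spec hR'' (D := D) (by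
      rw [State.setNatArr_realArr, hf.realArr 10 (by decide)]; exact hD₂)
    have hf₃ := den_frame prune (s'.setNatArr 5 N 1)
    have hbestreg : (prune.den (s'.setNatArr 5 N 1)).realReg 6 = best := by
      rw [hf₃.realReg 6 (by decide), State.setNatArr_realReg, hf.realReg 6 (by decide)]
      simp [hs₂]
    have h5' : (prune.den (s'.setNatArr 5 N 1)).natArr 5 = (s'.setNatArr 5 N 1).natArr 5 :=
      hf₃.natArr 5 (by decide)
    have h8 : (prune.den (s'.setNatArr 5 N 1)).natReg 8 = N := by
      rw [hf₃.natReg 8 (by decide)]; exact hN'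
    have hfeas := hprune best hb0
    have hset : (fun v : Fin n => (s'.setNatArr 5 N 1).natArr 5 v = 0) =
        fun v : Fin n => s'.natArr 5 v = 0 ∧ v ≠ ⟨N, hN⟩ := by
      funext v
      simp only [State.setNatArr_natArr, if_true, ne_eq, Fin.ext_iff, eq_iff_iff]
      split_ifs with hv <;> simp [hv]
    rw [show (∃ u, Survives (fun u w : Fin n => D u w) best
      (fun u => (s'.setNatArr 5 N 1).natArr 5 u = 0 ∧ best ≤ M) (inBag m n hom) m u u) =
      P (fun v : Fin n => (s'.setNatArr 5 N 1).natArr 5 v = 0) from rfl, hset] at hfeas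
    rw [den_seq, den_seq]
    have hd1 : (natA 5 (.reg 8) (.lit 1)).den s' = s'.setNatArr 5 N 1 := by
      simp [den, NatExpr.eval, hN']
    rw [hd1]
    set s₃ := prune.den (s'.setNatArr 5 N 1)
    rw [State.setNat_natArr]
    -- In the first case the trial lowered the optimum, so the vertex is readmitted and its
    -- indispensability is recorded; otherwise it stays excluded.
    by_cases hlt : s₃.realReg 5 < s₃.realReg 6
    · have hfin : ((ite (.realLt (.reg 5) (.reg 6)) (natA 5 (.reg 8) (.lit 0)) skip).den s₃).natArr 5
          = s'.natArr 5 := by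
        unfold den
        rw [if_pos (show (Test.realLt (.reg 5) (.reg 6)).eval s₃ from hlt)]
        funext v
        simp only [den, NatExpr.eval, State.setNatArr_natArr, if_true, h8, h5']
        split_ifs with hv
        · rw [hv, ih2 N hN le_rfl]
        · rfl
      rw [hfin]
      refine ⟨ih1, fun v hv hNv => ih2 v hv (by omega), fun v hv hv0 => ?_⟩
      rcases Nat.lt_succ_iff_lt_or_eq.1 hv with hv | hv
      · exact ih3 v hv hv0
      · have : v = ⟨N, hN⟩ := Fin.ext hv
        rw [this, ← hfeas, not_le, ← hbestreg]
        exact hlt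
    · have hfin : ((ite (.realLt (.reg 5) (.reg 6)) (natA 5 (.reg 8) (.lit 0)) skip).den s₃).natArr 5
          = (s'.setNatArr 5 N 1).natArr 5 := by
        unfold den
        rw [if_neg (show ¬ (Test.realLt (.reg 5) (.reg 6)).eval s₃ from hlt)]
        exact h5'
      rw [hfin, hset]
      rw [hbestreg, not_lt] at hlt
      refine ⟨hfeas.1 hlt, fun v hv hNv => ?_, fun v hv hv0 => ?_⟩
      · simp only [State.setNatArr_natArr, if_true]
        rw [if_neg (by omega)]
        exact ih2 v hv (by omega)
      · have hv0' := (congrFun hset v).mp hv0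
        have hvN : v.1 < N := by
          have : v.1 ≠ N := fun h => hv0'.2 (Fin.ext h)
          omega
        have hset' : ∀ u : Fin n, (s'.setNatArr 5 N 1).natArr 5 u = 0 → s'.natArr 5 u = 0 :=
          fun u hu => ((congrFun hset u).mp hu).1
        exact fun H => ih3 v hvN hv0'.1 (hPm _ _ (fun u hu => ⟨hset' u hu.1, hu.2⟩) H))
  rw [hR₂.verts] at key
  exact ⟨key.1, fun v hv => key.2.2 v v.2 hv⟩

theorem write_spec (h : Ready m n X Y hom M s) :
    (write.den s).output = {p | ∃ v < n, s.natArr 5 v = 0 ∧ p = (X v, Y v)} := by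
  unfold write
  simp only [den_seq, den_nat]
  have key := loop_induction (i := 5) (b := 3) (c := ite (.natLt (.get 5 (.reg 5)) (.lit 1))
    (realA 0 (.reg 9) (.get 8 (.reg 5)) ;; realA 1 (.reg 9) (.get 9 (.reg 5)) ;;
      nat 9 (.add (.reg 9) (.lit 1))) skip) (by decide) (s.setNat 9 ((NatExpr.lit 0).eval s))
    (fun N s' => ∀ p, (∃ i < s'.natReg 9, p = (s'.realArr 0 i, s'.realArr 1 i)) ↔
      ∃ v < N, s.natArr 5 v = 0 ∧ p = (X v, Y v)) (by simp [NatExpr.eval]) (by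
    intro N s' hN hN' hf ih p
    simp only [State.setNat_natReg, h.verts, if_neg (show (3 : ℕ) ≠ 9 by decide)] at hN
    have hR : Ready m n X Y hom M s' := (h.setNat (by decide)).frame hf
    have h5 : s'.natArr 5 = s.natArr 5 := by rw [hf.natArr 5 (by decide), State.setNat_natArr]
    rw [Nat.exists_lt_succ_right, ← ih p]
    unfold den
    by_cases hc : s.natArr 5 N = 0
    · rw [if_pos (by simp [Test.eval, NatExpr.eval, hN', h5, hc])]
      simp only [den, NatExpr.eval, RealExpr.eval, State.setNat_natReg, State.setNat_realArr,
        State.setRealArr_natReg, State.setRealArr_realArr, if_true, hN', hR.posX _ hN, hR.posY _ hN]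
      simp only [if_neg (show (9 : ℕ) ≠ 5 by decide), if_neg (show (0 : ℕ) ≠ 1 by decide),
        if_neg (show (1 : ℕ) ≠ 0 by decide), if_neg (show (9 : ℕ) ≠ 0 by decide)]
      rw [Nat.exists_lt_succ_right]
      simp only [if_true, hc, true_and]
      refine or_congr (exists_congr fun i => and_congr_right fun hi => ?_) Iff.rfl
      rw [if_neg (by omega), if_neg (by omega)]
    · rw [if_neg (by simp [Test.eval, NatExpr.eval, hN', h5, hc])]
      simp [den, hc])
  ext p
  simp only [State.setNat_natReg, h.verts, if_neg (show (3 : ℕ) ≠ 9 by decide)] at key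
  rw [mem_ofPred_eq, ← key p]
  simp [State.output, NatExpr.eval]

end Spec

/-! ### Preparing the tables, and the whole program -/

open Code

/-- Appends the corridors to the list of rooms. -/
def collect : Code :=
  nat 2 (.add (.reg 0) (.reg 1)) ;;
  nat 3 (.add (.add (.reg 2) (.reg 2)) (.add (.reg 2) (.reg 2))) ;;
  loop 5 1 (
    realA 0 (.add (.reg 0) (.reg 5)) (.get 4 (.reg 5)) ;;
    realA 1 (.add (.reg 0) (.reg 5)) (.get 5 (.reg 5)) ;;
    realA 2 (.add (.reg 0) (.reg 5)) (.get 6 (.reg 5)) ;;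
    realA 3 (.add (.reg 0) (.reg 5)) (.get 7 (.reg 5)))

/-- The position `4 k + c` of a corner of the rectangle `k`. -/
def cornerIndex (c : ℕ) : NatExpr :=
  .add (.add (.add (.reg 5) (.reg 5)) (.add (.reg 5) (.reg 5))) (.lit c)

def listCorners : Code :=
  loop 5 2 (
    realA 8 (cornerIndex 0) (.get 0 (.reg 5)) ;; realA 8 (cornerIndex 1) (.get 0 (.reg 5)) ;;
    realA 8 (cornerIndex 2) (.get 1 (.reg 5)) ;; realA 8 (cornerIndex 3) (.get 1 (.reg 5))) ;;
  loop 5 2 (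
    realA 9 (cornerIndex 0) (.get 2 (.reg 5)) ;; realA 9 (cornerIndex 1) (.get 3 (.reg 5)) ;;
    realA 9 (cornerIndex 2) (.get 2 (.reg 5)) ;; realA 9 (cornerIndex 3) (.get 3 (.reg 5))) ;;
  loop 5 2 (
    natA 0 (cornerIndex 0) (.reg 5) ;; natA 0 (cornerIndex 1) (.reg 5) ;;
    natA 0 (cornerIndex 2) (.reg 5) ;; natA 0 (cornerIndex 3) (.reg 5))

/-- The machine cannot multiply, so the sum of all half perimeters is added once for every
rectangle. The result exceeds every distance between vertices. -/
def measure : Code :=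
  real 0 (.lit 1) ;;
  loop 5 2 (loop 6 2 (real 0 (.add (.reg 0)
    (.add (.sub (.get 1 (.reg 6)) (.get 0 (.reg 6)))
      (.sub (.get 3 (.reg 6)) (.get 2 (.reg 6)))))))

/-- Only rooms are searched. As rooms come first in the list, the number of a room is also its
number as a bag. -/
def findHomes : Code :=
  loop 5 3 (loop 6 0 (ite
    (.and (.and (.not (.realLt (.get 8 (.reg 5)) (.get 0 (.reg 6))))
      (.not (.realLt (.get 1 (.reg 6)) (.get 8 (.reg 5)))))
      (.and (.not (.realLt (.get 9 (.reg 5)) (.get 2 (.reg 6))))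
      (.not (.realLt (.get 3 (.reg 6)) (.get 9 (.reg 5))))))
    (natA 1 (.reg 5) (.reg 6)) skip))

/-- Multiples of the number of vertices are obtained by repeated addition; the last one, left in
register `4`, is the number of matrix cells. -/
def numberRows : Code :=
  nat 4 (.lit 0) ;; loop 5 3 (natA 2 (.reg 5) (.reg 4) ;; nat 4 (.add (.reg 4) (.reg 3)))

/-- Two counters running like an odometer replace division with remainder. -/
def numberCells : Code :=
  nat 10 (.lit 0) ;; nat 11 (.lit 0) ;;
  loop 5 4 (natA 3 (.reg 5) (.reg 10) ;; natA 4 (.reg 5) (.reg 11) ;;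
    ite (.natLt (.add (.reg 11) (.lit 1)) (.reg 3)) (nat 11 (.add (.reg 11) (.lit 1)))
      (nat 11 (.lit 0) ;; nat 10 (.add (.reg 10) (.lit 1))))

def layout : Code := listCorners ;; measure ;; findHomes ;; numberRows

def solve : Code := numberCells ;; distances ;; shrink ;; write

/-- The split into three pieces reflects `compile_exec`: the registers that bound the loops of a
piece must have their final values before it starts, and each piece prepares such registers for a
later one. -/
def guardProgram : Program := .seq collect.compile (.seq layout.compile solve.compile)

/-! ### Correctness of the preparation of the tables. -/

section Spec

/-- The array that starts with the first `R` entries of `f` and continues with `g`. -/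
def append (R : ℕ) (f g : ℕ → ℝ) (k : ℕ) : ℝ := if k < R then f k else g (k - R)

theorem collect_spec (s : State) : ∀ k < s.natReg 0 + s.natReg 1,
    (collect.den s).realArr 0 k = append (s.natReg 0) (s.realArr 0) (s.realArr 4) k ∧
    (collect.den s).realArr 1 k = append (s.natReg 0) (s.realArr 1) (s.realArr 5) k ∧
    (collect.den s).realArr 2 k = append (s.natReg 0) (s.realArr 2) (s.realArr 6) k ∧
    (collect.den s).realArr 3 k = append (s.natReg 0) (s.realArr 3) (s.realArr 7) k := by
  unfold collect
  simp only [den_seq, den_nat]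
  set s₁ := (s.setNat 2 _).setNat 3 _ with hs₁
  have h0 : s₁.natReg 0 = s.natReg 0 := by simp [hs₁]
  have h1 : s₁.natReg 1 = s.natReg 1 := by simp [hs₁]
  have hr : s₁.realArr = s.realArr := by simp [hs₁]
  have := loop_induction (i := 5) (b := 1) (c :=
    realA 0 (.add (.reg 0) (.reg 5)) (.get 4 (.reg 5)) ;;
    realA 1 (.add (.reg 0) (.reg 5)) (.get 5 (.reg 5)) ;;
    realA 2 (.add (.reg 0) (.reg 5)) (.get 6 (.reg 5)) ;;
    realA 3 (.add (.reg 0) (.reg 5)) (.get 7 (.reg 5))) (by decide) s₁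
    (fun N s' => ∀ k < s.natReg 0 + N,
      s'.realArr 0 k = append (s.natReg 0) (s.realArr 0) (s.realArr 4) k ∧
      s'.realArr 1 k = append (s.natReg 0) (s.realArr 1) (s.realArr 5) k ∧
      s'.realArr 2 k = append (s.natReg 0) (s.realArr 2) (s.realArr 6) k ∧
      s'.realArr 3 k = append (s.natReg 0) (s.realArr 3) (s.realArr 7) k)
    (by intro k hk; simp only [add_zero] at hk; simp [append, hk, hr]) (by
    intro N s' _ hN hf ih k hk
    have h0' : s'.natReg 0 = s.natReg 0 := by rw [hf.natReg 0 (by decide), h0]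
    simp only [den, NatExpr.eval, RealExpr.eval, State.setNat_realArr, State.setRealArr_realArr,
      State.setRealArr_natReg, h0', hN]
    have e4 := hf.realArr 4 (by decide)
    have e5 := hf.realArr 5 (by decide)
    have e6 := hf.realArr 6 (by decide)
    have e7 := hf.realArr 7 (by decide)
    rw [hr] at e4 e5 e6 e7
    by_cases hk' : k = s.natReg 0 + N
    · simp [hk', append, e4, e5, e6, e7]
    · simpa [hk'] using ih k (by omega))
  rwa [h1] at this

/-- The coordinates of the corners in the order in which `listCorners` produces them. -/
def cornerX (x₀ x₁ : ℕ → ℝ) (v : ℕ) : ℝ := if v % 4 < 2 then x₀ (v / 4) else x₁ (v / 4)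

def cornerY (y₀ y₁ : ℕ → ℝ) (v : ℕ) : ℝ := if v % 2 = 0 then y₀ (v / 4) else y₁ (v / 4)

theorem listCorners_spec (s : State) :
    (∀ v < 4 * s.natReg 2,
      (listCorners.den s).realArr 8 v = cornerX (s.realArr 0) (s.realArr 1) v) ∧
    (∀ v < 4 * s.natReg 2,
      (listCorners.den s).realArr 9 v = cornerY (s.realArr 2) (s.realArr 3) v) ∧
    ∀ v < 4 * s.natReg 2, (listCorners.den s).natArr 0 v = v / 4 := by
  have hcase : ∀ {v N : ℕ}, v < 4 * (N + 1) → v < 4 * N ∨ v = N + N + (N + N) ∨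
      v = N + N + (N + N) + 1 ∨ v = N + N + (N + N) + 2 ∨ v = N + N + (N + N) + 3 := by
    intros; omega
  unfold listCorners
  simp only [den_seq]
  set c₁ := loop 5 2 (
    realA 8 (cornerIndex 0) (.get 0 (.reg 5)) ;; realA 8 (cornerIndex 1) (.get 0 (.reg 5)) ;;
    realA 8 (cornerIndex 2) (.get 1 (.reg 5)) ;; realA 8 (cornerIndex 3) (.get 1 (.reg 5))) with hc₁
  set c₂ := loop 5 2 (
    realA 9 (cornerIndex 0) (.get 2 (.reg 5)) ;; realA 9 (cornerIndex 1) (.get 3 (.reg 5)) ;;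
    realA 9 (cornerIndex 2) (.get 2 (.reg 5)) ;; realA 9 (cornerIndex 3) (.get 3 (.reg 5))) with hc₂
  set c₃ := loop 5 2 (
    natA 0 (cornerIndex 0) (.reg 5) ;; natA 0 (cornerIndex 1) (.reg 5) ;;
    natA 0 (cornerIndex 2) (.reg 5) ;; natA 0 (cornerIndex 3) (.reg 5)) with hc₃
  have hf₁ := den_frame c₁ s
  have hf₂ := den_frame c₂ (c₁.den s)
  have hf₃ := den_frame c₃ (c₂.den (c₁.den s))
  have h₁ : ∀ v < 4 * s.natReg 2,
      (c₁.den s).realArr 8 v = cornerX (s.realArr 0) (s.realArr 1) v := by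
    refine loop_induction (by decide) s (fun N s' => ∀ v < 4 * N,
      s'.realArr 8 v = cornerX (s.realArr 0) (s.realArr 1) v) (by simp) ?_
    intro N s' _ hN hf ih v hv
    have e0 := hf.realArr 0 (by decide)
    have e1 := hf.realArr 1 (by decide)
    simp only [den, cornerIndex, NatExpr.eval, RealExpr.eval, State.setNat_realArr,
      State.setRealArr_realArr, State.setRealArr_natReg, hN, e0, e1, if_true]
    rcases hcase hv with h | rfl | rfl | rfl | rfl
    · simpa [show v ≠ N + N + (N + N) by omega, show v ≠ N + N + (N + N) + 1 by omega,
        show v ≠ N + N + (N + N) + 2 by omega, show v ≠ N + N + (N + N) + 3 by omega]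
        using ih v h
    all_goals
      simp [cornerX, show (N + N + (N + N)) % 4 = 0 by omega, show (N + N + (N + N)) / 4 = N by omega,
        show (N + N + (N + N) + 1) % 4 = 1 by omega, show (N + N + (N + N) + 1) / 4 = N by omega,
        show (N + N + (N + N) + 2) % 4 = 2 by omega, show (N + N + (N + N) + 2) / 4 = N by omega,
        show (N + N + (N + N) + 3) % 4 = 3 by omega, show (N + N + (N + N) + 3) / 4 = N by omega]
  have h₂ : ∀ v < 4 * s.natReg 2,
      (c₂.den (c₁.den s)).realArr 9 v = cornerY (s.realArr 2) (s.realArr 3) v := by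
    rw [← hf₁.natReg 2 (by decide), ← hf₁.realArr 2 (by decide), ← hf₁.realArr 3 (by decide)]
    generalize c₁.den s = s
    refine loop_induction (by decide) s (fun N s' => ∀ v < 4 * N,
      s'.realArr 9 v = cornerY (s.realArr 2) (s.realArr 3) v) (by simp) ?_
    intro N s' _ hN hf ih v hv
    have e0 := hf.realArr 2 (by decide)
    have e1 := hf.realArr 3 (by decide)
    simp only [den, cornerIndex, NatExpr.eval, RealExpr.eval, State.setNat_realArr,
      State.setRealArr_realArr, State.setRealArr_natReg, hN, e0, e1, if_true]
    rcases hcase hv with h | rfl | rfl | rfl | rfl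
    · simpa [show v ≠ N + N + (N + N) by omega, show v ≠ N + N + (N + N) + 1 by omega,
        show v ≠ N + N + (N + N) + 2 by omega, show v ≠ N + N + (N + N) + 3 by omega]
        using ih v h
    all_goals
      simp [cornerY, show (N + N + (N + N)) % 2 = 0 by omega, show (N + N + (N + N)) / 4 = N by omega,
        show (N + N + (N + N) + 1) % 2 = 1 by omega, show (N + N + (N + N) + 1) / 4 = N by omega,
        show (N + N + (N + N) + 2) % 2 = 0 by omega, show (N + N + (N + N) + 2) / 4 = N by omega,
        show (N + N + (N + N) + 3) % 2 = 1 by omega, show (N + N + (N + N) + 3) / 4 = N by omega]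
  have h₃ : ∀ v < 4 * s.natReg 2, (c₃.den (c₂.den (c₁.den s))).natArr 0 v = v / 4 := by
    rw [← hf₁.natReg 2 (by decide), ← hf₂.natReg 2 (by decide)]
    generalize c₂.den (c₁.den s) = s
    refine loop_induction (by decide) s (fun N s' => ∀ v < 4 * N,
      s'.natArr 0 v = v / 4) (by simp) ?_
    intro N s' _ hN hf ih v hv
    simp only [den, cornerIndex, NatExpr.eval, State.setNat_natArr,
      State.setNatArr_natArr, State.setNatArr_natReg, hN, if_true]
    rcases hcase hv with h | rfl | rfl | rfl | rfl
    · simpa [show v ≠ N + N + (N + N) by omega, show v ≠ N + N + (N + N) + 1 by omega,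
        show v ≠ N + N + (N + N) + 2 by omega, show v ≠ N + N + (N + N) + 3 by omega]
        using ih v h
    all_goals
      simp [show (N + N + (N + N)) / 4 = N by omega, show (N + N + (N + N) + 1) / 4 = N by omega,
        show (N + N + (N + N) + 2) / 4 = N by omega, show (N + N + (N + N) + 3) / 4 = N by omega]
  refine ⟨?_, ?_, h₃⟩
  · rw [hf₃.realArr 8 (by decide), hf₂.realArr 8 (by decide)]; exact h₁
  · rw [hf₃.realArr 9 (by decide)]; exact h₂

theorem measure_spec (s : State) : (measure.den s).realReg 0 = 1 + s.natReg 2 *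
    ∑ k ∈ Finset.range (s.natReg 2),
      ((s.realArr 1 k - s.realArr 0 k) + (s.realArr 3 k - s.realArr 2 k)) := by
  set S := ∑ k ∈ Finset.range (s.natReg 2),
      ((s.realArr 1 k - s.realArr 0 k) + (s.realArr 3 k - s.realArr 2 k)) with hS
  unfold measure
  rw [den_seq, den_real]
  set c := loop 6 2 (real 0 (.add (.reg 0)
    (.add (.sub (.get 1 (.reg 6)) (.get 0 (.reg 6)))
      (.sub (.get 3 (.reg 6)) (.get 2 (.reg 6)))))) with hc
  refine loop_induction (i := 5) (b := 2) (c := c) (by decide)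
    (s.setReal 0 ((RealExpr.lit 1).eval s))
    (fun N s' => s'.realReg 0 = 1 + N * S) (by simp [RealExpr.eval]) ?_
  intro N s' _ _ hf ih
  have h2 : s'.natReg 2 = s.natReg 2 := hf.natReg 2 (by decide)
  have e0 : s'.realArr 0 = s.realArr 0 := hf.realArr 0 (by decide)
  have e1 : s'.realArr 1 = s.realArr 1 := hf.realArr 1 (by decide)
  have e2 : s'.realArr 2 = s.realArr 2 := hf.realArr 2 (by decide)
  have e3 : s'.realArr 3 = s.realArr 3 := hf.realArr 3 (by decide)
  have := loop_induction (i := 6) (b := 2) (c := real 0 (.add (.reg 0)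
    (.add (.sub (.get 1 (.reg 6)) (.get 0 (.reg 6)))
      (.sub (.get 3 (.reg 6)) (.get 2 (.reg 6)))))) (by decide) s'
    (fun K s'' => s''.realReg 0 = 1 + N * S + ∑ k ∈ Finset.range K,
      ((s.realArr 1 k - s.realArr 0 k) + (s.realArr 3 k - s.realArr 2 k))) (by simp [ih]) (by
    intro K s'' _ hK hf' ih'
    have e0' := hf'.realArr 0 (by decide)
    have e1' := hf'.realArr 1 (by decide)
    have e2' := hf'.realArr 2 (by decide)
    have e3' := hf'.realArr 3 (by decide)
    simp only [den, RealExpr.eval, NatExpr.eval, State.setNat_realReg, State.setReal_realReg,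
      if_true, hK, e0', e1', e2', e3', e0, e1, e2, e3, ih', Finset.sum_range_succ]
    ring)
  rw [h2, ← hS] at this
  rw [State.setNat_realReg, hc, this]
  push_cast
  ring

/-- Exactly one room passes the test for a given vertex, so the single store that happens is never
overwritten. -/
theorem findHomes_spec (s : State) (hom : ℕ → ℕ) (hlt : ∀ v < s.natReg 3, hom v < s.natReg 0)
    (hiff : ∀ v < s.natReg 3, ∀ i < s.natReg 0,
      (s.realArr 0 i ≤ s.realArr 8 v ∧ s.realArr 8 v ≤ s.realArr 1 i) ∧
      (s.realArr 2 i ≤ s.realArr 9 v ∧ s.realArr 9 v ≤ s.realArr 3 i) ↔ i = hom v) :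
    ∀ v < s.natReg 3, (findHomes.den s).natArr 1 v = hom v := by
  unfold findHomes
  set b := ite (.and (.and (.not (.realLt (.get 8 (.reg 5)) (.get 0 (.reg 6))))
      (.not (.realLt (.get 1 (.reg 6)) (.get 8 (.reg 5)))))
      (.and (.not (.realLt (.get 9 (.reg 5)) (.get 2 (.reg 6))))
      (.not (.realLt (.get 3 (.reg 6)) (.get 9 (.reg 5))))))
    (natA 1 (.reg 5) (.reg 6)) skip with hb
  refine loop_induction (by decide) s (fun N s' => ∀ v < N, s'.natArr 1 v = hom v) (by simp) ?_
  intro N s' hN hN' hf ih v hv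
  have h0 := hf.natReg 0 (by decide)
  have := loop_induction (i := 6) (b := 0) (c := b) (by decide) s'
    -- The entry of the current vertex `N` is guaranteed only once the inner loop has passed its
    -- home room.
    (fun K s'' => ∀ v < N + 1, (v < N ∨ hom v < K) → s''.natArr 1 v = hom v)
    (by
      intro v _ hv
      rw [State.setNat_natArr]
      exact ih v (hv.resolve_right (Nat.not_lt_zero _))) (by
    intro K s'' hK hK' hf' ih' v hv hvK
    rw [h0] at hK
    have h5 : s''.natReg 5 = N := by rw [hf'.natReg 5 (by decide), hN']
    have e0 := (hf'.realArr 0 (by decide)).trans (hf.realArr 0 (by decide))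
    have e1 := (hf'.realArr 1 (by decide)).trans (hf.realArr 1 (by decide))
    have e2 := (hf'.realArr 2 (by decide)).trans (hf.realArr 2 (by decide))
    have e3 := (hf'.realArr 3 (by decide)).trans (hf.realArr 3 (by decide))
    have e8 := (hf'.realArr 8 (by decide)).trans (hf.realArr 8 (by decide))
    have e9 := (hf'.realArr 9 (by decide)).trans (hf.realArr 9 (by decide))
    have hNK := hiff N hN K hK
    simp only [hb, den, Test.eval, RealExpr.eval, NatExpr.eval, hK', h5, e0, e1, e2, e3, e8, e9,
      not_lt, hNK, State.setNat_natArr, State.ite_natArr, State.setNatArr_natArr, if_true]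
    by_cases hKN : K = hom N
    · rw [if_pos hKN]
      split_ifs with hvN
      · rw [hvN, hKN]
      · exact ih' v hv (Or.inl (by omega))
    · rw [if_neg hKN]
      refine ih' v hv ?_
      rcases Nat.lt_succ_iff_lt_or_eq.1 hv with h | h
      · exact Or.inl h
      · subst h
        exact Or.inr (by omega))
  rw [h0] at this
  rw [State.setNat_natArr]
  exact this v hv (Or.inr (hlt v (by omega)))

theorem numberRows_spec (s : State) :
    (∀ v < s.natReg 3, (numberRows.den s).natArr 2 v = v * s.natReg 3) ∧
    (numberRows.den s).natReg 4 = s.natReg 3 * s.natReg 3 := by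
  unfold numberRows
  rw [den_seq, den_nat]
  refine loop_induction (i := 5) (b := 3) (by decide) (s.setNat 4 ((NatExpr.lit 0).eval s))
    (fun N s' => (∀ v < N, s'.natArr 2 v = v * s.natReg 3) ∧ s'.natReg 4 = N * s.natReg 3)
    (by simp [NatExpr.eval]) ?_
  intro N s' _ hN hf ⟨ih1, ih2⟩
  have h3 : s'.natReg 3 = s.natReg 3 := hf.natReg 3 (by decide)
  refine ⟨fun v hv => ?_, ?_⟩
  · simp only [den, NatExpr.eval, State.setNat_natArr, State.setNatArr_natArr, if_true, hN, ih2]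
    split_ifs with h
    · rw [h]
    · exact ih1 v (by omega)
  · simp [den, NatExpr.eval, ih2, h3, add_mul]

theorem numberCells_spec (s : State) (hn : 0 < s.natReg 3) :
    ∀ e < s.natReg 4, (numberCells.den s).natArr 3 e = e / s.natReg 3 ∧
      (numberCells.den s).natArr 4 e = e % s.natReg 3 := by
  unfold numberCells
  simp only [den_seq, den_nat]
  set s₁ := (s.setNat 10 _).setNat 11 _ with hs₁
  have h4 : s.natReg 4 = s₁.natReg 4 := by simp [hs₁]
  have h3₁ : s₁.natReg 3 = s.natReg 3 := by simp [hs₁]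
  rw [h4]
  refine (loop_induction (i := 5) (b := 4) (by decide) s₁
    (fun N s' => (∀ e < N, s'.natArr 3 e = e / s.natReg 3 ∧ s'.natArr 4 e = e % s.natReg 3) ∧
      s'.natReg 10 = N / s.natReg 3 ∧ s'.natReg 11 = N % s.natReg 3)
    (by simp [hs₁, NatExpr.eval]) ?_).1
  intro N s' _ hN hf ⟨ih1, ih2, ih3⟩
  have h3 : s'.natReg 3 = s.natReg 3 := by rw [hf.natReg 3 (by decide), h3₁]
  have hdm := Nat.div_add_mod N (s.natReg 3)
  have hml := Nat.mod_lt N hn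
  have hsucc : (N + 1) / s.natReg 3 = (if N % s.natReg 3 + 1 < s.natReg 3 then N / s.natReg 3 else
      N / s.natReg 3 + 1) ∧ (N + 1) % s.natReg 3 =
      (if N % s.natReg 3 + 1 < s.natReg 3 then N % s.natReg 3 + 1 else 0) := by
    rw [Nat.div_mod_unique hn]
    split_ifs with h
    · omega
    · rw [mul_add]; omega
  rw [hsucc.1, hsucc.2]
  simp only [den, NatExpr.eval, Test.eval, State.setNat_natArr, State.setNatArr_natArr, hN, ih2,
    ih3, State.setNatArr_natReg, State.ite_natReg, State.ite_natArr, State.setNat_natReg, h3]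
  refine ⟨fun e he => ?_, by simp, by simp⟩
  by_cases h : e = N
  · simp [h]
  · simpa [h] using ih1 e (by omega)

end Spec

/-- The values of the loop bounds. -/
def loopBounds (R C : ℕ) : ℕ → ℕ
  | 0 => R
  | 1 => C
  | 2 => R + C
  | 3 => 4 * (R + C)
  | _ => 4 * (R + C) * (4 * (R + C))

/-- The leading term comes from `shrink`: vertices to be tested, times rounds, times cells, times
candidate witnesses, that is `4 m · m · (4 m)² · 4 m` up to a constant. All lower powers of `m` are
bounded by the fifth, since `m` is positive. -/
theorem cost_le (R C : ℕ) (h : 0 < R + C) :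
    collect.cost (loopBounds R C) + (layout.cost (loopBounds R C) +
      solve.cost (loopBounds R C)) ≤ 1000000 * (R + C) ^ 5 := by
  generalize hm : R + C = m at h
  have hR : R ≤ m := by omega
  have hC : C ≤ m := by omega
  simp only [collect, layout, solve, listCorners, measure, findHomes, numberRows, numberCells,
    distances, shrink, write, prune, cost, fill, startCell, pruneCell, witnesses, weightCell,
    shortcutCell, loadCell, lower, raise, entry, natEq, cornerIndex, loopBounds, NatExpr.cost,
    RealExpr.cost, Test.cost, hm]
  ring_nf
  have h1 : m ^ 1 ≤ m ^ 5 := Nat.pow_le_pow_right h (by norm_num)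
  have h2 : m ^ 2 ≤ m ^ 5 := Nat.pow_le_pow_right h (by norm_num)
  have h3 : m ^ 3 ≤ m ^ 5 := Nat.pow_le_pow_right h (by norm_num)
  have h4 : m ^ 4 ≤ m ^ 5 := Nat.pow_le_pow_right h (by norm_num)
  have h5 : 1 ≤ m ^ 5 := Nat.one_le_pow _ _ h
  have h6 : m * R ≤ m ^ 2 := by rw [pow_two]; exact Nat.mul_le_mul_left m hR
  rw [pow_one] at h1
  omega

/-! ### The effect of the whole program, with the geometry isolated in hypotheses. -/

namespace OfficePolygon

variable (P : OfficePolygon)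

/-- The number of rectangles. -/
def numRects : ℕ := P.numRooms + P.numCorridors

/-- A coordinate of the rectangles, rooms first. -/
def coord (f : Rect → ℝ) : ℕ → ℝ :=
  append P.numRooms (toArray fun i => f (P.room i)) (toArray fun j => f (P.corridor j))

def vertexX : ℕ → ℝ := cornerX (P.coord Rect.x₀) (P.coord Rect.x₁)

def vertexY : ℕ → ℝ := cornerY (P.coord Rect.y₀) (P.coord Rect.y₁)

/-- A number larger than all distances. -/
def farAway : ℝ := 1 + P.numRects * ∑ k ∈ Finset.range P.numRects,
  ((P.coord Rect.x₁ k - P.coord Rect.x₀ k) + (P.coord Rect.y₁ k - P.coord Rect.y₀ k))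

/-- The matrix of distances that the program computes. -/
def distMatrix (hom : ℕ → ℕ) : ℕ → ℕ → ℝ :=
  floydWarshall (edgeWeight P.vertexX P.vertexY hom P.farAway) (4 * P.numRects)

/-- A threshold survives all rounds of pruning. -/
def Passes (hom : ℕ → ℕ) (δ : ℝ) (A : Fin (4 * P.numRects) → Prop) : Prop :=
  ∃ u, Survives (fun u w : Fin (4 * P.numRects) => P.distMatrix hom u w) δ
    (fun u => A u ∧ δ ≤ P.farAway) (inBag P.numRects (4 * P.numRects) hom) P.numRects u u

/-- The geometry enters through the uniqueness of the home room, the monotonicity of feasibility and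
the feasibility of threshold `0`. The last ensures that the optimum is above `-1`, where matrix
entries have their meaning. -/
theorem guardProgram_spec (hm : 0 < P.numRects) (hom : ℕ → ℕ)
    (hlt : ∀ v < 4 * P.numRects, hom v < P.numRooms)
    (hiff : ∀ v < 4 * P.numRects, ∀ i < P.numRooms,
      (P.coord Rect.x₀ i ≤ P.vertexX v ∧ P.vertexX v ≤ P.coord Rect.x₁ i) ∧
      (P.coord Rect.y₀ i ≤ P.vertexY v ∧ P.vertexY v ≤ P.coord Rect.y₁ i) ↔ i = hom v)
    (hmono : ∀ A A' δ, (∀ v, A v → A' v) → P.Passes hom δ A → P.Passes hom δ A')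
    (h0 : P.Passes hom 0 fun _ => True) :
    ∃ (final : State) (t : ℕ) (A : Fin (4 * P.numRects) → Prop) (best : ℝ),
      Exec guardProgram P.input final t ∧ t ≤ 1000000 * P.numRects ^ 5 ∧
      (∀ δ, -1 < δ → (δ ≤ best ↔ P.Passes hom δ fun _ => True)) ∧ P.Passes hom best A ∧
      (∀ v, A v → ¬ P.Passes hom best fun u => A u ∧ u ≠ v) ∧
      final.output = {p | ∃ v, A v ∧ p = (P.vertexX v, P.vertexY v)} := by
  obtain ⟨t₁, ht₁, he₁⟩ := compile_exec (loopBounds P.numRooms P.numCorridors) collect (by decide)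
    (by decide) P.input (by
      simp only [show collect.bounds = [1] from rfl, List.mem_singleton, forall_eq]; rfl)
  have hc := collect_spec P.input
  have hf₁ := den_frame collect P.input
  have hreg₁ : (collect.den P.input).natReg 2 = P.numRects ∧
      (collect.den P.input).natReg 3 = 4 * P.numRects := by
    unfold collect
    simp only [den_seq, den_nat]
    set s := (P.input.setNat 2 _).setNat 3 _ with hs
    set c := loop 5 1 _ with hc
    have hf := den_frame c s
    rw [hf.natReg 2 (by decide), hf.natReg 3 (by decide)]
    simp [hs, NatExpr.eval, input, numRects]
    ring
  set s₁ := collect.den P.input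
  have h0₁ : s₁.natReg 0 = P.numRooms := hf₁.natReg 0 (by decide)
  obtain ⟨t₂, ht₂, he₂⟩ := compile_exec (loopBounds P.numRooms P.numCorridors) layout (by decide)
    (by decide) s₁ (by
      have : ∀ b ∈ layout.bounds, b = 0 ∨ b = 2 ∨ b = 3 := by decide
      intro b hb
      rcases this b hb with rfl | rfl | rfl
      · exact h0₁
      · exact hreg₁.1
      · exact hreg₁.2)
  have hx : ∀ k < P.numRects, s₁.realArr 0 k = P.coord Rect.x₀ k ∧
      s₁.realArr 1 k = P.coord Rect.x₁ k ∧ s₁.realArr 2 k = P.coord Rect.y₀ k ∧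
      s₁.realArr 3 k = P.coord Rect.y₁ k := hc
  have hX : ∀ v < 4 * P.numRects,
      cornerX (s₁.realArr 0) (s₁.realArr 1) v = P.vertexX v := by
    intro v hv
    have hv4 : v / 4 < P.numRects := by omega
    simp only [cornerX, vertexX, (hx _ hv4).1, (hx _ hv4).2.1]
  have hY : ∀ v < 4 * P.numRects,
      cornerY (s₁.realArr 2) (s₁.realArr 3) v = P.vertexY v := by
    intro v hv
    have hv4 : v / 4 < P.numRects := by omega
    simp only [cornerY, vertexY, (hx _ hv4).2.2.1, (hx _ hv4).2.2.2]
  -- the tables produced by `layout`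
  set n := 4 * P.numRects with hn
  have hl := listCorners_spec s₁
  rw [hreg₁.1, ← hn] at hl
  have g₁ := den_frame listCorners s₁
  set a₁ := listCorners.den s₁ with ha₁
  have hmeas := measure_spec a₁
  have g₂ := den_frame measure a₁
  set a₂ := measure.den a₁ with ha₂
  have ha₂3 : a₂.natReg 3 = n := by
    rw [g₂.natReg 3 (by decide), g₁.natReg 3 (by decide), hreg₁.2]
  have ha₂0 : a₂.natReg 0 = P.numRooms := by
    rw [g₂.natReg 0 (by decide), g₁.natReg 0 (by decide), h0₁]
  have e0 : a₂.realArr 0 = s₁.realArr 0 :=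
    (g₂.realArr 0 (by decide)).trans (g₁.realArr 0 (by decide))
  have e1 : a₂.realArr 1 = s₁.realArr 1 :=
    (g₂.realArr 1 (by decide)).trans (g₁.realArr 1 (by decide))
  have e2 : a₂.realArr 2 = s₁.realArr 2 :=
    (g₂.realArr 2 (by decide)).trans (g₁.realArr 2 (by decide))
  have e3 : a₂.realArr 3 = s₁.realArr 3 :=
    (g₂.realArr 3 (by decide)).trans (g₁.realArr 3 (by decide))
  have e8 : a₂.realArr 8 = a₁.realArr 8 := g₂.realArr 8 (by decide)
  have e9 : a₂.realArr 9 = a₁.realArr 9 := g₂.realArr 9 (by decide)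
  have hhome := findHomes_spec a₂ hom (by rw [ha₂3, ha₂0]; exact hlt) (by
    rw [ha₂3, ha₂0]
    intro v hv i hi
    have hi' : i < P.numRects := Nat.lt_of_lt_of_le hi (Nat.le_add_right _ _)
    rw [e0, e1, e2, e3, e8, e9, hl.1 v hv, hl.2.1 v hv, hX v hv, hY v hv, (hx i hi').1,
      (hx i hi').2.1, (hx i hi').2.2.1, (hx i hi').2.2.2]
    exact hiff v hv i hi)
  have g₃ := den_frame findHomes a₂
  set a₃ := findHomes.den a₂ with ha₃
  have hrows := numberRows_spec a₃
  have g₄ := den_frame numberRows a₃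
  have hlay : layout.den s₁ = numberRows.den a₃ := rfl
  rw [hlay] at he₂
  set a₄ := numberRows.den a₃ with ha₄
  have ha₃3 : a₃.natReg 3 = n := by rw [g₃.natReg 3 (by decide), ha₂3]
  rw [ha₃3] at hrows
  have ha₄2 : a₄.natReg 2 = P.numRects := by
    rw [g₄.natReg 2 (by decide), g₃.natReg 2 (by decide), g₂.natReg 2 (by decide),
      g₁.natReg 2 (by decide), hreg₁.1]
  have ha₄3 : a₄.natReg 3 = n := by rw [g₄.natReg 3 (by decide), ha₃3]
  have ha₄own : ∀ v < n, a₄.natArr 0 v = v / 4 := by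
    rw [g₄.natArr 0 (by decide), g₃.natArr 0 (by decide), g₂.natArr 0 (by decide)]
    exact hl.2.2
  have ha₄home : ∀ v < n, a₄.natArr 1 v = hom v := by
    rw [g₄.natArr 1 (by decide)]
    rwa [ha₂3] at hhome
  have ha₄top : a₄.realReg 0 = P.farAway := by
    rw [g₄.realReg 0 (by decide), g₃.realReg 0 (by decide), hmeas, g₁.natReg 2 (by decide), hreg₁.1,
      g₁.realArr 0 (by decide), g₁.realArr 1 (by decide), g₁.realArr 2 (by decide),
      g₁.realArr 3 (by decide), farAway]
    congr 2
    refine Finset.sum_congr rfl fun k hk => ?_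
    obtain ⟨h1, h2, h3, h4⟩ := hx k (Finset.mem_range.1 hk)
    rw [h1, h2, h3, h4]
  have ha₄X : ∀ v < n, a₄.realArr 8 v = P.vertexX v := by
    intro v hv
    rw [g₄.realArr 8 (by decide), g₃.realArr 8 (by decide), e8, hl.1 v hv, hX v hv]
  have ha₄Y : ∀ v < n, a₄.realArr 9 v = P.vertexY v := by
    intro v hv
    rw [g₄.realArr 9 (by decide), g₃.realArr 9 (by decide), e9, hl.2.1 v hv, hY v hv]
  have ha₄5 : ∀ v, a₄.natArr 5 v = 0 := by
    intro v
    rw [g₄.natArr 5 (by decide), g₃.natArr 5 (by decide), g₂.natArr 5 (by decide),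
      g₁.natArr 5 (by decide), hf₁.natArr 5 (by decide)]
    rfl
  obtain ⟨t₃, ht₃, he₃⟩ := compile_exec (loopBounds P.numRooms P.numCorridors) solve (by decide)
    (by decide) a₄ (by
      have : ∀ b ∈ solve.bounds, b = 2 ∨ b = 3 ∨ b = 4 := by decide
      intro b hb
      rcases this b hb with rfl | rfl | rfl
      · exact ha₄2
      · exact ha₄3
      · exact hrows.2)
  have hcells := numberCells_spec a₄ (by rw [ha₄3]; omega)
  rw [hrows.2, ha₄3] at hcells
  have g₅ := den_frame numberCells a₄
  have hsol : solve.den a₄ = write.den (shrink.den (distances.den (numberCells.den a₄))) := rfl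
  rw [hsol] at he₃
  set a₅ := numberCells.den a₄ with ha₅
  have hR : Ready P.numRects n P.vertexX P.vertexY hom P.farAway a₅ := by
    constructor
    · rw [g₅.natReg 2 (by decide), ha₄2]
    · rw [g₅.natReg 3 (by decide), ha₄3]
    · rw [g₅.natReg 4 (by decide), hrows.2]
    · rw [g₅.natArr 0 (by decide)]; exact ha₄own
    · rw [g₅.natArr 1 (by decide)]; exact ha₄home
    · rw [g₅.natArr 2 (by decide)]; exact hrows.1
    · exact fun e he => (hcells e he).1
    · exact fun e he => (hcells e he).2
    · rw [g₅.realReg 0 (by decide), ha₄top]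
    · rw [g₅.realArr 8 (by decide)]; exact ha₄X
    · rw [g₅.realArr 9 (by decide)]; exact ha₄Y
  have hD := distances_spec hR
  have g₆ := den_frame distances a₅
  have hR₆ : Ready P.numRects n P.vertexX P.vertexY hom P.farAway (distances.den a₅) := hR.frame g₆
  set a₆ := distances.den a₅ with ha₆
  clear_value a₆
  have h5 : ∀ v < n, a₆.natArr 5 v = 0 := by
    intro v _
    rw [g₆.natArr 5 (by decide), g₅.natArr 5 (by decide), ha₄5]
  have hbest : IsBest (P.distMatrix hom) P.farAway (inBag P.numRects n hom) (fun _ => True)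
      ((prune.den a₆).realReg 5) := by
    intro δ hδ
    rw [prune_spec hR₆ hD δ hδ]
    exact ⟨hmono (fun v => a₆.natArr 5 v = 0) (fun _ => True) δ fun _ _ => trivial,
      hmono (fun _ => True) (fun v => a₆.natArr 5 v = 0) δ fun v _ => h5 v v.2⟩
  have hb0 : -1 < (prune.den a₆).realReg 5 :=
    lt_of_lt_of_le (by norm_num) ((hbest 0 (by norm_num)).2 h0)
  have hshr := shrink_spec hR₆ hD h5 hmono hbest hb0
  have g₇ := den_frame shrink a₆
  have hR₇ : Ready P.numRects n P.vertexX P.vertexY hom P.farAway (shrink.den a₆) := hR₆.frame g₇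
  refine ⟨_, _, fun v => (shrink.den a₆).natArr 5 v = 0, _,
    Exec.seq he₁ (Exec.seq he₂ he₃), ?_, hbest, hshr.1, hshr.2, ?_⟩
  · exact (add_le_add ht₁ (add_le_add ht₂ ht₃)).trans (cost_le _ _ hm)
  · rw [write_spec hR₇]
    ext p
    exact ⟨fun ⟨v, hv, h1, h2⟩ => ⟨⟨v, hv⟩, h1, h2⟩, fun ⟨v, h1, h2⟩ => ⟨v, v.2, h1, h2⟩⟩

end OfficePolygon

/-! ### Geometry of office-like polygons -/

/-- The coordinate of a point along an axis; `false` is the horizontal axis. -/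
def co (s : Bool) (p : ℝ × ℝ) : ℝ := if s then p.2 else p.1

/-- The point with coordinate `a` along the axis `s` and `b` along the other one. -/
def mkPt (s : Bool) (a b : ℝ) : ℝ × ℝ := if s then (b, a) else (a, b)

/-- The lower (`false`) or upper (`true`) end of a rectangle along an axis. -/
def Rect.bd (s e : Bool) (r : Rect) : ℝ :=
  if s then (if e then r.y₁ else r.y₀) else (if e then r.x₁ else r.x₀)

@[simp] theorem co_mkPt (s : Bool) (a b : ℝ) : co s (mkPt s a b) = a := by
  cases s <;> rfl

@[simp] theorem co_not_mkPt (s : Bool) (a b : ℝ) : co (!s) (mkPt s a b) = b := by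
  cases s <;> rfl

@[simp] theorem co_mkPt_not (s : Bool) (a b : ℝ) : co s (mkPt (!s) a b) = b := by
  cases s <;> rfl

theorem co_ext {p q : ℝ × ℝ} (s : Bool) (h : co s p = co s q) (h' : co (!s) p = co (!s) q) :
    p = q := by
  cases s
  · exact Prod.ext h h'
  · exact Prod.ext h' h

theorem Rect.bd_lt (r : Rect) (s : Bool) : r.bd s false < r.bd s true := by
  cases s
  · exact r.hx
  · exact r.hy

theorem Rect.mem_iff (r : Rect) (s : Bool) (z : ℝ × ℝ) : z ∈ r.toSet ↔
    (r.bd s false ≤ co s z ∧ co s z ≤ r.bd s true) ∧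
      (r.bd (!s) false ≤ co (!s) z ∧ co (!s) z ≤ r.bd (!s) true) := by
  cases s
  · exact Iff.rfl
  · exact and_comm

theorem Rect.isClosed (r : Rect) : IsClosed r.toSet := isClosed_Icc.prod isClosed_Icc

theorem Rect.bd_le (r : Rect) (s e : Bool) : r.bd s false ≤ r.bd s e ∧ r.bd s e ≤ r.bd s true := by
  have := r.bd_lt s
  cases e
  · exact ⟨le_rfl, this.le⟩
  · exact ⟨this.le, le_rfl⟩

theorem Rect.bd_injective (r : Rect) (s : Bool) {e e' : Bool} (h : r.bd s e = r.bd s e') :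
    e = e' := by
  have := r.bd_lt s
  cases e <;> cases e' <;> first | rfl | (exfalso; linarith)

theorem l1Dist_eq (s : Bool) (p q : ℝ × ℝ) :
    l1Dist p q = |co s p - co s q| + |co (!s) p - co (!s) q| := by
  cases s
  · rfl
  · exact add_comm _ _

/-- The corner of a rectangle at given ends of the two axes. -/
def Rect.corner (r : Rect) (e : Bool → Bool) : ℝ × ℝ :=
  (r.bd false (e false), r.bd true (e true))

@[simp] theorem Rect.co_corner (r : Rect) (e : Bool → Bool) (s : Bool) :
    co s (r.corner e) = r.bd s (e s) := by
  cases s <;> rfl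

theorem Rect.corner_mem (r : Rect) (e : Bool → Bool) : r.corner e ∈ r.toSet := by
  rw [r.mem_iff false]
  simp only [co_corner]
  exact ⟨r.bd_le _ _, r.bd_le _ _⟩

theorem Rect.mem_corners (r : Rect) (p : ℝ × ℝ) : p ∈ r.corners ↔ ∃ e, p = r.corner e := by
  simp only [corners, Finset.mem_insert, Finset.mem_singleton]
  constructor
  · rintro (h | h | h | h)
    · exact ⟨fun _ => false, h⟩
    · exact ⟨fun s => s, h⟩
    · exact ⟨fun s => !s, h⟩
    · exact ⟨fun _ => true, h⟩
  · rintro ⟨e, rfl⟩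
    rcases h0 : e false <;> rcases h1 : e true <;> simp [corner, h0, h1, bd]

/-- Being beyond the end `e` of a rectangle along the axis `s`. -/
def Rect.Beyond (r : Rect) (s e : Bool) (x : ℝ) : Prop :=
  if e then r.bd s true < x else x < r.bd s false

theorem Rect.beyond_or (r : Rect) (s : Bool) (x : ℝ) :
    (r.bd s false ≤ x ∧ x ≤ r.bd s true) ∨ ∃ e, r.Beyond s e x := by
  by_cases h : r.bd s false ≤ x
  · by_cases h' : x ≤ r.bd s true
    · exact Or.inl ⟨h, h'⟩
    · exact Or.inr ⟨true, not_le.1 h'⟩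
  · exact Or.inr ⟨false, not_le.1 h⟩

namespace OfficePolygon

variable (P : OfficePolygon)

/-- The rectangles of the polygon. -/
def rect : Fin P.numRooms ⊕ Fin P.numCorridors → Rect := Sum.elim P.room P.corridor

theorem region_eq : P.region = ⋃ k, (P.rect k).toSet := by
  ext z
  simp [region, rect, Set.iUnion_sum]

theorem rect_subset (k) : (P.rect k).toSet ⊆ P.region := by
  rw [region_eq]; exact subset_iUnion (fun k => (P.rect k).toSet) k

theorem exists_link (j : Fin P.numCorridors) : ∃ (s : Bool) (a : Bool → Fin P.numRooms),
    (∀ e, (P.corridor j).bd s e = (P.room (a e)).bd s (!e) ∧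
      (P.room (a e)).bd (!s) false < (P.corridor j).bd (!s) false ∧
      (P.corridor j).bd (!s) true < (P.room (a e)).bd (!s) true) ∧
    ∀ i, (∀ e, i ≠ a e) → Disjoint (P.corridor j).toSet (P.room i).toSet := by
  obtain ⟨a, b, h, hd⟩ := P.links j
  rcases h with ⟨h1, h2, h3, h4, h5, h6⟩ | ⟨h1, h2, h3, h4, h5, h6⟩
  · refine ⟨false, fun e => if e then b else a, fun e => ?_, fun i hi => hd i (hi false) (hi true)⟩
    cases e
    · exact ⟨h1, h3, h4⟩
    · exact ⟨h2, h5, h6⟩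
  · refine ⟨true, fun e => if e then b else a, fun e => ?_, fun i hi => hd i (hi false) (hi true)⟩
    cases e
    · exact ⟨h1, h3, h4⟩
    · exact ⟨h2, h5, h6⟩

/-- The axis along which a corridor links two rooms. -/
def axis (j : Fin P.numCorridors) : Bool := (P.exists_link j).choose

/-- The room at the given end of a corridor. -/
def nbr (j : Fin P.numCorridors) : Bool → Fin P.numRooms := (P.exists_link j).choose_spec.choose

variable {P}

section

variable {j j' : Fin P.numCorridors} {i : Fin P.numRooms} {z : ℝ × ℝ}

theorem link_bd (j : Fin P.numCorridors) (e : Bool) :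
    (P.corridor j).bd (P.axis j) e = (P.room (P.nbr j e)).bd (P.axis j) (!e) :=
  ((P.exists_link j).choose_spec.choose_spec.1 e).1

theorem link_lo (j : Fin P.numCorridors) (e : Bool) :
    (P.room (P.nbr j e)).bd (!P.axis j) false < (P.corridor j).bd (!P.axis j) false :=
  ((P.exists_link j).choose_spec.choose_spec.1 e).2.1

theorem link_hi (j : Fin P.numCorridors) (e : Bool) :
    (P.corridor j).bd (!P.axis j) true < (P.room (P.nbr j e)).bd (!P.axis j) true :=
  ((P.exists_link j).choose_spec.choose_spec.1 e).2.2

theorem room_unique {i i' : Fin P.numRooms} (h : z ∈ (P.room i).toSet)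
    (h' : z ∈ (P.room i').toSet) : i = i' := by
  by_contra hne
  exact Set.disjoint_left.1 (P.rooms_disjoint i i' hne) h h'

theorem corridor_unique (h : z ∈ (P.corridor j).toSet) (h' : z ∈ (P.corridor j').toSet) :
    j = j' := by
  by_contra hne
  exact Set.disjoint_left.1 (P.corridors_disjoint j j' hne) h h'

/-- A corridor and a room meet only in a mouth of the corridor. -/
theorem mouth (hj : z ∈ (P.corridor j).toSet) (hi : z ∈ (P.room i).toSet) :
    ∃ e, i = P.nbr j e ∧ co (P.axis j) z = (P.corridor j).bd (P.axis j) e := by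
  have h : ∃ e, i = P.nbr j e := by
    by_contra! h
    exact Set.disjoint_left.1 ((P.exists_link j).choose_spec.choose_spec.2 i h) hj hi
  obtain ⟨e, rfl⟩ := h
  refine ⟨e, rfl, ?_⟩
  have h1 := ((Rect.mem_iff _ (P.axis j) z).1 hj).1
  have h2 := ((Rect.mem_iff _ (P.axis j) z).1 hi).1
  have h3 := link_bd j e
  cases e
  · exact le_antisymm (h3 ▸ h2.2) h1.1
  · exact le_antisymm h1.2 (h3 ▸ h2.1)

theorem mouth_mem (hj : z ∈ (P.corridor j).toSet) {e : Bool}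
    (h : co (P.axis j) z = (P.corridor j).bd (P.axis j) e) :
    z ∈ (P.room (P.nbr j e)).toSet := by
  have h1 := ((Rect.mem_iff _ (P.axis j) z).1 hj).2
  rw [Rect.mem_iff _ (P.axis j), h, link_bd]
  exact ⟨Rect.bd_le _ _ _, (link_lo j e).le.trans h1.1, h1.2.trans (link_hi j e).le⟩

theorem nbr_injective (j : Fin P.numCorridors) : Function.Injective (P.nbr j) := by
  have key : P.nbr j false ≠ P.nbr j true := by
    intro h
    have h1 := link_bd j false
    have h2 := link_bd j true
    rw [← h] at h2
    have h3 := (P.corridor j).bd_lt (P.axis j)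
    have h4 := (P.room (P.nbr j false)).bd_lt (P.axis j)
    simp only [Bool.not_false, Bool.not_true] at h1 h2
    linarith
  intro e e' h
  cases e <;> cases e' <;> first | rfl | exact absurd h key | exact absurd h.symm key

end

/-! ### Corners and the rectangles that contain them. -/

/-- The room that contains a given corner of a given rectangle. -/
def cornerHome (k : Fin P.numRooms ⊕ Fin P.numCorridors) (e : Bool → Bool) : Fin P.numRooms :=
  match k with
  | .inl i => i
  | .inr j => P.nbr j (e (P.axis j))

/-- Mouths lie strictly inside edges of rooms, so no corridor touches a corner of a room, while a
corner of a corridor lies in the one room at its mouth. This is the combinatorial description of the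
bags. -/
theorem corner_mem_iff (k k' : Fin P.numRooms ⊕ Fin P.numCorridors) (e : Bool → Bool) :
    (P.rect k).corner e ∈ (P.rect k').toSet ↔ k' = k ∨ k' = .inl (cornerHome k e) := by
  have hself := (P.rect k).corner_mem e
  constructor
  · intro h
    rcases k with i | j <;> rcases k' with i' | j'
    · left; rw [room_unique h hself]
    · exfalso
      obtain ⟨e', hi, -⟩ := mouth h hself
      have h1 := ((Rect.mem_iff _ (P.axis j') _).1 h).2
      have h2 := link_lo j' e'
      have h3 := link_hi j' e'
      rw [← hi] at h2 h3
      simp only [Rect.co_corner] at h1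
      change (P.corridor j').bd _ _ ≤ (P.room i).bd _ _ ∧
        (P.room i).bd _ _ ≤ (P.corridor j').bd _ _ at h1
      generalize e (!P.axis j') = b at h1
      cases b <;> linarith [h1.1, h1.2]
    · right
      obtain ⟨e', hi, he⟩ := mouth hself h
      rw [Rect.co_corner] at he
      have := (P.corridor j).bd_injective _ he
      rw [hi, cornerHome, this]
    · left; rw [corridor_unique h hself]
  · rintro (rfl | rfl)
    · exact hself
    · rcases k with i | j
      · exact hself
      · exact mouth_mem hself (by rw [Rect.co_corner]; rfl)

/-- If two rectangles shared a corner, each would contain a corner of the other. By `corner_mem_iff`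
the other one would then be a home room, and the home of a room's corner is the room itself. -/
theorem corner_injective {k k' : Fin P.numRooms ⊕ Fin P.numCorridors} {e e' : Bool → Bool}
    (h : (P.rect k).corner e = (P.rect k').corner e') : k = k' ∧ e = e' := by
  have h1 := (corner_mem_iff k k' e).1 (h ▸ (P.rect k').corner_mem e')
  have h2 := (corner_mem_iff k' k e').1 (h ▸ (P.rect k).corner_mem e)
  have hk : k = k' := by
    rcases h1 with h1 | h1
    · exact h1.symm
    rcases h2 with h2 | h2
    · exact h2
    subst h1
    exact h2
  subst hk
  refine ⟨rfl, funext fun s => (P.rect k).bd_injective s ?_⟩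
  rw [← Rect.co_corner, ← Rect.co_corner, h]

/-! #### Visibility -/

theorem sees_iff {g q : ℝ × ℝ} (s : Bool) : P.Sees g q ↔
    ∀ z, co s z ∈ uIcc (co s g) (co s q) → co (!s) z ∈ uIcc (co (!s) g) (co (!s) q) →
      z ∈ P.region := by
  cases s
  · exact ⟨fun h z h1 h2 => h ⟨h1, h2⟩, fun h z hz => h z hz.1 hz.2⟩
  · exact ⟨fun h z h1 h2 => h ⟨h2, h1⟩, fun h z hz => h z hz.2 hz.1⟩

theorem sees_of_mem {k} {g q : ℝ × ℝ} (hg : g ∈ (P.rect k).toSet) (hq : q ∈ (P.rect k).toSet) :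
    P.Sees g q :=
  (Set.prod_mono (ordConnected_Icc.uIcc_subset hg.1 hq.1)
    (ordConnected_Icc.uIcc_subset hg.2 hq.2)).trans (P.rect_subset k)

/-- A point of a room whose position lies in the range of a corridor sees all of the corridor. -/
theorem sees_corridor {j : Fin P.numCorridors} {e : Bool} {g : ℝ × ℝ}
    (hg : g ∈ (P.room (P.nbr j e)).toSet)
    (hg' : co (!P.axis j) g ∈ Icc ((P.corridor j).bd (!P.axis j) false)
      ((P.corridor j).bd (!P.axis j) true)) :
    ∀ q ∈ (P.corridor j).toSet, P.Sees g q := by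
  intro q hq
  rw [sees_iff (P.axis j)]
  intro z hz hz'
  have h1 := (Rect.mem_iff _ (P.axis j) _).1 hg
  have h2 := (Rect.mem_iff _ (P.axis j) _).1 hq
  have h3 := link_bd j e
  have h4 := link_lo j e
  have h5 := link_hi j e
  have h6 : co (!P.axis j) z ∈ Icc ((P.corridor j).bd (!P.axis j) false)
      ((P.corridor j).bd (!P.axis j) true) :=
    ordConnected_Icc.uIcc_subset hg' h2.2 hz'
  by_cases hzc : (P.corridor j).bd (P.axis j) false ≤ co (P.axis j) z ∧
      co (P.axis j) z ≤ (P.corridor j).bd (P.axis j) true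
  · exact P.rect_subset (.inr j) ((Rect.mem_iff _ (P.axis j) _).2 ⟨hzc, h6⟩)
  · refine P.rect_subset (.inl (P.nbr j e)) ((Rect.mem_iff _ (P.axis j) _).2
      ⟨?_, h4.le.trans h6.1, h6.2.trans h5.le⟩)
    change (P.room (P.nbr j e)).bd _ _ ≤ _ ∧ _ ≤ (P.room (P.nbr j e)).bd _ _
    rw [mem_uIcc] at hz
    have h7 := (P.corridor j).bd_lt (P.axis j)
    have h8 := (P.room (P.nbr j e)).bd_lt (P.axis j)
    cases e
    · simp only [Bool.not_false] at h3
      constructor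
      · rcases hz with hz | hz <;> linarith [h1.1.1, h2.1.1]
      · by_contra hcon
        exact hzc ⟨by linarith, by rcases hz with hz | hz <;> linarith [h1.1.2, h2.1.2]⟩
    · simp only [Bool.not_true] at h3
      constructor
      · by_contra hcon
        exact hzc ⟨by rcases hz with hz | hz <;> linarith [h1.1.1, h2.1.1], by linarith⟩
      · rcases hz with hz | hz <;> linarith [h1.1.2, h2.1.2]

/-- A vertex of the room in front of the mouth would see the whole corridor. For corners of other
corridors independence forbids this; corners of the room itself are out of range because the mouth
is strictly inside an edge. -/
theorem Independent.corner_notMem_range (hP : P.Independent) {j : Fin P.numCorridors} {e : Bool}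
    {k} {c : Bool → Bool} (hc : (P.rect k).corner c ∈ (P.room (P.nbr j e)).toSet)
    (hj : (P.rect k).corner c ∉ (P.corridor j).toSet) :
    co (!P.axis j) ((P.rect k).corner c) ∉ Icc ((P.corridor j).bd (!P.axis j) false)
      ((P.corridor j).bd (!P.axis j) true) := by
  intro hr
  rcases k with i | j'
  · have hi : i = P.nbr j e := room_unique ((P.rect (.inl i)).corner_mem c) hc
    have h1 := link_lo j e
    have h2 := link_hi j e
    rw [← hi] at h1 h2
    rw [Rect.co_corner] at hr
    change (P.room i).bd _ _ ∈ _ at hr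
    generalize c (!P.axis j) = b at hr
    cases b <;> linarith [hr.1, hr.2]
  · have hne : j' ≠ j := by
      rintro rfl; exact hj ((P.rect (.inr j')).corner_mem c)
    exact hP j' j hne _ ((Rect.mem_corners _ _).2 ⟨c, rfl⟩) (sees_corridor hc hr)

/-- If two parallel corridors at one room had overlapping ranges, the lower end of one range would
lie in the other, and a corner of the first corridor would face the second. -/
theorem Independent.range_disjoint (hP : P.Independent) {j j' : Fin P.numCorridors} (hne : j' ≠ j)
    {e e' : Bool} (hroom : P.nbr j e = P.nbr j' e') (hax : P.axis j = P.axis j') {x : ℝ}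
    (hx : x ∈ Icc ((P.corridor j).bd (!P.axis j) false) ((P.corridor j).bd (!P.axis j) true))
    (hx' : x ∈ Icc ((P.corridor j').bd (!P.axis j) false) ((P.corridor j').bd (!P.axis j) true)) :
    False := by
  have key : ∀ {j j' : Fin P.numCorridors} {e e' : Bool}, j' ≠ j → P.nbr j e = P.nbr j' e' →
      P.axis j = P.axis j' →
      (P.corridor j').bd (!P.axis j) false ∈
        Icc ((P.corridor j).bd (!P.axis j) false) ((P.corridor j).bd (!P.axis j) true) →
      False := by
    intro j j' e e' hne hroom hax h
    have hmem : (P.rect (.inr j')).corner (fun s => if s = P.axis j then e' else false) ∈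
        (P.room (P.nbr j e)).toSet := by
      have := (corner_mem_iff (.inr j') (.inl (P.nbr j e))
        (fun s => if s = P.axis j then e' else false)).2
        (Or.inr (by simp [cornerHome, hroom, hax]))
      exact this
    refine hP.corner_notMem_range hmem (fun h' => ?_) ?_
    · exact hne (corridor_unique ((P.rect (.inr j')).corner_mem _) h')
    · rw [Rect.co_corner]
      simpa [rect] using h
  rcases le_total ((P.corridor j).bd (!P.axis j) false) ((P.corridor j').bd (!P.axis j) false)
    with h | h
  · exact key hne hroom hax ⟨h, hx'.1.trans hx.2⟩
  · exact key hne.symm hroom.symm hax.symm (by rw [← hax]; exact ⟨h, hx.1.trans hx'.2⟩)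

theorem co_segment {a b z : ℝ × ℝ} (hz : z ∈ segment ℝ a b) (s : Bool) :
    co s z ∈ uIcc (co s a) (co s b) := by
  have h1 : z.1 ∈ segment ℝ a.1 b.1 := by
    have := mem_image_of_mem (LinearMap.fst ℝ ℝ ℝ).toAffineMap hz
    rwa [image_segment] at this
  have h2 : z.2 ∈ segment ℝ a.2 b.2 := by
    have := mem_image_of_mem (LinearMap.snd ℝ ℝ ℝ).toAffineMap hz
    rwa [image_segment] at this
  rw [segment_eq_uIcc] at h1 h2
  cases s
  · exact h1
  · exact h2

/-- A segment can leave a rectangle only through another rectangle. -/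
theorem exists_rect_at_exit {k} {s e : Bool} {z₀ z₁ : ℝ × ℝ} (h₀ : z₀ ∈ (P.rect k).toSet)
    (hz₀ : co s z₀ = (P.rect k).bd s e) (hz : co (!s) z₀ = co (!s) z₁)
    (hb : (P.rect k).Beyond s e (co s z₁)) (hseg : segment ℝ z₀ z₁ ⊆ P.region) :
    ∃ k' ≠ k, z₀ ∈ (P.rect k').toSet := by
  have hpre : IsPreconnected (segment ℝ z₀ z₁) := (convex_segment _ _).isPreconnected
  rw [isPreconnected_closed_iff] at hpre
  obtain ⟨z, hzs, hzk, hzo⟩ := hpre (P.rect k).toSet (⋃ k' : {k' // k' ≠ k}, (P.rect k').toSet)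
    (P.rect k).isClosed (isClosed_iUnion_of_finite fun k' => (P.rect k'.1).isClosed)
    (by
      intro z hz
      have := hseg hz
      rw [region_eq, mem_iUnion] at this
      obtain ⟨k', hk'⟩ := this
      by_cases h : k' = k
      · subst h; exact Or.inl hk'
      · exact Or.inr (mem_iUnion.2 ⟨⟨k', h⟩, hk'⟩))
    ⟨z₀, left_mem_segment ℝ _ _, h₀⟩
    ⟨z₁, right_mem_segment ℝ _ _, by
      have := hseg (right_mem_segment ℝ z₀ z₁)
      rw [region_eq, mem_iUnion] at this
      obtain ⟨k', hk'⟩ := this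
      refine mem_iUnion.2 ⟨⟨k', ?_⟩, hk'⟩
      rintro rfl
      have := ((Rect.mem_iff _ s _).1 hk').1
      cases e <;> simp only [Rect.Beyond, if_true, Bool.false_eq_true, if_false] at hb <;> linarith⟩
  obtain ⟨⟨k', hne⟩, hk'⟩ := mem_iUnion.1 hzo
  have h1 := co_segment hzs s
  have h2 := co_segment hzs (!s)
  have h3 := ((Rect.mem_iff _ s _).1 hzk).1
  have hzz : z = z₀ := by
    refine co_ext s ?_ ?_
    · rw [mem_uIcc] at h1
      cases e <;> simp only [Rect.Beyond, if_true, Bool.false_eq_true, if_false] at hb <;>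
        rcases h1 with h1 | h1 <;> linarith
    · rw [← hz, uIcc_self] at h2; exact h2
  exact ⟨k', hne, hzz ▸ hk'⟩

/-- If a point sees a point of a rectangle but lies beyond one of its ends, then the line of sight
leaves the rectangle through another rectangle. -/
theorem Sees.exists_rect {g p : ℝ × ℝ} (h : P.Sees g p) {k} {s e : Bool} {y : ℝ}
    (hp : co s p ∈ Icc ((P.rect k).bd s false) ((P.rect k).bd s true))
    (hb : (P.rect k).Beyond s e (co s g)) (hy : y ∈ uIcc (co (!s) g) (co (!s) p))
    (hyk : y ∈ Icc ((P.rect k).bd (!s) false) ((P.rect k).bd (!s) true)) :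
    ∃ k' ≠ k, mkPt s ((P.rect k).bd s e) y ∈ (P.rect k').toSet := by
  rw [sees_iff s] at h
  refine exists_rect_at_exit (s := s) (e := e) (z₁ := mkPt s (co s g) y) ?_ (by simp) (by simp)
    (by simpa using hb) ?_
  · rw [Rect.mem_iff _ s]
    simpa using ⟨(P.rect k).bd_le s e, hyk⟩
  · intro z hz
    have h1 := co_segment hz s
    have h2 := co_segment hz (!s)
    rw [co_not_mkPt, co_not_mkPt, uIcc_self, mem_singleton_iff] at h2
    refine h z ?_ (h2 ▸ hy)
    rw [co_mkPt, co_mkPt] at h1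
    refine uIcc_subset_uIcc ?_ left_mem_uIcc h1
    rw [mem_uIcc]
    have := hp.1
    have := hp.2
    cases e <;> simp only [Rect.Beyond, if_true, Bool.false_eq_true, if_false] at hb
    · left; constructor <;> linarith
    · right; constructor <;> linarith

/-- From a point outside, the line of sight to a corner of the room along an edge would enter the
room at a corner that another rectangle also contains, which `corner_mem_iff` excludes when that
rectangle is not the room itself. -/
theorem mem_room_of_sees {i : Fin P.numRooms} {g : ℝ × ℝ}
    (h : P.Sees g ((P.room i).corner fun _ => false)) : g ∈ (P.room i).toSet := by
  have key : ∀ s, (P.room i).bd s false ≤ co s g ∧ co s g ≤ (P.room i).bd s true := by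
    intro s
    refine ((P.room i).beyond_or s _).resolve_right ?_
    rintro ⟨e, he⟩
    obtain ⟨k', hne, hk'⟩ := h.exists_rect (k := .inl i) (s := s) (e := e)
      (y := (P.room i).bd (!s) false)
      (by rw [Rect.co_corner]; exact Rect.bd_le _ _ _) he (by rw [Rect.co_corner]; exact right_mem_uIcc)
      (Rect.bd_le _ _ _)
    have : mkPt s ((P.rect (.inl i)).bd s e) ((P.room i).bd (!s) false) =
        (P.rect (.inl i)).corner (fun t => if t = s then e else false) :=
      co_ext s (by simp) (by simp [rect])
    rw [this, corner_mem_iff] at hk'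
    rcases hk' with h | h
    · exact hne h
    · exact hne h
  rw [Rect.mem_iff _ false]
  exact ⟨key false, key true⟩

/-- The centre of a rectangle. -/
def _root_.Gallery.Rect.center (r : Rect) : ℝ × ℝ := ((r.x₀ + r.x₁) / 2, (r.y₀ + r.y₁) / 2)

theorem _root_.Gallery.Rect.co_center (r : Rect) (s : Bool) :
    co s r.center = (r.bd s false + r.bd s true) / 2 := by
  cases s <;> rfl

theorem _root_.Gallery.Rect.center_mem (r : Rect) : r.center ∈ r.toSet := by
  have := r.bd_lt
  rw [r.mem_iff false]
  simp only [Rect.co_center, Bool.not_false]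
  exact ⟨⟨by linarith [this false], by linarith [this false]⟩,
    ⟨by linarith [this true], by linarith [this true]⟩⟩

/-- A guard to the side would look through the middle of a long side of the corridor, which no other
rectangle touches. A guard beyond an end, within the range of the corridor, is either in the
adjacent room, against `corner_notMem_range`, or looks across that room through another corridor.
The latter cannot be parallel, by `range_disjoint`, nor perpendicular, since its mouth would lie on
an edge of the room outside the range. -/
theorem Independent.mem_corridor_of_sees (hP : P.Independent) {j : Fin P.numCorridors} {k}
    {c : Bool → Bool} (h : P.Sees ((P.rect k).corner c) (P.corridor j).center) :
    (P.rect k).corner c ∈ (P.corridor j).toSet := by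
  set g := (P.rect k).corner c with hg
  have hctr := (Rect.mem_iff _ (P.axis j) _).1 (P.corridor j).center_mem
  have hlt := (P.corridor j).bd_lt (P.axis j)
  have hcc := (P.corridor j).co_center (P.axis j)
  have h1 : (P.corridor j).bd (!P.axis j) false ≤ co (!P.axis j) g ∧
      co (!P.axis j) g ≤ (P.corridor j).bd (!P.axis j) true := by
    refine ((P.corridor j).beyond_or _ _).resolve_right ?_
    rintro ⟨e, he⟩
    obtain ⟨k', hne, hk'⟩ := h.exists_rect (k := .inr j) (s := !P.axis j) (e := e)
      (y := co (P.axis j) (P.corridor j).center) hctr.2 he (by simp)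
      (by rw [Bool.not_not]; exact hctr.1)
    have hmem : mkPt (!P.axis j) ((P.rect (.inr j)).bd (!P.axis j) e)
        (co (P.axis j) (P.corridor j).center) ∈ (P.corridor j).toSet := by
      rw [Rect.mem_iff _ (!P.axis j)]
      simp only [co_mkPt, co_not_mkPt]
      exact ⟨Rect.bd_le _ _ _, by rw [Bool.not_not]; exact hctr.1⟩
    rcases k' with i | j'
    · obtain ⟨e', -, he'⟩ := mouth hmem hk'
      have : co (P.axis j) (mkPt (!P.axis j) ((P.rect (.inr j)).bd (!P.axis j) e)
        (co (P.axis j) (P.corridor j).center)) = co (P.axis j) (P.corridor j).center :=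
        co_mkPt_not _ _ _
      rw [this] at he'
      cases e' <;> linarith
    · exact hne (by rw [corridor_unique hk' hmem])
  rcases (P.corridor j).beyond_or (P.axis j) (co (P.axis j) g) with h2 | ⟨e, he⟩
  · exact (Rect.mem_iff _ (P.axis j) _).2 ⟨h2, h1⟩
  exfalso
  have hbd := link_bd j e
  have hlo := link_lo j e
  have hhi := link_hi j e
  have hrlt := (P.room (P.nbr j e)).bd_lt (P.axis j)
  have hgr : co (!P.axis j) g ∈ Icc ((P.room (P.nbr j e)).bd (!P.axis j) false)
      ((P.room (P.nbr j e)).bd (!P.axis j) true) := ⟨hlo.le.trans h1.1, h1.2.trans hhi.le⟩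
  by_cases h3 : (P.room (P.nbr j e)).bd (P.axis j) false ≤ co (P.axis j) g ∧
      co (P.axis j) g ≤ (P.room (P.nbr j e)).bd (P.axis j) true
  · have hroom : g ∈ (P.room (P.nbr j e)).toSet := (Rect.mem_iff _ (P.axis j) _).2 ⟨h3, hgr⟩
    refine hP.corner_notMem_range hroom (fun hj => ?_) h1
    have := ((Rect.mem_iff _ (P.axis j) _).1 hj).1
    cases e <;> simp only [Rect.Beyond, if_true, Bool.false_eq_true, if_false] at he <;> linarith
  · have hb : (P.rect (.inl (P.nbr j e))).Beyond (P.axis j) e (co (P.axis j) g) := by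
      change (P.room (P.nbr j e)).Beyond (P.axis j) e (co (P.axis j) g)
      cases e <;> simp only [Rect.Beyond, if_true, Bool.false_eq_true, if_false, Bool.not_true,
        Bool.not_false] at he hbd ⊢ <;> by_contra hcon <;> exact h3 ⟨by linarith, by linarith⟩
    have hsub : P.Sees g (mkPt (P.axis j) ((P.corridor j).bd (P.axis j) e) (co (!P.axis j) g)) := by
      rw [sees_iff (P.axis j)] at h ⊢
      simp only [co_mkPt, co_not_mkPt]
      intro z hz hz'
      refine h z (uIcc_subset_uIcc_left ?_ hz) ?_
      · rw [mem_uIcc]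
        cases e <;> simp only [Rect.Beyond, if_true, Bool.false_eq_true, if_false] at he
        · left; constructor <;> linarith
        · right; constructor <;> linarith
      · rw [uIcc_self, mem_singleton_iff] at hz'
        rw [hz']; exact left_mem_uIcc
    obtain ⟨k', hne, hk'⟩ := hsub.exists_rect (k := .inl (P.nbr j e)) (s := P.axis j) (e := e)
      (y := co (!P.axis j) g)
      (by rw [co_mkPt, hbd]; exact Rect.bd_le _ _ _) hb (by simp) hgr
    set z₀ := mkPt (P.axis j) ((P.rect (.inl (P.nbr j e))).bd (P.axis j) e) (co (!P.axis j) g)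
      with hz₀
    have hz₀r : z₀ ∈ (P.room (P.nbr j e)).toSet := by
      rw [Rect.mem_iff _ (P.axis j)]
      simp only [hz₀, co_mkPt, co_not_mkPt]
      exact ⟨Rect.bd_le _ _ _, hgr⟩
    rcases k' with i | j'
    · exact hne (by rw [room_unique hk' hz₀r])
    obtain ⟨e', hi', he'⟩ := mouth hk' hz₀r
    have hjj : j' ≠ j := by
      rintro rfl
      have := nbr_injective _ hi'
      subst this
      rw [hz₀, co_mkPt, hbd] at he'
      have := Rect.bd_injective _ _ he'
      cases e <;> simp at this
    by_cases hax : P.axis j = P.axis j'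
    · refine hP.range_disjoint hjj hi' hax h1 ?_
      have := ((Rect.mem_iff _ (P.axis j) _).1 hk').2
      rw [hz₀, co_not_mkPt] at this
      exact this
    · have hax' : P.axis j' = !P.axis j := by
        cases h1 : P.axis j <;> cases h2 : P.axis j' <;> simp_all
      rw [link_bd, ← hi', hax', hz₀, co_not_mkPt] at he'
      rw [he'] at h1
      cases e' <;> simp only [Bool.not_true, Bool.not_false] at h1 <;> linarith [h1.1, h1.2]

/-- Vertices guard an independent polygon if and only if there is one in every rectangle. -/
theorem Independent.isGuardSet_iff (hP : P.Independent) (S : Set (ℝ × ℝ)) :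
    P.IsGuardSet S ↔ S ⊆ {p | ∃ k c, p = (P.rect k).corner c} ∧
      ∀ k, ∃ g ∈ S, g ∈ (P.rect k).toSet := by
  have hv : (P.vertices : Set (ℝ × ℝ)) = {p | ∃ k c, p = (P.rect k).corner c} := by
    ext p
    simp [vertices, Rect.mem_corners, rect]
  unfold IsGuardSet
  rw [hv]
  refine and_congr_right fun hS => ⟨fun h k => ?_, fun h p hp => ?_⟩
  · rcases k with i | j
    · obtain ⟨g, hg, hs⟩ := h _ (P.rect_subset (.inl i) ((P.room i).corner_mem fun _ => false))
      exact ⟨g, hg, mem_room_of_sees hs⟩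
    · obtain ⟨g, hg, hs⟩ := h _ (P.rect_subset (.inr j) (P.corridor j).center_mem)
      obtain ⟨k, c, rfl⟩ := hS hg
      exact ⟨_, hg, hP.mem_corridor_of_sees hs⟩
  · rw [region_eq, mem_iUnion] at hp
    obtain ⟨k, hk⟩ := hp
    obtain ⟨g, hg, hgk⟩ := h k
    exact ⟨g, hg, sees_of_mem hgk hk⟩

end OfficePolygon

/-! ### Trees of bags -/

/-- Bags on the nodes of a tree, such that only adjacent bags meet and only in two elements, form
a tree of bags. -/
theorem exists_bagTree {B V : Type*} {G : SimpleGraph B} (hG : G.IsTree) {bag : B → V → Prop}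
    (hadj : ∀ k k' v, k ≠ k' → bag k v → bag k' v → G.Adj k k')
    (hportals : ∀ k k', k ≠ k' → ∃ c c', ∀ v, bag k v → bag k' v → v = c ∨ v = c')
    (hcover : ∀ v, ∃ k, bag k v) : Nonempty (BagTree bag) := by
  obtain ⟨root⟩ := hG.connected.nonempty
  choose p hp hlen using fun k => hG.connected.exists_path_of_dist k root
  -- Going first to a neighbour that is nearer to the root gives a shortest walk, hence the unique
  -- path; so this neighbour is the parent.
  have key : ∀ k k', G.Adj k k' → G.dist k root = G.dist k' root + 1 →
      k ≠ root ∧ (p k).snd = k' := by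
    intro k k' h hd
    have h1 : ((p k').cons h).IsPath := by
      refine SimpleGraph.Walk.isPath_of_length_eq_dist _ ?_
      rw [SimpleGraph.Walk.length_cons, hlen, hd]
    have h2 := (hG.existsUnique_path k root).unique h1 (hp k)
    refine ⟨?_, ?_⟩
    · rintro rfl
      simp at hd
    · rw [← h2]; simp
  refine ⟨⟨root, fun k => (p k).snd, fun k => G.dist k root, ?_, ?_, hportals, hcover⟩⟩
  · intro k hk
    have hnil : ¬ (p k).Nil := SimpleGraph.Walk.not_nil_of_ne hk
    have h1 := SimpleGraph.dist_le (p k).tail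
    have h2 := SimpleGraph.Walk.length_tail_add_one hnil
    have h3 := hlen k
    change G.dist (p k).snd root < _
    omega
  · intro k k' v hne hv hv'
    have h := hadj k k' v hne hv hv'
    have := hG.dist_eq_dist_add_one_of_adj root h
    rw [SimpleGraph.dist_comm, G.dist_comm (u := root)] at this
    rcases this with h1 | h1
    · exact Or.inl (key k k' h h1)
    · exact Or.inr (key k' k h.symm h1)

/-! ### Crossing numbers -/

/-- The signed number of crossings of the part along the axis `s` of the path from `p` to `q`
that first follows the axis `s`, and of the upper ray from `Z` along the other axis. -/
def crossing (s : Bool) (p q Z : ℝ × ℝ) : ℤ :=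
  (if co (!s) Z < co (!s) p then 1 else 0) *
    ((if co s p ≤ co s Z then 1 else 0) - (if co s q ≤ co s Z then 1 else 0))

/-- The signed number of crossings of the other part of this path and of the lower ray
from `Z` along the axis `s`. -/
def crossing' (s : Bool) (p q Z : ℝ × ℝ) : ℤ :=
  (if co s q ≤ co s Z then 1 else 0) *
    ((if co (!s) Z < co (!s) q then 1 else 0) - (if co (!s) Z < co (!s) p then 1 else 0))

/-- The indicator function of the quadrant of points that `p` dominates. -/
def quadrant (s : Bool) (p Z : ℝ × ℝ) : ℤ :=
  (if co (!s) Z < co (!s) p then 1 else 0) * (if co s p ≤ co s Z then 1 else 0)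

/-- The difference of the two counts depends only on the endpoints, so it telescopes along a chain
of points and cancels for a closed curve, where both counts then agree. -/
theorem crossing_sub_crossing' (s : Bool) (p q Z : ℝ × ℝ) :
    crossing s p q Z - crossing' s p q Z = quadrant s p Z - quadrant s q Z := by
  unfold crossing crossing' quadrant
  ring

/-- The segment along the axis `s` from `Z` to `Z'` avoids `A`. -/
def Clear (s : Bool) (A : Set (ℝ × ℝ)) (Z Z' : ℝ × ℝ) : Prop :=
  co (!s) Z = co (!s) Z' ∧ ∀ t ∈ uIcc (co s Z) (co s Z'), mkPt s t (co (!s) Z) ∉ A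

theorem lt_iff_of_notMem_uIcc {a b t : ℝ} (h : t ∉ uIcc a b) : a < t ↔ b < t := by
  rw [mem_uIcc] at h
  push Not at h
  constructor
  · intro h1; exact h.1 h1.le
  · intro h1; exact h.2 h1.le

theorem le_iff_of_notMem_uIcc {a b t : ℝ} (h : t ∉ uIcc a b) : t ≤ a ↔ t ≤ b := by
  rw [mem_uIcc] at h
  push Not at h
  constructor
  · intro h1; by_contra h2; exact absurd (h.2 (not_le.1 h2).le) (not_lt.2 h1)
  · intro h1; by_contra h2; exact absurd (h.1 (not_le.1 h2).le) (not_lt.2 h1)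

/-- Here `Z` moves along the ray. If the ray's line meets the rectangle's range, the segment avoids
the rectangle and so does not pass the position of `p`; otherwise `p` and `q` lie on the same side
of the line and nothing is crossed. The other count behaves in the same way in the other direction.
-/
theorem crossing_eq {s : Bool} {r : Rect} {p q Z Z' : ℝ × ℝ} (hp : p ∈ r.toSet) (hq : q ∈ r.toSet)
    (h : Clear (!s) r.toSet Z Z') : crossing s p q Z = crossing s p q Z' := by
  obtain ⟨h1, h2⟩ := h
  rw [Bool.not_not] at h1 h2
  have hp' := (r.mem_iff s _).1 hp
  have hq' := (r.mem_iff s _).1 hq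
  unfold crossing
  rw [← h1]
  by_cases hX : r.bd s false ≤ co s Z ∧ co s Z ≤ r.bd s true
  · have hnot : co (!s) p ∉ uIcc (co (!s) Z) (co (!s) Z') := by
      intro hmem
      apply h2 _ hmem
      rw [r.mem_iff s]
      simp only [co_mkPt_not, co_mkPt]
      exact ⟨hX, hp'.2⟩
    simp only [lt_iff_of_notMem_uIcc hnot]
  · have : co s p ≤ co s Z ↔ co s q ≤ co s Z := by
      constructor
      · intro h; by_contra h'; exact hX ⟨by linarith, by linarith⟩
      · intro h; by_contra h'; exact hX ⟨by linarith, by linarith⟩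
    simp only [this, sub_self, mul_zero]

theorem crossing'_eq {s : Bool} {r : Rect} {p q Z Z' : ℝ × ℝ} (hp : p ∈ r.toSet)
    (hq : q ∈ r.toSet) (h : Clear s r.toSet Z Z') : crossing' s p q Z = crossing' s p q Z' := by
  obtain ⟨h1, h2⟩ := h
  have hp' := (r.mem_iff s _).1 hp
  have hq' := (r.mem_iff s _).1 hq
  unfold crossing'
  rw [← h1]
  by_cases hY : r.bd (!s) false ≤ co (!s) Z ∧ co (!s) Z ≤ r.bd (!s) true
  · have hnot : co s q ∉ uIcc (co s Z) (co s Z') := by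
      intro hmem
      apply h2 _ hmem
      rw [r.mem_iff s]
      simp only [co_not_mkPt, co_mkPt]
      exact ⟨hq'.1, hY⟩
    simp only [le_iff_of_notMem_uIcc hnot]
  · have : co (!s) Z < co (!s) p ↔ co (!s) Z < co (!s) q := by
      constructor
      · intro h; by_contra h'; exact hY ⟨by linarith, by linarith⟩
      · intro h; by_contra h'; exact hY ⟨by linarith, by linarith⟩
    simp only [this, sub_self, mul_zero]

/-- Some path from `p` to `q` inside `A` has crossing numbers that are constant along segments
outside `A`. -/
def HasCrossings (s : Bool) (A : Set (ℝ × ℝ)) (p q : ℝ × ℝ) : Prop :=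
  ∃ F F' : ℝ × ℝ → ℤ, (∀ Z, F Z - F' Z = quadrant s p Z - quadrant s q Z) ∧
    (∀ Z Z', Clear (!s) A Z Z' → F Z = F Z') ∧ ∀ Z Z', Clear s A Z Z' → F' Z = F' Z'

theorem Clear.mono {s : Bool} {A A' : Set (ℝ × ℝ)} {Z Z' : ℝ × ℝ} (h : Clear s A Z Z')
    (hA : A' ⊆ A) : Clear s A' Z Z' :=
  ⟨h.1, fun t ht hm => h.2 t ht (hA hm)⟩

theorem hasCrossings_of_mem {s : Bool} {A : Set (ℝ × ℝ)} {r : Rect} (hA : r.toSet ⊆ A)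
    {p q : ℝ × ℝ} (hp : p ∈ r.toSet) (hq : q ∈ r.toSet) : HasCrossings s A p q :=
  ⟨crossing s p q, crossing' s p q, crossing_sub_crossing' s p q,
    fun _ _ h => crossing_eq hp hq (h.mono hA), fun _ _ h => crossing'_eq hp hq (h.mono hA)⟩

theorem HasCrossings.trans {s : Bool} {A : Set (ℝ × ℝ)} {p q x : ℝ × ℝ} (h : HasCrossings s A p q)
    (h' : HasCrossings s A q x) : HasCrossings s A p x := by
  obtain ⟨F, F', h1, h2, h3⟩ := h
  obtain ⟨G, G', h4, h5, h6⟩ := h'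
  refine ⟨fun Z => F Z + G Z, fun Z => F' Z + G' Z, fun Z => ?_, fun Z Z' h => ?_, fun Z Z' h => ?_⟩
  · linarith [h1 Z, h4 Z]
  · simp only [h2 Z Z' h, h5 Z Z' h]
  · simp only [h3 Z Z' h, h6 Z Z' h]

/-- A function that is constant along axis-parallel segments outside a closed set with connected
complement is constant. -/
theorem eq_of_clear {A : Set (ℝ × ℝ)} (hA : IsClosed A) (hpre : IsPreconnected Aᶜ)
    {F : ℝ × ℝ → ℤ} (h : ∀ s Z Z', Clear s A Z Z' → F Z = F Z') {Z Z' : ℝ × ℝ} (hZ : Z ∉ A)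
    (hZ' : Z' ∉ A) : F Z = F Z' := by
  refine hpre.induction₂ (fun Z Z' => F Z = F Z') ?_ (fun _ _ _ _ _ _ => Eq.trans)
    (fun _ _ _ _ => Eq.symm) hZ hZ'
  intro Z hZ
  obtain ⟨ε, hε, hball⟩ := Metric.isOpen_iff.1 hA.isOpen_compl Z hZ
  filter_upwards [mem_nhdsWithin_of_mem_nhds (Metric.ball_mem_nhds Z hε)] with Z' hZ'
  have hsub : ∀ W, W.1 ∈ uIcc Z.1 Z'.1 → W.2 ∈ uIcc Z.2 Z'.2 → W ∉ A := by
    intro W h1 h2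
    refine hball ?_
    rw [Metric.mem_ball, Prod.dist_eq, max_lt_iff] at hZ' ⊢
    rw [Real.dist_eq, Real.dist_eq] at *
    exact ⟨(abs_sub_left_of_mem_uIcc h1).trans_lt hZ'.1,
      (abs_sub_left_of_mem_uIcc h2).trans_lt hZ'.2⟩
  -- Inside a ball that avoids `A`, two points are joined by an L-shaped path, so the function is
  -- locally constant on the complement.
  refine (h false Z (Z'.1, Z.2) ⟨rfl, fun t ht => hsub _ ht left_mem_uIcc⟩).trans
    (h true _ _ ⟨rfl, fun t ht => hsub _ right_mem_uIcc ht⟩)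

theorem mkPt_not (s : Bool) (a b : ℝ) : mkPt (!s) a b = mkPt s b a := by
  cases s <;> rfl

theorem continuous_mkPt (s : Bool) (a : ℝ) : Continuous (mkPt s a) := by
  cases s
  · exact continuous_const.prodMk continuous_id
  · exact continuous_id.prodMk continuous_const

namespace OfficePolygon

variable {P : OfficePolygon}

theorem isClosed_region : IsClosed P.region := by
  rw [region_eq]
  exact isClosed_iUnion_of_finite fun k => (P.rect k).isClosed

/-- In a polygon without holes, the part without a corridor does not link its ends. -/
theorem HoleFree.not_hasCrossings (hP : P.HoleFree) (j : Fin P.numCorridors) {p q : ℝ × ℝ} {e : Bool}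
    (hp : p ∈ (P.corridor j).toSet) (hq : q ∈ (P.corridor j).toSet)
    (hpe : co (P.axis j) p = (P.corridor j).bd (P.axis j) e)
    (hqe : co (P.axis j) q = (P.corridor j).bd (P.axis j) (!e))
    (h : HasCrossings (P.axis j) (⋃ k : {k // k ≠ Sum.inr j}, (P.rect k.1).toSet) p q) : False := by
  obtain ⟨s, hs⟩ : ∃ s, s = P.axis j := ⟨_, rfl⟩
  rw [← hs] at hpe hqe h
  set A := ⋃ k : {k // k ≠ Sum.inr j}, (P.rect k.1).toSet with hAdef
  have hAc : IsClosed A := isClosed_iUnion_of_finite fun k => (P.rect k.1).isClosed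
  have hAR : A ⊆ P.region := iUnion_subset fun k => P.rect_subset k
  have hRA : ∀ z ∈ P.region, z ∉ A → z ∈ (P.corridor j).toSet := by
    intro z hz hzA
    rw [region_eq, mem_iUnion] at hz
    obtain ⟨k, hk⟩ := hz
    by_cases hkj : k = .inr j
    · subst hkj; exact hk
    · exact absurd (mem_iUnion.2 ⟨⟨k, hkj⟩, hk⟩) hzA
  obtain ⟨F, F', h1, h2, h3⟩ := h
  set xc := co s (P.corridor j).center with hxc
  have hxc' : xc = ((P.corridor j).bd s false + (P.corridor j).bd s true) / 2 :=
    (P.corridor j).co_center s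
  have hlt := (P.corridor j).bd_lt s
  have hlt' := (P.corridor j).bd_lt (!s)
  set y₀ := (P.corridor j).bd (!s) false with hy₀
  set y₁ := (P.corridor j).bd (!s) true with hy₁
  have hin : ∀ t ∈ Icc y₀ y₁, mkPt s xc t ∉ A := by
    intro t ht hA
    have hm : mkPt s xc t ∈ (P.corridor j).toSet := by
      rw [Rect.mem_iff _ s]
      simp only [co_mkPt, co_not_mkPt]
      exact ⟨⟨by linarith, by linarith⟩, ht⟩
    obtain ⟨⟨k, hk⟩, hkm⟩ := mem_iUnion.1 hA
    rcases k with i | j'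
    · obtain ⟨e', -, he'⟩ := mouth hm hkm
      rw [← hs, co_mkPt] at he'
      cases e' <;> linarith
    · exact hk (by rw [corridor_unique hkm hm])
  have hcont : Continuous fun t => mkPt s xc t := continuous_mkPt s xc
  have hopen : IsOpen {t | mkPt s xc t ∉ A} := hAc.isOpen_compl.preimage hcont
  -- The rest of the polygon is closed, so the transversal through the middle of the corridor can be
  -- prolonged a little beyond both long sides without meeting it.
  obtain ⟨ε₀, hε₀, hb₀⟩ := Metric.isOpen_iff.1 hopen y₀ (hin y₀ ⟨le_rfl, hlt'.le⟩)
  obtain ⟨ε₁, hε₁, hb₁⟩ := Metric.isOpen_iff.1 hopen y₁ (hin y₁ ⟨hlt'.le, le_rfl⟩)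
  have hin' : ∀ t ∈ Icc (y₀ - ε₀ / 2) (y₁ + ε₁ / 2), mkPt s xc t ∉ A := by
    intro t ht
    by_cases h₀ : y₀ ≤ t
    · by_cases h₁ : t ≤ y₁
      · exact hin t ⟨h₀, h₁⟩
      · refine hb₁ ?_
        rw [Metric.mem_ball, Real.dist_eq, abs_lt]
        constructor <;> linarith [ht.2]
    · refine hb₀ ?_
      rw [Metric.mem_ball, Real.dist_eq, abs_lt]
      constructor <;> linarith [ht.1]
  have hF : F (mkPt s xc (y₀ - ε₀ / 2)) = F (mkPt s xc (y₁ + ε₁ / 2)) := by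
    refine h2 _ _ ⟨by simp, fun t ht => ?_⟩
    simp only [co_not_mkPt, Bool.not_not, co_mkPt] at ht ⊢
    rw [uIcc_of_le (by linarith)] at ht
    have := hin' t ht
    rwa [mkPt_not]
  have hout : ∀ t, t < y₀ ∨ y₁ < t → t ∈ Icc (y₀ - ε₀ / 2) (y₁ + ε₁ / 2) →
      mkPt s xc t ∉ P.region := by
    intro t ht ht' hreg
    have := ((Rect.mem_iff _ s _).1 (hRA _ hreg (hin' t ht'))).2
    rw [co_not_mkPt] at this
    rcases ht with ht | ht <;> linarith
  -- The path through the rest of the polygon is closed up through the corridor. The endpoint terms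
  -- cancel, so one function is invariant in both axis directions outside the polygon.
  have hG : ∀ Z, F Z + crossing s q p Z = F' Z + crossing' s q p Z := by
    intro Z
    linarith [h1 Z, crossing_sub_crossing' s q p Z]
  have hjR : (P.corridor j).toSet ⊆ P.region := P.rect_subset (.inr j)
  have hconst := eq_of_clear isClosed_region hP (F := fun Z => F Z + crossing s q p Z)
    (Z := mkPt s xc (y₀ - ε₀ / 2)) (Z' := mkPt s xc (y₁ + ε₁ / 2)) (by
      intro s' Z Z' hc
      by_cases hss : s' = s
      · rw [hss] at hc
        simp only [hG, h3 Z Z' (hc.mono hAR), crossing'_eq hq hp (hc.mono hjR)]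
      · have hss' : s' = !s := Bool.eq_not.2 hss
        rw [hss'] at hc
        simp only [h2 Z Z' (hc.mono hAR), crossing_eq hq hp (hc.mono hjR)])
    (hout _ (Or.inl (by linarith)) ⟨le_rfl, by linarith⟩)
    (hout _ (Or.inr (by linarith)) ⟨by linarith, le_rfl⟩)
  have hq' := ((Rect.mem_iff _ s _).1 hq).2
  simp only [hF, add_right_inj, crossing, co_not_mkPt, co_mkPt, hpe, hqe] at hconst
  -- By connectedness of the complement the closed-up function takes the same value at both ends of
  -- the transversal, and so does `F`. The part through the corridor, however, is crossed once by
  -- the ray from the lower end and not at all by the ray from the upper end.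
  rw [if_pos (by linarith), if_neg (show ¬ y₁ + ε₁ / 2 < co (!s) q by linarith)] at hconst
  cases e
  · rw [Bool.not_false, if_neg (by linarith), if_pos (by linarith)] at hconst
    simp at hconst
  · rw [Bool.not_true, if_pos (by linarith), if_neg (by linarith)] at hconst
    simp at hconst

/-! ### The rectangles form a tree -/

variable (P) in
/-- The graph of intersecting rectangles. -/
def graph : SimpleGraph (Fin P.numRooms ⊕ Fin P.numCorridors) where
  Adj k k' := k ≠ k' ∧ ∃ z, z ∈ (P.rect k).toSet ∧ z ∈ (P.rect k').toSet
  symm := ⟨fun _ _ ⟨h, z, hz, hz'⟩ => ⟨h.symm, z, hz', hz⟩⟩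
  loopless := ⟨fun _ h => h.1 rfl⟩

/-- The rectangles reachable from one of them and the unreachable ones form two closed sets that
cover the connected region. Were both nonempty, they would meet, which would create an edge between
them. -/
theorem graph_connected : P.graph.Connected := by
  have hpre : IsPreconnected P.region := P.connected.isPreconnected
  obtain ⟨z₀, hz₀⟩ : P.region.Nonempty := P.connected.nonempty
  rw [region_eq, mem_iUnion] at hz₀
  obtain ⟨k₀, -⟩ := hz₀
  have : Nonempty (Fin P.numRooms ⊕ Fin P.numCorridors) := ⟨k₀⟩
  refine ⟨?_⟩
  intro k k'
  by_contra hcon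
  rw [isPreconnected_closed_iff] at hpre
  obtain ⟨z, -, hz, hz'⟩ := hpre (⋃ l : {l // P.graph.Reachable k l}, (P.rect l.1).toSet)
    (⋃ l : {l // ¬ P.graph.Reachable k l}, (P.rect l.1).toSet)
    (isClosed_iUnion_of_finite fun l => (P.rect l.1).isClosed)
    (isClosed_iUnion_of_finite fun l => (P.rect l.1).isClosed)
    (by
      intro z hz
      rw [region_eq, mem_iUnion] at hz
      obtain ⟨l, hl⟩ := hz
      by_cases h : P.graph.Reachable k l
      · exact Or.inl (mem_iUnion.2 ⟨⟨l, h⟩, hl⟩)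
      · exact Or.inr (mem_iUnion.2 ⟨⟨l, h⟩, hl⟩))
    ⟨_, P.rect_subset k (P.rect k).center_mem, mem_iUnion.2 ⟨⟨k, .refl _⟩, (P.rect k).center_mem⟩⟩
    ⟨_, P.rect_subset k' (P.rect k').center_mem, mem_iUnion.2 ⟨⟨k', hcon⟩, (P.rect k').center_mem⟩⟩
  obtain ⟨⟨l, hl⟩, hzl⟩ := mem_iUnion.1 hz
  obtain ⟨⟨l', hl'⟩, hzl'⟩ := mem_iUnion.1 hz'
  refine hl' (hl.trans (SimpleGraph.Adj.reachable ⟨?_, z, hzl, hzl'⟩))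
  rintro rfl
  exact hl' hl

/-- The middle of a mouth of a corridor. -/
def _root_.Gallery.Rect.mid (r : Rect) (s e : Bool) : ℝ × ℝ := mkPt s (r.bd s e) (co (!s) r.center)

theorem _root_.Gallery.Rect.mid_mem (r : Rect) (s e : Bool) : r.mid s e ∈ r.toSet := by
  rw [r.mem_iff s, Rect.mid, co_mkPt, co_not_mkPt]
  exact ⟨r.bd_le s e, ((r.mem_iff s _).1 r.center_mem).2⟩

theorem _root_.Gallery.Rect.co_mid (r : Rect) (s e : Bool) : co s (r.mid s e) = r.bd s e :=
  co_mkPt _ _ _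

theorem graph_adj_inr {j : Fin P.numCorridors} {k} (h : P.graph.Adj k (.inr j)) :
    ∃ e, k = .inl (P.nbr j e) := by
  obtain ⟨hne, z, hz, hz'⟩ := h
  rcases k with i | j'
  · obtain ⟨e, rfl, -⟩ := mouth hz' hz
    exact ⟨e, rfl⟩
  · exact absurd (by rw [corridor_unique hz hz']) hne

/-- A route from the room to the corridor that avoids their common edge must arrive through the room
at the other mouth. It yields crossing numbers for a path between the two mouths outside the
corridor, contrary to `not_hasCrossings`. -/
theorem HoleFree.isBridge (hP : P.HoleFree) (j : Fin P.numCorridors) (e : Bool) :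
    ¬ (P.graph.deleteEdges {s(.inl (P.nbr j e), .inr j)}).Reachable
      (.inl (P.nbr j e)) (.inr j) := by
  intro h
  set A := ⋃ k : {k // k ≠ Sum.inr j}, (P.rect k.1).toSet with hAdef
  have hsub : ∀ k ≠ .inr j, (P.rect k).toSet ⊆ A := fun k hk =>
    subset_iUnion (fun k : {k // k ≠ Sum.inr j} => (P.rect k.1).toSet) ⟨k, hk⟩
  have hmid : ∀ e, (P.corridor j).mid (P.axis j) e ∈ (P.rect (.inl (P.nbr j e))).toSet :=
    fun e => mouth_mem (Rect.mid_mem _ _ _) (Rect.co_mid _ _ _)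
  set p := (P.corridor j).mid (P.axis j) e with hp
  -- At the corridor itself the claim is made for the room at its other end, the only neighbour left
  -- after the deletion.
  have key : ∀ k, (P.graph.deleteEdges {s(.inl (P.nbr j e), .inr j)}).Reachable
      (.inl (P.nbr j e)) k →
      ∀ q ∈ (P.rect (if k = .inr j then .inl (P.nbr j (!e)) else k)).toSet,
        HasCrossings (P.axis j) A p q := by
    intro k hk
    rw [SimpleGraph.reachable_iff_reflTransGen] at hk
    induction hk with
    | refl =>
      intro q hq
      rw [if_neg (by simp)] at hq
      exact hasCrossings_of_mem (hsub _ (by simp)) (hmid e) hq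
    | @tail k k' _ hadj ih =>
      rw [SimpleGraph.deleteEdges_adj] at hadj
      obtain ⟨hadj, hedge⟩ := hadj
      have hnbr : ∀ l, P.graph.Adj l (.inr j) → s(l, .inr j) ∉
          ({s(.inl (P.nbr j e), .inr j)} : Set (Sym2 _)) → l = .inl (P.nbr j (!e)) := by
        intro l hl hl'
        obtain ⟨e', rfl⟩ := graph_adj_inr hl
        by_cases he : e' = e
        · subst he; simp at hl'
        · rw [show e' = !e by cases e <;> cases e' <;> simp_all]
      by_cases h1 : k' = .inr j
      · subst h1
        have h2 := hnbr k hadj hedge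
        rw [if_pos rfl, ← h2]
        rwa [if_neg hadj.1] at ih
      · rw [if_neg h1]
        by_cases h2 : k = .inr j
        · subst h2
          have h3 := hnbr k' hadj.symm (by rwa [Sym2.eq_swap (a := k')])
          rwa [if_pos rfl, ← h3] at ih
        · rw [if_neg h2] at ih
          intro q hq
          obtain ⟨-, z, hz, hz'⟩ := hadj
          exact (ih z hz).trans (hasCrossings_of_mem (hsub k' h1) hz' hq)
  have := key _ h _ (by rw [if_pos rfl]; exact hmid (!e))
  exact hP.not_hasCrossings j (Rect.mid_mem _ _ _) (Rect.mid_mem _ _ _) (Rect.co_mid _ _ _)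
    (Rect.co_mid _ _ _) this

theorem HoleFree.graph_isTree (hP : P.HoleFree) : P.graph.IsTree := by
  refine ⟨graph_connected, ?_⟩
  rw [SimpleGraph.isAcyclic_iff_forall_adj_isBridge]
  intro k k' h
  rcases k' with i' | j
  · rcases k with i | j
    · obtain ⟨hne, z, hz, hz'⟩ := h
      exact absurd (by rw [room_unique hz hz']) hne
    · obtain ⟨e, he⟩ := graph_adj_inr h.symm
      rw [he, Sym2.eq_swap, SimpleGraph.isBridge_iff]
      exact hP.isBridge j e
  · obtain ⟨e, rfl⟩ := graph_adj_inr h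
    rw [SimpleGraph.isBridge_iff]
    exact hP.isBridge j e

end OfficePolygon

/-! ### Shortest paths -/

section FloydWarshall

variable {w : ℕ → ℕ → ℝ}

theorem floydWarshall_symm (hw : ∀ u v, w u v = w v u) (K u v : ℕ) :
    floydWarshall w K u v = floydWarshall w K v u := by
  induction K generalizing u v with
  | zero => exact hw u v
  | succ K ih =>
    simp only [floydWarshall]
    rw [ih u v, ih u K, ih K v, add_comm]

theorem floydWarshall_nonneg (hw : ∀ u v, 0 ≤ w u v) (K u v : ℕ) : 0 ≤ floydWarshall w K u v := by
  induction K generalizing u v with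
  | zero => exact hw u v
  | succ K ih => exact le_min (ih u v) (add_nonneg (ih u K) (ih K v))

theorem floydWarshall_le (K u v : ℕ) : floydWarshall w K u v ≤ w u v := by
  induction K with
  | zero => exact le_rfl
  | succ K ih => exact (min_le_left _ _).trans ih

theorem floydWarshall_self (hw : ∀ u v, 0 ≤ w u v) (h0 : ∀ u, w u u = 0) (K u : ℕ) :
    floydWarshall w K u u = 0 :=
  le_antisymm ((floydWarshall_le K u u).trans (h0 u).le) (floydWarshall_nonneg hw K u u)

/-- The inequality through `x` holds from the stage that admits `x` as an intermediate vertex: the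
row and column of `x` do not change in that stage, as its distance to itself is zero, and later
stages preserve the inequality. -/
theorem floydWarshall_triangle (hw : ∀ u v, 0 ≤ w u v) (h0 : ∀ u, w u u = 0) (K : ℕ) :
    ∀ x < K, ∀ u v, floydWarshall w K u v ≤ floydWarshall w K u x + floydWarshall w K x v := by
  induction K with
  | zero => intro x hx; omega
  | succ K ih =>
    intro x hx u v
    have hself := floydWarshall_self hw h0 K K
    have hnn := floydWarshall_nonneg hw K
    have h1 : floydWarshall w (K + 1) u v ≤ floydWarshall w K u v := min_le_left _ _
    have h2 : floydWarshall w (K + 1) u v ≤ floydWarshall w K u K + floydWarshall w K K v :=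
      min_le_right _ _
    rcases Nat.lt_succ_iff_lt_or_eq.1 hx with hx | rfl
    · have h3 := ih x hx u v
      have h4 := ih x hx u K
      have h5 := ih x hx K v
      have h6 : floydWarshall w (K + 1) u x =
        min (floydWarshall w K u x) (floydWarshall w K u K + floydWarshall w K K x) := rfl
      have h7 : floydWarshall w (K + 1) x v =
        min (floydWarshall w K x v) (floydWarshall w K x K + floydWarshall w K K v) := rfl
      have h8 := hnn K x
      have h9 := hnn x K
      rcases min_choice (floydWarshall w K u x) (floydWarshall w K u K + floydWarshall w K K x)
        with h | h <;>
      rcases min_choice (floydWarshall w K x v) (floydWarshall w K x K + floydWarshall w K K v)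
        with h' | h' <;> linarith
    · have h3 : floydWarshall w (x + 1) u x = floydWarshall w x u x := by
        simp [floydWarshall, hself]
      have h4 : floydWarshall w (x + 1) x v = floydWarshall w x x v := by
        simp [floydWarshall, hself]
      rw [h3, h4]
      exact h2

/-- A computed distance is the length of a walk, unless it is at least `M`. -/
theorem floydWarshall_cases (hw : ∀ u v, 0 ≤ w u v) {n : ℕ} {M : ℝ} {R : Fin n → Fin n → ℝ → Prop}
    (hR : ∀ u v x L L', R u v L → R v x L' → R u x (L + L'))
    (h : ∀ u v : Fin n, R u v (w u v) ∨ M ≤ w u v) (K : ℕ) (hK : K ≤ n) :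
    ∀ u v : Fin n, R u v (floydWarshall w K u v) ∨ M ≤ floydWarshall w K u v := by
  induction K with
  | zero => exact h
  | succ K ih =>
    intro u v
    have hnn := floydWarshall_nonneg hw K
    simp only [floydWarshall]
    rcases min_choice (floydWarshall w K u v) (floydWarshall w K u K + floydWarshall w K K v)
      with h | h <;> rw [h]
    · exact ih (by omega) u v
    · have h1 := ih (by omega) u ⟨K, hK⟩
      have h2 := ih (by omega) ⟨K, hK⟩ v
      simp only at h1 h2
      rcases h1 with h1 | h1
      · rcases h2 with h2 | h2
        · exact Or.inl (hR _ _ _ _ _ h1 h2)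
        · exact Or.inr (by linarith [hnn u K])
      · exact Or.inr (by linarith [hnn K v])

end FloydWarshall

/-! ### Geodesic `L₁`-distances between vertices. -/

theorem l1Dist_self (p : ℝ × ℝ) : l1Dist p p = 0 := by simp [l1Dist]

theorem l1Dist_triangle (p q z : ℝ × ℝ) : l1Dist p z ≤ l1Dist p q + l1Dist q z := by
  have := abs_sub_le p.1 q.1 z.1
  have := abs_sub_le p.2 q.2 z.2
  unfold l1Dist
  linarith

theorem l1Dist_lineMap (a b : ℝ × ℝ) {t t' : ℝ} (h : t ≤ t') :
    l1Dist (AffineMap.lineMap a b t) (AffineMap.lineMap a b t') = (t' - t) * l1Dist a b := by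
  have key : ∀ x y : ℝ, |AffineMap.lineMap x y t - AffineMap.lineMap x y t'| =
      (t' - t) * |x - y| := by
    intro x y
    rw [← abs_of_nonneg (sub_nonneg.2 h), ← abs_mul, AffineMap.lineMap_apply_ring',
      AffineMap.lineMap_apply_ring']
    congr 1
    ring
  unfold l1Dist
  rw [mul_add, ← key, ← key]
  simp [AffineMap.lineMap_apply]

theorem Rect.convex (r : Rect) : Convex ℝ r.toSet := (convex_Icc _ _).prod (convex_Icc _ _)

namespace OfficePolygon

variable {P : OfficePolygon}

/-- The geodesics from a vertex of a rectangle to a point of a second rectangle can pass through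
a common vertex. -/
theorem Independent.exists_portal (hP : P.Independent) {k k'} (hne : k ≠ k') {k₀}
    {c : Bool → Bool} (hc : (P.rect k₀).corner c ∈ (P.rect k).toSet) {z : ℝ × ℝ}
    (hz : z ∈ (P.rect k).toSet) (hz' : z ∈ (P.rect k').toSet) : ∃ k₁ c₁,
      (P.rect k₁).corner c₁ ∈ (P.rect k).toSet ∧ (P.rect k₁).corner c₁ ∈ (P.rect k').toSet ∧
      l1Dist ((P.rect k₀).corner c) z = l1Dist ((P.rect k₀).corner c) ((P.rect k₁).corner c₁) +
        l1Dist ((P.rect k₁).corner c₁) z := by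
  rcases k with i | j <;> rcases k' with i' | j'
  · exact absurd (by rw [room_unique hz hz']) hne
  · obtain ⟨e, rfl, he⟩ := mouth hz' hz
    by_cases hj : (P.rect k₀).corner c ∈ (P.corridor j').toSet
    · exact ⟨k₀, c, hc, hj, by rw [l1Dist_self, zero_add]⟩
    -- The vertex is not in front of the mouth but off to one side `b`. The corner of the mouth on
    -- that side lies between the vertex and `z` in the transversal direction and has the same axial
    -- coordinate as `z`.
    have hr := hP.corner_notMem_range hc hj
    obtain ⟨b, hb⟩ := ((P.corridor j').beyond_or (!P.axis j')
      (co (!P.axis j') ((P.rect k₀).corner c))).resolve_left hr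
    refine ⟨.inr j', fun t => if t = P.axis j' then e else b, ?_, (P.corridor j').corner_mem _, ?_⟩
    · rw [corner_mem_iff]; right; simp [cornerHome]
    · have hz2 := ((Rect.mem_iff _ (P.axis j') _).1 hz').2
      have h1 : co (P.axis j') ((P.rect (.inr j')).corner
          fun t => if t = P.axis j' then e else b) = co (P.axis j') z := by
        rw [he, Rect.co_corner, if_pos rfl]; rfl
      have h2 : co (!P.axis j') ((P.rect (.inr j')).corner
          fun t => if t = P.axis j' then e else b) = (P.corridor j').bd (!P.axis j') b := by
        rw [Rect.co_corner, if_neg (by simp)]; rfl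
      rw [l1Dist_eq (P.axis j'), l1Dist_eq (P.axis j'), l1Dist_eq (P.axis j'), h1, h2, sub_self,
        abs_zero, zero_add, add_assoc, add_right_inj]
      change _ ≤ _ ∧ _ ≤ _ at hz2
      simp only [rect, Sum.elim_inr] at hz2
      cases b <;> simp only [Rect.Beyond, if_true, Bool.false_eq_true, if_false] at hb
      · rw [abs_of_nonpos (by linarith), abs_of_nonpos (by linarith), abs_of_nonpos (by linarith)]
        ring
      · rw [abs_of_nonneg (by linarith), abs_of_nonneg (by linarith), abs_of_nonneg (by linarith)]
        ring
  · obtain ⟨e, rfl, he⟩ := mouth hz hz'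
    obtain rfl : Sum.inr j = k₀ := by
      rcases (corner_mem_iff _ _ _).1 hc with h | h
      · exact h
      · cases h
    -- From a corner of the corridor a geodesic may first follow the corridor to the mouth
    -- containing `z`, ending at a corner of that mouth, and then move within the mouth.
    refine ⟨.inr j, fun t => if t = P.axis j then e else c t, (P.corridor j).corner_mem _, ?_, ?_⟩
    · rw [corner_mem_iff]; right; simp [cornerHome]
    · have h1 : co (P.axis j) ((P.rect (.inr j)).corner
          fun t => if t = P.axis j then e else c t) = co (P.axis j) z := by
        rw [he, Rect.co_corner, if_pos rfl]; rfl
      have h2 : co (!P.axis j) ((P.rect (.inr j)).corner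
          fun t => if t = P.axis j then e else c t) =
          co (!P.axis j) ((P.rect (.inr j)).corner c) := by
        rw [Rect.co_corner, Rect.co_corner, if_neg (by simp)]
      rw [l1Dist_eq (P.axis j), l1Dist_eq (P.axis j), l1Dist_eq (P.axis j), h1, h2]
      simp
  · exact absurd (by rw [corridor_unique hz hz']) hne

/-- A segment of the polygon that does not end at a given point continues in some rectangle. -/
theorem exists_rect_right {a b : ℝ × ℝ} (hab : segment ℝ a b ⊆ P.region) {t y : ℝ} (ht : 0 ≤ t)
    (ht1 : t < 1) (hy : t < y) : ∃ t' ∈ Ioc t y, t' ≤ 1 ∧ ∃ k,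
      AffineMap.lineMap a b t ∈ (P.rect k).toSet ∧ AffineMap.lineMap a b t' ∈ (P.rect k).toSet := by
  have hcont : Continuous (AffineMap.lineMap a b : ℝ → ℝ × ℝ) := AffineMap.lineMap_continuous
  -- There are finitely many closed rectangles, so a point close enough to the given one lies only
  -- in rectangles that contain the given point too.
  have hev : ∀ᶠ t' in nhds t, ∀ k, AffineMap.lineMap a b t' ∈ (P.rect k).toSet →
      AffineMap.lineMap a b t ∈ (P.rect k).toSet := by
    rw [Filter.eventually_all]
    intro k
    by_cases hk : AffineMap.lineMap a b t ∈ (P.rect k).toSet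
    · exact Filter.Eventually.of_forall fun _ _ => hk
    · filter_upwards [((P.rect k).isClosed.preimage hcont).isOpen_compl.mem_nhds hk] with t' h h'
      exact absurd h' h
  have hlt : t < min y 1 := lt_min hy ht1
  obtain ⟨t', h1, h2⟩ := ((hev.filter_mono nhdsWithin_le_nhds).and (Ioc_mem_nhdsGT hlt)).exists
  have h3 : AffineMap.lineMap a b t' ∈ P.region := by
    apply hab
    rw [segment_eq_image_lineMap]
    exact mem_image_of_mem _ ⟨ht.trans h2.1.le, h2.2.trans (min_le_right _ _)⟩
  rw [region_eq, mem_iUnion] at h3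
  obtain ⟨k, hk⟩ := h3
  exact ⟨t', ⟨h2.1, h2.2.trans (min_le_left _ _)⟩, h2.2.trans (min_le_right _ _), k, h1 k hk, hk⟩

section Vertices

variable {V : Type*} {pos : V → ℝ × ℝ} {D : V → V → ℝ}

/-- A path between vertices is no shorter than a vertex distance that satisfies the triangle
inequality and is bounded by the `L₁`-distance inside each rectangle. -/
theorem Independent.le_pathLength [Finite V] (hP : P.Independent)
    (hpos : ∀ v, ∃ k c, pos v = (P.rect k).corner c)
    (hsurj : ∀ k c, ∃ v, pos v = (P.rect k).corner c) (hself : ∀ u, D u u = 0)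
    (htri : ∀ u v x, D u x ≤ D u v + D v x)
    (hD : ∀ k u v, pos u ∈ (P.rect k).toSet → pos v ∈ (P.rect k).toSet →
      D u v ≤ l1Dist (pos u) (pos v)) {u v : V} {n : ℕ} {z : ℕ → ℝ × ℝ}
    (hz : P.IsPath (pos u) (pos v) n z) : D u v ≤ pathLength n z := by
  obtain ⟨hz0, hzn, hseg⟩ := hz
  -- The invariant along the path: the current rectangle contains a vertex `v` for which `D u v`
  -- plus the distance from `v` to the current point is at most the length so far. A change of
  -- rectangle replaces `v` by a portal.
  have htransfer : ∀ {k k' x T}, x ∈ (P.rect k).toSet → x ∈ (P.rect k').toSet →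
      (∃ v, pos v ∈ (P.rect k).toSet ∧ D u v + l1Dist (pos v) x ≤ T) →
      ∃ v, pos v ∈ (P.rect k').toSet ∧ D u v + l1Dist (pos v) x ≤ T := by
    rintro k k' x T hx hx' ⟨v, hv, hT⟩
    by_cases hkk : k = k'
    · exact ⟨v, hkk ▸ hv, hT⟩
    obtain ⟨k₀, c, hc⟩ := hpos v
    rw [hc] at hv hT
    obtain ⟨k₁, c₁, h1, h2, h3⟩ := hP.exists_portal hkk hv hx hx'
    obtain ⟨v', hv'⟩ := hsurj k₁ c₁
    refine ⟨v', hv' ▸ h2, ?_⟩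
    have h4 := htri u v v'
    have h5 := hD k v v' (hc ▸ hv) (hv' ▸ h1)
    rw [hc, hv'] at h5
    rw [hv']
    linarith
  have hstep : ∀ {a b : ℝ × ℝ} {T}, segment ℝ a b ⊆ P.region →
      (∃ k, a ∈ (P.rect k).toSet ∧ ∃ v, pos v ∈ (P.rect k).toSet ∧
        D u v + l1Dist (pos v) a ≤ T) →
      ∃ k, b ∈ (P.rect k).toSet ∧ ∃ v, pos v ∈ (P.rect k).toSet ∧
        D u v + l1Dist (pos v) b ≤ T + l1Dist a b := by
    intro a b T hab ha
    set s : Set ℝ := {t | ∃ k, AffineMap.lineMap a b t ∈ (P.rect k).toSet ∧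
      ∃ v, pos v ∈ (P.rect k).toSet ∧
        D u v + l1Dist (pos v) (AffineMap.lineMap a b t) ≤ T + t * l1Dist a b} with hs
    have hcont : Continuous (AffineMap.lineMap a b : ℝ → ℝ × ℝ) := AffineMap.lineMap_continuous
    have hclosed : IsClosed s := by
      have : s = ⋃ k, ⋃ v : {v // pos v ∈ (P.rect k).toSet},
          {t | AffineMap.lineMap a b t ∈ (P.rect k).toSet ∧
            D u v + l1Dist (pos v) (AffineMap.lineMap a b t) ≤ T + t * l1Dist a b} := by
        ext t
        simp only [hs, mem_ofPred_eq, mem_iUnion, Subtype.exists, exists_prop]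
        constructor
        · rintro ⟨k, h1, v, h2, h3⟩; exact ⟨k, v, h2, h1, h3⟩
        · rintro ⟨k, v, h2, h1, h3⟩; exact ⟨k, h1, v, h2, h3⟩
      rw [this]
      refine isClosed_iUnion_of_finite fun k => isClosed_iUnion_of_finite fun v => ?_
      refine ((P.rect k).isClosed.preimage hcont).inter (s₂ := {t | D u v +
        l1Dist (pos v) (AffineMap.lineMap a b t) ≤ T + t * l1Dist a b}) (isClosed_le ?_ ?_)
      · have : Continuous (l1Dist (pos v)) := by unfold l1Dist; fun_prop
        exact continuous_const.add (this.comp hcont)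
      · fun_prop
    -- Continuous induction along the segment: the set of good parameters is closed, and from each
    -- of them one can advance within a single rectangle, changing rectangles first if necessary.
    have hsub : Icc 0 1 ⊆ s := by
      refine IsClosed.Icc_subset_of_forall_exists_gt (hclosed.inter isClosed_Icc) ?_ ?_
      · simpa [hs] using ha
      · rintro t ⟨⟨k, hk, hv⟩, ht⟩ y hy
        obtain ⟨t', ht', -, k', h1, h2⟩ := exists_rect_right hab ht.1 ht.2 hy
        obtain ⟨v, hv, hT⟩ := htransfer hk h1 hv
        refine ⟨t', ⟨k', h2, v, hv, ?_⟩, ht'⟩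
        have h3 := l1Dist_triangle (pos v) (AffineMap.lineMap a b t) (AffineMap.lineMap a b t')
        rw [l1Dist_lineMap a b ht'.1.le] at h3
        linarith
    simpa [hs] using hsub (right_mem_Icc.2 zero_le_one)
  have hind : ∀ i ≤ n, ∃ k, z i ∈ (P.rect k).toSet ∧ ∃ v, pos v ∈ (P.rect k).toSet ∧
      D u v + l1Dist (pos v) (z i) ≤ pathLength i z := by
    intro i hi
    induction i with
    | zero =>
      obtain ⟨k, c, hc⟩ := hpos u
      have hk : pos u ∈ (P.rect k).toSet := hc ▸ (P.rect k).corner_mem c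
      refine ⟨k, hz0 ▸ hk, u, hk, ?_⟩
      rw [hz0, l1Dist_self, hself, pathLength]
      simp
    | succ i ih =>
      rw [pathLength, Finset.sum_range_succ]
      exact hstep (hseg i hi) (ih (by omega))
  obtain ⟨k, hk, v', hv', hT⟩ := hind n le_rfl
  rw [hzn] at hk hT
  linarith [htri u v' v, hD k v' v hv' hk]

theorem exists_path_of_walkLength {B : Type*} {bag : B → V → Prop}
    (hbag : ∀ k u v, bag k u → bag k v → segment ℝ (pos u) (pos v) ⊆ P.region) {u v : V} {L : ℝ}
    (h : WalkLength bag (fun u v => l1Dist (pos u) (pos v)) u v L) :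
    ∃ n z, P.IsPath (pos u) (pos v) n z ∧ pathLength n z = L := by
  induction h with
  | @edge k u v hu hv =>
    refine ⟨1, fun i => if i = 0 then pos u else pos v, ⟨rfl, rfl, ?_⟩, ?_⟩
    · intro i hi
      obtain rfl : i = 0 := by omega
      exact hbag k u v hu hv
    · simp [pathLength]
  | @trans u v x L L' _ _ ih ih' =>
    obtain ⟨n, z, ⟨h1, h2, h3⟩, h4⟩ := ih
    obtain ⟨n', z', ⟨h1', h2', h3'⟩, h4'⟩ := ih'
    have hz : ∀ i ≤ n, (if i ≤ n then z i else z' (i - n)) = z i := fun i hi => if_pos hi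
    have hz' : ∀ i, (if n + i ≤ n then z (n + i) else z' (n + i - n)) = z' i := by
      intro i
      split_ifs with h
      · obtain rfl : i = 0 := by omega
        rw [h1', add_zero, h2]
      · rw [Nat.add_sub_cancel_left]
    refine ⟨n + n', fun i => if i ≤ n then z i else z' (i - n), ⟨?_, ?_, ?_⟩, ?_⟩
    · exact (hz 0 (Nat.zero_le _)).trans h1
    · exact (hz' n').trans h2'
    · intro i hi
      by_cases hin : i < n
      · simp only [hz i hin.le, hz (i + 1) hin]
        exact h3 i hin
      · obtain ⟨l, rfl⟩ := Nat.exists_eq_add_of_le (not_lt.1 hin)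
        simp only [hz' l, add_assoc, hz' (l + 1)]
        exact h3' l (by omega)
    · rw [pathLength, Finset.sum_range_add, ← h4, ← h4', pathLength, pathLength]
      congr 1
      · refine Finset.sum_congr rfl fun i hi => ?_
        rw [Finset.mem_range] at hi
        simp only [hz i hi.le, hz (i + 1) hi]
      · refine Finset.sum_congr rfl fun i _ => ?_
        simp only [hz' i, add_assoc, hz' (i + 1)]

/-- The geodesic distance of two vertices. -/
theorem Independent.geodesicDist_eq [Finite V] (hP : P.Independent)
    (hpos : ∀ v, ∃ k c, pos v = (P.rect k).corner c)
    (hsurj : ∀ k c, ∃ v, pos v = (P.rect k).corner c) (hself : ∀ u, D u u = 0)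
    (htri : ∀ u v x, D u x ≤ D u v + D v x)
    (hD : ∀ k u v, pos u ∈ (P.rect k).toSet → pos v ∈ (P.rect k).toSet →
      D u v ≤ l1Dist (pos u) (pos v)) {B : Type*} {bag : B → V → Prop}
    (hbag : ∀ k u v, bag k u → bag k v → segment ℝ (pos u) (pos v) ⊆ P.region) {u v : V}
    (hwalk : WalkLength bag (fun u v => l1Dist (pos u) (pos v)) u v (D u v)) :
    P.geodesicDist (pos u) (pos v) = ENNReal.ofReal (D u v) := by
  apply le_antisymm
  · obtain ⟨n, z, hz, hL⟩ := exists_path_of_walkLength hbag hwalk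
    rw [← hL]
    exact iInf₂_le_of_le n z (iInf_le _ hz)
  · refine le_iInf fun n => le_iInf fun z => le_iInf fun hz => ENNReal.ofReal_le_ofReal ?_
    exact hP.le_pathLength hpos hsurj hself htri hD hz

/-- A corridor and a room at its end share exactly the two corridor corners of the mouth, which
become the portals; other pairs of rectangles share no vertex. -/
theorem HoleFree.exists_bagTree (hP : P.HoleFree) {B : Type*}
    (f : B ≃ Fin P.numRooms ⊕ Fin P.numCorridors) (hinj : Function.Injective pos)
    (hpos : ∀ v, ∃ k c, pos v = (P.rect k).corner c)
    (hsurj : ∀ k c, ∃ v, pos v = (P.rect k).corner c) {bag : B → V → Prop}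
    (hbag : ∀ k v, bag k v ↔ pos v ∈ (P.rect (f k)).toSet) : Nonempty (BagTree bag) := by
  have hG : (P.graph.comap f).IsTree :=
    (SimpleGraph.Iso.isTree_iff (SimpleGraph.Iso.comap f P.graph)).2 hP.graph_isTree
  have hroom : ∀ j i, ∃ c c', ∀ v, pos v ∈ (P.corridor j).toSet → pos v ∈ (P.room i).toSet →
      v = c ∨ v = c' := by
    intro j i
    by_cases hi : ∃ e, i = P.nbr j e
    · obtain ⟨e, rfl⟩ := hi
      choose x hx using fun b => hsurj (.inr j) fun t => if t = P.axis j then e else b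
      refine ⟨x false, x true, fun v hv hv' => ?_⟩
      obtain ⟨k, c, hc⟩ := hpos v
      rw [hc] at hv hv'
      obtain rfl : Sum.inr j = k := by
        rcases (corner_mem_iff k (.inr j) c).1 hv with h | h
        · exact h
        · cases h
      have he : c (P.axis j) = e := by
        rcases (corner_mem_iff (.inr j) (.inl _) c).1 hv' with h | h
        · cases h
        · exact (nbr_injective j (Sum.inl_injective h)).symm
      have hcx : v = x (c (!P.axis j)) := by
        apply hinj
        rw [hc, hx]
        congr 1
        funext t
        by_cases ht : t = P.axis j
        · rw [if_pos ht, ht, he]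
        · rw [if_neg ht, Bool.eq_not.2 ht]
      rw [hcx]
      cases c (!P.axis j)
      · exact Or.inl rfl
      · exact Or.inr rfl
    · obtain ⟨v, -⟩ := hsurj (.inr j) fun _ => true
      refine ⟨v, v, fun v hv hv' => ?_⟩
      obtain ⟨e, he, -⟩ := mouth hv hv'
      exact absurd ⟨e, he⟩ hi
  refine Gallery.exists_bagTree hG ?_ ?_ ?_
  · intro k k' v hne hv hv'
    exact ⟨fun h => hne (f.injective h), _, (hbag _ _).1 hv, (hbag _ _).1 hv'⟩
  · intro k k' hne
    simp only [hbag]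
    have hne' : f k ≠ f k' := fun h => hne (f.injective h)
    revert hne'
    generalize f k = l
    generalize f k' = l'
    intro hne'
    rcases l with i | j <;> rcases l' with i' | j'
    · obtain ⟨v, -⟩ := hsurj (.inl i) fun _ => true
      exact ⟨v, v, fun v hv hv' => absurd (by rw [room_unique hv hv']) hne'⟩
    · obtain ⟨c, c', h⟩ := hroom j' i
      exact ⟨c, c', fun v hv hv' => h v hv' hv⟩
    · exact hroom j i'
    · obtain ⟨v, -⟩ := hsurj (.inr j) fun _ => true
      exact ⟨v, v, fun v hv hv' => absurd (by rw [corridor_unique hv hv']) hne'⟩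
  · intro v
    obtain ⟨k, c, hc⟩ := hpos v
    refine ⟨f.symm k, (hbag _ _).2 ?_⟩
    rw [Equiv.apply_symm_apply, hc]
    exact Rect.corner_mem _ _

theorem exists_common_corner {k k'} (h : P.graph.Adj k k') :
    ∃ k₁ c₁, (P.rect k₁).corner c₁ ∈ (P.rect k).toSet ∧ (P.rect k₁).corner c₁ ∈ (P.rect k').toSet := by
  have key : ∀ k j, P.graph.Adj k (.inr j) → ∃ c, (P.rect (.inr j)).corner c ∈ (P.rect k).toSet := by
    intro k j h
    obtain ⟨e, rfl⟩ := graph_adj_inr h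
    exact ⟨fun _ => e, (corner_mem_iff _ _ _).2 (Or.inr rfl)⟩
  rcases k with i | j
  · rcases k' with i' | j
    · obtain ⟨hne, z, hz, hz'⟩ := h
      exact absurd (by rw [room_unique hz hz']) hne
    · obtain ⟨c, hc⟩ := key _ _ h
      exact ⟨_, c, hc, Rect.corner_mem _ _⟩
  · obtain ⟨c, hc⟩ := key _ _ h.symm
    exact ⟨_, c, Rect.corner_mem _ _, hc⟩

/-- A bound on all vertex distances. -/
theorem dist_le_card_mul (hpos : ∀ v, ∃ k c, pos v = (P.rect k).corner c)
    (hsurj : ∀ k c, ∃ v, pos v = (P.rect k).corner c)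
    (htri : ∀ u v x, D u x ≤ D u v + D v x) {Δ : ℝ} (hΔ : 0 ≤ Δ)
    (hD : ∀ k u v, pos u ∈ (P.rect k).toSet → pos v ∈ (P.rect k).toSet → D u v ≤ Δ) (u v : V) :
    D u v ≤ (P.numRooms + P.numCorridors : ℕ) * Δ := by
  have hwalk : ∀ {k k'} (p : P.graph.Walk k k') (u : V), pos u ∈ (P.rect k).toSet →
      ∀ v, pos v ∈ (P.rect k').toSet → D u v ≤ (p.length + 1 : ℕ) * Δ := by
    intro k k' p
    induction p with
    | nil =>
      intro u hu v hv
      simpa using hD _ u v hu hv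
    | cons h p ih =>
      intro u hu v hv
      obtain ⟨k₁, c₁, h1, h2⟩ := exists_common_corner h
      obtain ⟨x, hx⟩ := hsurj k₁ c₁
      rw [← hx] at h1 h2
      have h3 := ih x h2 v hv
      have h4 := hD _ u x hu h1
      have h5 := htri u x v
      rw [SimpleGraph.Walk.length_cons]
      push_cast at h3 ⊢
      linarith
  obtain ⟨k, c, hc⟩ := hpos u
  obtain ⟨k', c', hc'⟩ := hpos v
  obtain ⟨p, hp, -⟩ := graph_connected.exists_path_of_dist k k'
  refine (hwalk p u (hc ▸ Rect.corner_mem _ _) v (hc' ▸ Rect.corner_mem _ _)).trans ?_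
  -- A path visits each rectangle at most once, so it has fewer edges than there are rectangles, and
  -- each visited rectangle contributes at most `Δ`.
  have := hp.length_lt
  rw [Fintype.card_sum, Fintype.card_fin, Fintype.card_fin] at this
  exact mul_le_mul_of_nonneg_right (by exact_mod_cast this) hΔ

end Vertices

end OfficePolygon

namespace OfficePolygon

variable (P : OfficePolygon)

/-! ### The vertices in the order of the program -/

/-- The rectangles, rooms first. -/
def rectEquiv : Fin P.numRects ≃ Fin P.numRooms ⊕ Fin P.numCorridors := finSumFinEquiv.symm

/-- The rectangle with the vertex of the given number. -/
def vertexRect (v : Fin (4 * P.numRects)) : Fin P.numRooms ⊕ Fin P.numCorridors :=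
  P.rectEquiv ⟨v / 4, by omega⟩

/-- The end of the rectangle along an axis at which the vertex of the given number lies. -/
def vertexEnd (v : ℕ) (s : Bool) : Bool := if s then decide (v % 2 = 1) else decide (2 ≤ v % 4)

def vertexPos (v : Fin (4 * P.numRects)) : ℝ × ℝ := (P.rect (P.vertexRect v)).corner (vertexEnd v)

/-- The number of the room that contains the vertex of the given number. -/
def homeIndex (v : ℕ) : ℕ :=
  if h : v < 4 * P.numRects then cornerHome (P.vertexRect ⟨v, h⟩) (vertexEnd v) else 0

variable {P}

theorem coord_eq (f : Rect → ℝ) (k : Fin P.numRects) : P.coord f k = f (P.rect (P.rectEquiv k)) := by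
  obtain ⟨l, rfl⟩ := P.rectEquiv.symm.surjective k
  rw [Equiv.apply_symm_apply]
  rcases l with i | j
  · rw [show (P.rectEquiv.symm (.inl i) : ℕ) = i from rfl]
    simp [coord, append, toArray, rect]
  · rw [show (P.rectEquiv.symm (.inr j) : ℕ) = P.numRooms + j from rfl]
    simp [coord, append, toArray, rect]

theorem vertexPos_eq (v : Fin (4 * P.numRects)) : (P.vertexX v, P.vertexY v) = P.vertexPos v := by
  have h := fun f => coord_eq (P := P) f ⟨v / 4, by omega⟩
  simp only at h
  refine Prod.ext ?_ ?_
  · simp only [vertexX, cornerX, vertexPos, Rect.corner, vertexEnd, vertexRect, Rect.bd, h]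
    by_cases hv : 2 ≤ v.1 % 4
    · simp [hv, not_lt.2 hv]
    · simp [hv, not_le.1 hv]
  · simp only [vertexY, cornerY, vertexPos, Rect.corner, vertexEnd, vertexRect, Rect.bd, h]
    rcases Nat.mod_two_eq_zero_or_one v.1 with hv | hv <;> simp [hv]

theorem exists_vertex (k) (c : Bool → Bool) : ∃ v, P.vertexPos v = (P.rect k).corner c := by
  set i := P.rectEquiv.symm k with hi
  -- Corners are numbered by two binary digits, the horizontal end first; this inverts `vertexEnd`.
  refine ⟨⟨4 * i + 2 * (c false).toNat + (c true).toNat, ?_⟩, ?_⟩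
  · have := i.2
    cases c false <;> cases c true <;> simp only [Bool.toNat_true, Bool.toNat_false] <;> omega
  · have h1 : P.vertexRect ⟨4 * i + 2 * (c false).toNat + (c true).toNat, by
        have := i.2
        cases c false <;> cases c true <;> simp only [Bool.toNat_true, Bool.toNat_false] <;>
          omega⟩ = k := by
      have h2 : (⟨(4 * i + 2 * (c false).toNat + (c true).toNat) / 4, by
          have := i.2
          cases c false <;> cases c true <;> simp only [Bool.toNat_true, Bool.toNat_false] <;>
            omega⟩ : Fin P.numRects) = i := by
        apply Fin.ext
        cases c false <;> cases c true <;> simp only [Bool.toNat_true, Bool.toNat_false] <;> omega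
      rw [vertexRect]
      simp only
      rw [h2, hi, Equiv.apply_symm_apply]
    rw [vertexPos, h1]
    congr 1
    funext s
    cases s
    · simp only [vertexEnd, Bool.false_eq_true, if_false]
      rcases h0 : c false <;> rcases h1 : c true <;>
        simp only [Bool.toNat_true, Bool.toNat_false, decide_eq_true_eq, decide_eq_false_iff_not] <;>
        omega
    · simp only [vertexEnd, if_true]
      rcases h0 : c false <;> rcases h1 : c true <;>
        simp only [Bool.toNat_true, Bool.toNat_false, decide_eq_true_eq, decide_eq_false_iff_not] <;>
        omega

theorem vertexPos_injective : Function.Injective P.vertexPos := by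
  intro u v h
  obtain ⟨h1, h2⟩ := corner_injective h
  have h3 := congrArg Fin.val (P.rectEquiv.injective h1)
  have h4 := congrFun h2 false
  have h5 := congrFun h2 true
  simp only [vertexEnd, Bool.false_eq_true, if_false, if_true, decide_eq_decide] at h3 h4 h5
  apply Fin.ext
  omega

theorem homeIndex_eq (v : Fin (4 * P.numRects)) :
    P.homeIndex v = cornerHome (P.vertexRect v) (vertexEnd v) := by
  rw [homeIndex, dif_pos v.2]

theorem rectEquiv_eq_inl (k : Fin P.numRects) (i : Fin P.numRooms) :
    P.rectEquiv k = .inl i ↔ (k : ℕ) = i := by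
  rw [← Equiv.eq_symm_apply, Fin.ext_iff]
  rfl

theorem inBag_iff (k : Fin P.numRects) (v : Fin (4 * P.numRects)) :
    inBag P.numRects (4 * P.numRects) P.homeIndex k v ↔
      P.vertexPos v ∈ (P.rect (P.rectEquiv k)).toSet := by
  rw [vertexPos, corner_mem_iff, inBag, homeIndex_eq, rectEquiv_eq_inl, vertexRect,
    P.rectEquiv.apply_eq_iff_eq, Fin.ext_iff]
  exact or_congr eq_comm eq_comm

theorem homeIndex_iff {v : ℕ} (hv : v < 4 * P.numRects) {i : ℕ} (hi : i < P.numRooms) :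
    (P.coord Rect.x₀ i ≤ P.vertexX v ∧ P.vertexX v ≤ P.coord Rect.x₁ i) ∧
      (P.coord Rect.y₀ i ≤ P.vertexY v ∧ P.vertexY v ≤ P.coord Rect.y₁ i) ↔
    i = P.homeIndex v := by
  have hk : i < P.numRects := hi.trans_le (Nat.le_add_right _ _)
  have h := fun f => coord_eq (P := P) f ⟨i, hk⟩
  have hr : P.rectEquiv ⟨i, hk⟩ = .inl ⟨i, hi⟩ := (rectEquiv_eq_inl _ _).2 rfl
  simp only [hr] at h
  have h1 := vertexPos_eq ⟨v, hv⟩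
  simp only at h1
  rw [h, h, h, h]
  have h2 : (P.vertexX v, P.vertexY v) ∈ (P.rect (.inl ⟨i, hi⟩)).toSet ↔ i = P.homeIndex v := by
    rw [h1, vertexPos, corner_mem_iff, show P.homeIndex v = _ from homeIndex_eq ⟨v, hv⟩]
    simp only [Sum.inl.injEq, Fin.ext_iff]
    constructor
    · rintro (h | h)
      · rw [← h]; rfl
      · exact h
    · exact Or.inr
  exact h2

theorem exists_vertexPos (v : Fin (4 * P.numRects)) :
    ∃ k c, P.vertexPos v = (P.rect k).corner c := ⟨_, _, rfl⟩

/-- The corners of all rectangles are pairwise distinct, so a running time in terms of the number of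
rectangles is one in terms of the number of vertices. -/
theorem four_mul_numRects_le : 4 * P.numRects ≤ P.numVertices := by
  rw [numVertices]
  have := Finset.card_le_card_of_injOn (s := Finset.univ) (t := P.vertices) P.vertexPos
    (fun v _ => ?_) vertexPos_injective.injOn
  · simpa using this
  · obtain ⟨k, c, h⟩ := exists_vertexPos v
    rw [h]
    simp only [vertices, Finset.coe_union, Finset.coe_biUnion, mem_union, mem_iUnion]
    rcases k with i | j
    · exact Or.inl ⟨i, by simp, (Rect.mem_corners _ _).2 ⟨c, rfl⟩⟩
    · exact Or.inr ⟨j, by simp, (Rect.mem_corners _ _).2 ⟨c, rfl⟩⟩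

theorem numRects_pos : 0 < P.numRects := by
  obtain ⟨k⟩ := (graph_connected (P := P)).nonempty
  exact (P.rectEquiv.symm k).pos

/-! ### The distances that the program computes -/

variable (P) in
/-- The sum of the half perimeters of all rectangles. -/
def extent : ℝ := ∑ k ∈ Finset.range P.numRects,
  ((P.coord Rect.x₁ k - P.coord Rect.x₀ k) + (P.coord Rect.y₁ k - P.coord Rect.y₀ k))

theorem farAway_eq : P.farAway = 1 + P.numRects * P.extent := rfl

theorem half_perimeter_nonneg {k : ℕ} (hk : k < P.numRects) :
    0 ≤ (P.coord Rect.x₁ k - P.coord Rect.x₀ k) + (P.coord Rect.y₁ k - P.coord Rect.y₀ k) := by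
  have h := fun f => coord_eq (P := P) f ⟨k, hk⟩
  simp only at h
  rw [h, h, h, h]
  linarith [(P.rect (P.rectEquiv ⟨k, hk⟩)).hx, (P.rect (P.rectEquiv ⟨k, hk⟩)).hy]

theorem extent_nonneg : 0 ≤ P.extent :=
  Finset.sum_nonneg fun _ hk => half_perimeter_nonneg (Finset.mem_range.1 hk)

theorem l1Dist_le_extent {k} {p q : ℝ × ℝ} (hp : p ∈ (P.rect k).toSet) (hq : q ∈ (P.rect k).toSet) :
    l1Dist p q ≤ P.extent := by
  obtain ⟨i, rfl⟩ := P.rectEquiv.surjective k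
  have h := fun f => coord_eq (P := P) f i
  refine le_trans ?_ (Finset.single_le_sum
    (fun k hk => half_perimeter_nonneg (Finset.mem_range.1 hk)) (Finset.mem_range.2 i.2))
  rw [h, h, h, h]
  obtain ⟨⟨h1, h2⟩, h3, h4⟩ := hp
  obtain ⟨⟨h5, h6⟩, h7, h8⟩ := hq
  refine add_le_add ?_ ?_ <;> rw [abs_le] <;> constructor <;> linarith

variable (P) in
/-- The edge weights that the program uses. -/
def weight : ℕ → ℕ → ℝ := edgeWeight P.vertexX P.vertexY P.homeIndex P.farAway

theorem weight_nonneg (u v : ℕ) : 0 ≤ P.weight u v := by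
  unfold weight edgeWeight
  split_ifs
  · positivity
  · have := extent_nonneg (P := P)
    rw [farAway_eq]
    positivity

theorem weight_self (u : ℕ) : P.weight u u = 0 := by simp [weight, edgeWeight]

theorem weight_symm (u v : ℕ) : P.weight u v = P.weight v u := by
  unfold weight edgeWeight
  rw [abs_sub_comm, abs_sub_comm (P.vertexY u)]
  refine if_congr ?_ rfl rfl
  constructor <;> rintro ((h | h) | h | h) <;> simp [h]

theorem weight_of_inBag {k} {u v : Fin (4 * P.numRects)}
    (hu : P.vertexPos u ∈ (P.rect k).toSet) (hv : P.vertexPos v ∈ (P.rect k).toSet) :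
    P.weight u v = l1Dist (P.vertexPos u) (P.vertexPos v) := by
  obtain ⟨k, rfl⟩ := P.rectEquiv.surjective k
  rw [← inBag_iff] at hu hv
  rw [weight, edgeWeight, if_pos]
  · rw [← vertexPos_eq, ← vertexPos_eq]; rfl
  · rcases hu with hu | hu <;> rcases hv with hv | hv <;> simp [hu, hv]

theorem weight_cases (u v : Fin (4 * P.numRects)) :
    (∃ k, inBag P.numRects (4 * P.numRects) P.homeIndex k u ∧
      inBag P.numRects (4 * P.numRects) P.homeIndex k v) ∨ P.weight u v = P.farAway := by
  by_cases h : ((u : ℕ) / 4 = v / 4 ∨ (u : ℕ) / 4 = P.homeIndex v) ∨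
      P.homeIndex u = v / 4 ∨ P.homeIndex u = P.homeIndex v
  · left
    have hu : P.homeIndex u < P.numRects := by
      rw [homeIndex_eq]; exact (Fin.is_lt _).trans_le (Nat.le_add_right _ _)
    have hu' : (u : ℕ) / 4 < P.numRects := by omega
    rcases h with (h | h) | h | h
    · exact ⟨⟨_, hu'⟩, Or.inl rfl, Or.inl h.symm⟩
    · exact ⟨⟨_, hu'⟩, Or.inl rfl, Or.inr h.symm⟩
    · exact ⟨⟨_, hu⟩, Or.inr rfl, Or.inl h.symm⟩
    · exact ⟨⟨_, hu⟩, Or.inr rfl, Or.inr h.symm⟩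
  · right
    rw [weight, edgeWeight, if_neg h]

variable (P) in
def vertexDist (u v : Fin (4 * P.numRects)) : ℝ := P.distMatrix P.homeIndex u v

theorem vertexDist_symm (u v : Fin (4 * P.numRects)) : P.vertexDist u v = P.vertexDist v u :=
  floydWarshall_symm weight_symm _ _ _

theorem vertexDist_nonneg (u v : Fin (4 * P.numRects)) : 0 ≤ P.vertexDist u v :=
  floydWarshall_nonneg weight_nonneg _ _ _

theorem vertexDist_self (u : Fin (4 * P.numRects)) : P.vertexDist u u = 0 :=
  floydWarshall_self weight_nonneg weight_self _ _

theorem vertexDist_triangle (u v x : Fin (4 * P.numRects)) :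
    P.vertexDist u x ≤ P.vertexDist u v + P.vertexDist v x :=
  floydWarshall_triangle weight_nonneg weight_self _ _ v.2 _ _

theorem vertexDist_le {k} {u v : Fin (4 * P.numRects)}
    (hu : P.vertexPos u ∈ (P.rect k).toSet) (hv : P.vertexPos v ∈ (P.rect k).toSet) :
    P.vertexDist u v ≤ l1Dist (P.vertexPos u) (P.vertexPos v) :=
  (floydWarshall_le _ _ _).trans (weight_of_inBag hu hv).le

/-- This justifies the finite number `farAway` in the role of infinity: no entry of the distance
matrix arises from a missing edge, and a diagonal value of that size blocks no threshold given by a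
distance. -/
theorem vertexDist_lt (u v : Fin (4 * P.numRects)) : P.vertexDist u v < P.farAway := by
  have := dist_le_card_mul exists_vertexPos exists_vertex vertexDist_triangle extent_nonneg
    (fun k u v hu hv => (vertexDist_le hu hv).trans (l1Dist_le_extent hu hv)) u v
  rw [farAway_eq]
  change _ ≤ (P.numRects : ℝ) * _ at this
  linarith

theorem vertexDist_walkLength (u v : Fin (4 * P.numRects)) :
    WalkLength (inBag P.numRects (4 * P.numRects) P.homeIndex)
      (fun u v => l1Dist (P.vertexPos u) (P.vertexPos v)) u v (P.vertexDist u v) := by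
  refine (floydWarshall_cases weight_nonneg (M := P.farAway)
    (R := WalkLength (inBag P.numRects (4 * P.numRects) P.homeIndex)
      (fun u v => l1Dist (P.vertexPos u) (P.vertexPos v)))
    (fun _ _ _ _ _ => WalkLength.trans) (fun u v => ?_) _ le_rfl u v).resolve_right
    (not_le.2 (vertexDist_lt u v))
  rcases weight_cases u v with ⟨k, hu, hv⟩ | h
  · left
    rw [weight_of_inBag ((inBag_iff k u).1 hu) ((inBag_iff k v).1 hv)]
    exact WalkLength.edge (w := fun u v => l1Dist (P.vertexPos u) (P.vertexPos v)) hu hv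
  · exact Or.inr h.ge

theorem Independent.geodesicDist_vertexPos (hP : P.Independent) (u v : Fin (4 * P.numRects)) :
    P.geodesicDist (P.vertexPos u) (P.vertexPos v) = ENNReal.ofReal (P.vertexDist u v) := by
  refine hP.geodesicDist_eq exists_vertexPos exists_vertex vertexDist_self vertexDist_triangle
    (fun k u v => vertexDist_le) (fun k u v hu hv => ?_) (vertexDist_walkLength u v)
  rw [inBag_iff] at hu hv
  exact ((P.rect _).convex.segment_subset hu hv).trans (P.rect_subset _)

theorem HoleFree.passes_iff (hP : P.HoleFree) (δ : ℝ) (A : Fin (4 * P.numRects) → Prop) :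
    P.Passes P.homeIndex δ A ↔ ∃ S, IsSeparatedHitting P.vertexDist δ
      (fun u => A u ∧ δ ≤ P.farAway) (inBag P.numRects (4 * P.numRects) P.homeIndex) S := by
  obtain ⟨T⟩ := hP.exists_bagTree P.rectEquiv vertexPos_injective exists_vertexPos exists_vertex
    inBag_iff
  have := exists_survives_iff T (w := fun u v => l1Dist (P.vertexPos u) (P.vertexPos v)) δ
    (fun u => A u ∧ δ ≤ P.farAway) vertexDist_symm vertexDist_self vertexDist_triangle
    (fun k u v hu hv => vertexDist_le ((inBag_iff k u).1 hu) ((inBag_iff k v).1 hv))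
    vertexDist_walkLength
  rw [Fintype.card_fin] at this
  exact this

theorem exists_inBag (k : Fin P.numRects) :
    ∃ v, inBag P.numRects (4 * P.numRects) P.homeIndex k v := by
  obtain ⟨v, hv⟩ := exists_vertex (P.rectEquiv k) fun _ => false
  exact ⟨v, (inBag_iff k v).2 (hv ▸ Rect.corner_mem _ _)⟩

/-- A minimal set of vertices that passes the maximal threshold is an optimal guard set. -/
theorem isOptimalGuardSet (hI : P.Independent) (hH : P.HoleFree) {A : Fin (4 * P.numRects) → Prop}
    {best : ℝ}
    (hbest : ∀ δ, -1 < δ → P.Passes P.homeIndex δ (fun _ => True) → δ ≤ best)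
    (hA : P.Passes P.homeIndex best A)
    (hmin : ∀ v, A v → ¬ P.Passes P.homeIndex best fun u => A u ∧ u ≠ v) :
    P.IsOptimalGuardSet {p | ∃ v, A v ∧ p = P.vertexPos v} := by
  obtain ⟨S, hSA, hsep, hhit⟩ := (hH.passes_iff _ _).1 hA
  -- A solution `S` inside `A` cannot omit a vertex of `A`, by minimality. So `A` equals `S`, and
  -- the output is itself separated.
  have hAS : ∀ v, A v → v ∈ S := by
    intro v hv
    by_contra hvS
    refine hmin v hv ((hH.passes_iff _ _).2 ⟨S, fun p hp => ⟨⟨(hSA p hp).1, ?_⟩, (hSA p hp).2⟩,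
      hsep, hhit⟩)
    rintro rfl
    exact hvS hp
  refine ⟨(hI.isGuardSet_iff _).2 ⟨?_, fun k => ?_⟩, fun S' hS' => ?_⟩
  · rintro _ ⟨v, -, rfl⟩
    exact exists_vertexPos v
  · obtain ⟨p, hp, hk⟩ := hhit (P.rectEquiv.symm k)
    rw [inBag_iff, Equiv.apply_symm_apply] at hk
    exact ⟨_, ⟨p, (hSA p hp).1, rfl⟩, hk⟩
  refine le_iInf fun p => le_iInf fun hp => le_iInf fun q => le_iInf fun hq => le_iInf fun hpq => ?_
  obtain ⟨a, ha, rfl⟩ := hp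
  obtain ⟨b, hb, rfl⟩ := hq
  have hab : a ≠ b := fun h => hpq (congrArg _ h)
  rw [hI.geodesicDist_vertexPos]
  by_contra! hlt
  obtain ⟨hS'v, hS'k⟩ := (hI.isGuardSet_iff S').1 hS'
  classical
  -- The minimum of `f` is a threshold that the better guard set `S'` attains. The default `farAway`
  -- covers sets with a single guard and keeps the threshold within the admissible bound.
  set f : Fin (4 * P.numRects) × Fin (4 * P.numRects) → ℝ := fun x =>
    if P.vertexPos x.1 ∈ S' ∧ P.vertexPos x.2 ∈ S' ∧ x.1 ≠ x.2 then P.vertexDist x.1 x.2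
    else P.farAway with hf
  have hfgt : ∀ x, P.vertexDist a b < f x := by
    intro x
    simp only [hf]
    split_ifs with h
    · obtain ⟨h1, h2, h3⟩ := h
      have h4 : P.dispersion S' ≤ P.geodesicDist (P.vertexPos x.1) (P.vertexPos x.2) :=
        iInf₂_le_of_le _ h1 (iInf₂_le_of_le _ h2 (iInf_le _ (vertexPos_injective.ne h3)))
      rw [hI.geodesicDist_vertexPos] at h4
      exact (ENNReal.ofReal_lt_ofReal_iff_of_nonneg (vertexDist_nonneg _ _)).1 (hlt.trans_le h4)
    · exact vertexDist_lt a b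
  obtain ⟨x, -, hx⟩ := Finset.exists_min_image Finset.univ f ⟨(a, a), Finset.mem_univ _⟩
  have hpass : P.Passes P.homeIndex (f x) fun _ => True := by
    refine (hH.passes_iff _ _).2 ⟨{v | P.vertexPos v ∈ S'}, fun p _ => ⟨trivial, ?_⟩,
      fun p hp q hq hpq => ?_, fun k => ?_⟩
    · simpa [hf] using hx (a, a) (Finset.mem_univ _)
    · have := hx (p, q) (Finset.mem_univ _)
      rw [show f (p, q) = P.vertexDist p q from if_pos ⟨hp, hq, hpq⟩] at this
      exact this
    · obtain ⟨g, hg, hgk⟩ := hS'k (P.rectEquiv k)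
      obtain ⟨k', c, rfl⟩ := hS'v hg
      obtain ⟨v, hv⟩ := exists_vertex k' c
      exact ⟨v, by simpa [hv] using hg, (inBag_iff k v).2 (hv ▸ hgk)⟩
  have h1 := hbest _ (by linarith [hfgt x, vertexDist_nonneg a b]) hpass
  have h2 := hsep a (hAS a ha) b (hAS b hb) hab
  linarith [hfgt x]

theorem exists_exec (hI : P.Independent) (hH : P.HoleFree) : ∃ (final : State) (t : ℕ),
    Exec guardProgram P.input final t ∧ t ≤ 1000000 * P.numRects ^ 5 ∧
      P.IsOptimalGuardSet final.output := by
  obtain ⟨final, t, A, best, h1, h2, h3, h4, h5, h6⟩ := guardProgram_spec P numRects_pos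
    P.homeIndex (fun v hv => by rw [homeIndex, dif_pos hv]; exact Fin.is_lt _)
    (fun v hv i hi => homeIndex_iff hv hi)
    (fun A A' δ hAA' hA => by
      obtain ⟨S, hS, hS'⟩ := (hH.passes_iff _ _).1 hA
      exact (hH.passes_iff _ _).2 ⟨S, fun p hp => ⟨hAA' p (hS p hp).1, (hS p hp).2⟩, hS'⟩)
    -- Threshold zero is feasible: the set of all vertices meets every bag and distances are
    -- nonnegative.
    ((hH.passes_iff _ _).2 ⟨univ, fun p _ => ⟨trivial, by
      have := vertexDist_lt p p; rw [vertexDist_self] at this; exact this.le⟩,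
      fun p _ q _ _ => vertexDist_nonneg p q, fun k => by simpa using exists_inBag k⟩)
  refine ⟨final, t, h1, h2, ?_⟩
  rw [h6]
  simp only [vertexPos_eq]
  exact isOptimalGuardSet hI hH (fun δ hδ => (h3 δ hδ).2) h4 h5

end OfficePolygon

end Gallery

end

/-! ### The running time in terms of the number of vertices. -/

theorem mainTheorem6 :
    ∃ (prog : Gallery.Program) (K : ℝ), ∀ P : Gallery.OfficePolygon,
      P.Independent → P.HoleFree →
        ∃ (final : Gallery.State) (t : ℕ),
          Gallery.Exec prog P.input final t ∧
          (t : ℝ) ≤ K * (P.numVertices : ℝ) ^ 5 * Real.log (P.numVertices : ℝ) ^ 2 ∧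
          P.IsOptimalGuardSet final.output := by
  refine ⟨Gallery.guardProgram, 1000000, fun P hI hH => ?_⟩
  obtain ⟨final, t, h1, h2, h3⟩ := Gallery.OfficePolygon.exists_exec hI hH
  refine ⟨final, t, h1, ?_, h3⟩
  have hpos := Gallery.OfficePolygon.numRects_pos (P := P)
  have hle := Gallery.OfficePolygon.four_mul_numRects_le (P := P)
  have h4 : (4 : ℝ) ≤ P.numVertices := by exact_mod_cast (by omega : 4 ≤ P.numVertices)
  -- There are at least four vertices and `4` exceeds `e`, so the logarithmic factor is at least one
  -- and the bound of order `n⁵` suffices.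
  have hlog : 1 ≤ Real.log P.numVertices := by
    rw [Real.le_log_iff_exp_le (by linarith)]
    linarith [Real.exp_one_lt_d9]
  have hm : (P.numRects : ℝ) ≤ P.numVertices := by exact_mod_cast (by omega)
  calc (t : ℝ) ≤ 1000000 * (P.numRects : ℝ) ^ 5 := by exact_mod_cast h2
    _ ≤ 1000000 * (P.numVertices : ℝ) ^ 5 := by gcongr
    _ ≤ 1000000 * (P.numVertices : ℝ) ^ 5 * Real.log P.numVertices ^ 2 :=
      le_mul_of_one_le_right (by positivity) (one_le_pow₀ hlog)
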